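/- Let $\mathbb F$ be a non-Archimedean local field of residue characteristic $p$ with real-valued discrete valuation $\upsilon$, let $\mathcal G$ be a connected reductive linear algebraic group over $\mathbb F$, $G=\mathcal G(\mathbb F)$, and let $\mathcal S$ be a maximal $\mathbb F$-split torus of $\mathcal G$ with (relative) root system $\Phi$ and root subgroups $U_a\subset G$, $a\in\Phi$. Together with $Z_G(\mathcal S)$ the groups $U_a$ form a root datum in the sense of Bruhat and Tits. Let $N$ be the group generated by $Z_G(\mathcal S)$ and the classes $M_a$ of this root datum. Let $\varphi=(\varphi_a)_{a\in\Phi}$ be a valuation of this root datum in the sense of Bruhat and Tits, compatible with $\upsilon$, whose groups $U_{a,k}=\{u\in U_a : \varphi_a(u)\ge k\}$, $k\in\mathbb R$, are compact open subgroups of $U_a$; put $U_{a,k+}=\bigcup_{s>k}U_{a,s}$. Let $(H_r)_{r\ge0}$ be a prolongation of $\varphi$ to $\Phi\cup\{0\}$: a decreasing family of compact open subgroups of $Z_G(\mathcal S)$ that are normalised by $N$, are pro-$p$ for $r>0$, and satisfy, with $U_{0,k}:=H_k$, the commutator condition \[ [U_{a,k},U_{b,l}]\subseteq\bigl\langle U_{ia+jb,\,ik+jl}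 : i,j\ge1,\ ia+jb\in\Phi\cup\{0\}\bigr\rangle \] for all $a,b\in\Phi\cup\{0\}$ and $k,l\in\mathbb R$ for which the indices of all groups $U_{0,\cdot}=H_\cdot$ that occur are positive. Put $H_{r+}=\bigcup_{s>r}H_s$. Let $y$ be a point of the apartment $A_S$ of the Bruhat--Tits building (identified, with $\varphi$ as origin, with the real vector space dual to the span of $\Phi$), let $P_y$ be its stabiliser in $G$, let $e\in\mathbb R_{\ge0}$, and let $U_y^{(e)}$ be the subgroup generated by $H_{e+}$ and the groups $U_{a,(e-a(y))+}$, $a\in\Phi$. Let $\alpha\in\Phi$ be reduced (that is, $\alpha/2\notin\Phi$), put $r=-\alpha(y)$, and let $G_\alpha=\langle U_\alpha,U_{-\alpha}\rangle$, $T_\alpha=G_\alpha\cap Z_G(\mathcal S)$ and $T_\alpha^{(s)}=T_\alpha\cap H_{s+}$ for $s\ge0$. Consider the quotient group \[ L=L_{\alpha,e,r}=(P_y\cap G_\alpha)/(U_y^{(e)}\cap G_\alpha). \] For a ring $R$ let $R[L]$ be the group algebra of $L$, and for a subset $Y\subseteq P_y\cap G_\alpha$ with finite image in $L$ let $[Y]\in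 R[L]$ be the sum of the elements of the image of $Y$ in $L$. The inclusion $T_\alpha^{(0)}\subseteq P_y\cap G_\alpha$ induces a homomorphism $R[T_\alpha^{(0)}/T_\alpha^{(e)}]\to R[L]$, through which elements of $R[T_\alpha^{(0)}/T_\alpha^{(e)}]$ are viewed in $R[L]$. The images of $U_{\alpha,r}$, $U_{\alpha,r+}$ and $U_{-\alpha,-r}$ in $L$ are finite, and for $x$ in the image of $U_{\alpha,r+}$ and $\bar x$ in the image of $U_{-\alpha,-r}$ there are unique $\bar u(x,\bar x)$ in the image of $U_{-\alpha,-r}$, $t(x,\bar x)\in T_\alpha^{(0)}/T_\alpha^{(e)}$ and $u(x,\bar x)$ in the image of $U_{\alpha,r+}$ with $x\bar x=\bar u(x,\bar x)\,t(x,\bar x)\,u(x,\bar x)$ in $L$. The element \[ S=\sum_{x,\bar x}[t(x,\bar x)] \] of the group algebra of $T_\alpha^{(0)}/T_\alpha^{(e)}$, where $x$ and $\bar x$ run through these two images, has the following properties. (a) $\bigl([U_{-\alpha,-r}][U_{\alpha,r+}]\bigr)^2=[U_{-\alpha,-r}]\,S\,[U_{\alpha,r+}]$ in $R[L]$ for every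 ring $R$. (b) $S$ belongs to the centre of $R[T_\alpha^{(0)}/T_\alpha^{(e)}]$ for every ring $R$. (c) $[U_{-\alpha,-r}]\,S\,[U_{\alpha,r+}]\in[U_{-\alpha,-r}][U_{\alpha,r}]\,R[L]$ for every ring $R$. (d) If $l\ne p$ is a prime, then $S$ is invertible in $(\mathbb Z/l)[T_\alpha^{(0)}/T_\alpha^{(e)}]$. (e) $S$ is invertible in $\mathbb Z[1/p][T_\alpha^{(0)}/T_\alpha^{(e)}]$, and in $R[T_\alpha^{(0)}/T_\alpha^{(e)}]$ for every ring $R$ in which $p$ is invertible. Moreover, for every ring $R$ in which $p$ is invertible, $[U_{-\alpha,-r}][U_{\alpha,r+}]\in[U_{-\alpha,-r}][U_{\alpha,r}]\,R[L]$. -/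

import Mathlib

open scoped NNReal

noncomputable section

/-! ### Linear algebraic groups as Zariski closed subgroups of `GL_n` -/

namespace LinAlgGroup

section AlgClosed

variable {K : Type*} [Field K] {n : ℕ}

/-- The value of a polynomial in the matrix entries at a matrix. -/
def evalAt (g : Matrix (Fin n) (Fin n) K) (f : MvPolynomial (Fin n × Fin n) K) : K :=
  MvPolynomial.eval (fun ij => g ij.1 ij.2) f

/-- The ideal of all polynomials in the matrix entries that vanish on `X`. -/
def vanishingIdeal (X : Set (GL (Fin n) K)) : Ideal (MvPolynomial (Fin n × Fin n) K) where
  carrier := {f | ∀ g ∈ X, evalAt (g : Matrix (Fin n) (Fin n) K) f = 0}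
  add_mem' := by
    intro f g hf hg x hx
    have h1 := hf x hx
    have h2 := hg x hx
    simp only [evalAt] at h1 h2
    simp [evalAt, h1, h2]
  zero_mem' := by
    intro x _
    simp [evalAt]
  smul_mem' := by
    intro c f hf x hx
    have h1 := hf x hx
    simp only [evalAt] at h1
    simp [evalAt, h1]

/-- `X` is Zariski closed in `GL_n(K)`. -/
def IsZariskiClosed (X : Set (GL (Fin n) K)) : Prop :=
  ∃ E : Set (MvPolynomial (Fin n × Fin n) K),
    X = {g : GL (Fin n) K | ∀ f ∈ E, evalAt (g : Matrix (Fin n) (Fin n) K) f = 0}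

/-- `X` is connected in the Zariski topology of `GL_n(K)`. -/
def IsZariskiConnected (X : Set (GL (Fin n) K)) : Prop :=
  X.Nonempty ∧ ∀ A B : Set (GL (Fin n) K), IsZariskiClosed A → IsZariskiClosed B →
    X ⊆ A ∪ B → X ∩ A ∩ B = ∅ → X ⊆ A ∨ X ⊆ B

/-- All elements of the group are unipotent matrices. -/
def IsUnipotentGroup (X : Subgroup (GL (Fin n) K)) : Prop :=
  ∀ g ∈ X, IsNilpotent ((g : Matrix (Fin n) (Fin n) K) - 1)

/-- The Lie algebra of a closed subgroup of `GL_n`: the tangent space at `1`, cut out by the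
differentials at `1` of the polynomials that vanish on the group. -/
def lieAlgebra (X : Subgroup (GL (Fin n) K)) : Submodule K (Matrix (Fin n) (Fin n) K) where
  carrier := {A | ∀ f ∈ vanishingIdeal (X : Set (GL (Fin n) K)),
    ∑ ij : Fin n × Fin n,
      A ij.1 ij.2 * evalAt (1 : Matrix (Fin n) (Fin n) K) (MvPolynomial.pderiv ij f) = 0}
  add_mem' := by
    intro A B hA hB f hf
    have h1 := hA f hf
    have h2 := hB f hf
    simp [add_mul, Finset.sum_add_distrib, h1, h2]
  zero_mem' := by
    intro f _
    simp
  smul_mem' := by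
    intro c A hA f hf
    have h1 := hA f hf
    simp [mul_assoc, ← Finset.mul_sum, h1]

/-- The weight space of weight `χ` of the adjoint action of `S` on the Lie algebra of `𝒢`. -/
def weightSpace (𝒢 S : Subgroup (GL (Fin n) K)) (χ : S →* Kˣ) :
    Submodule K (Matrix (Fin n) (Fin n) K) where
  carrier := {A | A ∈ lieAlgebra 𝒢 ∧ ∀ s : S,
    (s.1 : Matrix (Fin n) (Fin n) K) * A * ((s.1⁻¹ : GL (Fin n) K) : Matrix (Fin n) (Fin n) K)
      = (χ s : K) • A}
  add_mem' := by
    intro A B hA hB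
    refine ⟨add_mem hA.1 hB.1, fun s => ?_⟩
    rw [mul_add, add_mul, hA.2 s, hB.2 s, smul_add]
  zero_mem' := ⟨zero_mem _, fun s => by simp⟩
  smul_mem' := by
    intro c A hA
    refine ⟨Submodule.smul_mem _ c hA.1, fun s => ?_⟩
    rw [Matrix.mul_smul, Matrix.smul_mul, hA.2 s, smul_comm]

/-- `χ` is a root of `𝒢` with respect to the torus `S`: a nontrivial weight on `Lie 𝒢`. -/
def IsRoot (𝒢 S : Subgroup (GL (Fin n) K)) (χ : S →* Kˣ) : Prop :=
  χ ≠ 1 ∧ weightSpace 𝒢 S χ ≠ ⊥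

/-- The centraliser of `S` in `𝒢`. -/
def centralizerIn (𝒢 S : Subgroup (GL (Fin n) K)) : Subgroup (GL (Fin n) K) :=
  𝒢 ⊓ Subgroup.centralizer (S : Set (GL (Fin n) K))

/-- `X` is the root subgroup of `𝒢` for the root `χ` of `S`: the unique closed connected unipotent
subgroup that is normalised by `Z_𝒢(S)` and whose Lie algebra is the sum of the root spaces for the
positive multiples of `χ` (only `χ` and `2χ`, here written multiplicatively, can be roots). -/
structure IsRootSubgroup (𝒢 S : Subgroup (GL (Fin n) K)) (χ : S →* Kˣ)
    (X : Subgroup (GL (Fin n) K)) : Prop where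
  le : X ≤ 𝒢
  closed : IsZariskiClosed (X : Set (GL (Fin n) K))
  connected : IsZariskiConnected (X : Set (GL (Fin n) K))
  unipotent : IsUnipotentGroup X
  normalised : ∀ z ∈ centralizerIn 𝒢 S, ∀ x ∈ X, z * x * z⁻¹ ∈ X
  lie : lieAlgebra X = weightSpace 𝒢 S χ ⊔ weightSpace 𝒢 S (χ ^ 2)

end AlgClosed

section Rational

variable (F : Type*) [Field F] {n : ℕ}

/-- A Zariski closed set is defined over `F` if its ideal is generated by polynomials over `F`. -/
def IsDefinedOver (X : Set (GL (Fin n) (AlgebraicClosure F))) : Prop :=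
  vanishingIdeal X = Ideal.span {f | f ∈ vanishingIdeal X ∧
    f ∈ Set.range (MvPolynomial.map (σ := Fin n × Fin n) (algebraMap F (AlgebraicClosure F)))}

/-- `𝒢` is a connected reductive linear algebraic group defined over `F`. -/
structure IsConnectedReductive (𝒢 : Subgroup (GL (Fin n) (AlgebraicClosure F))) : Prop where
  closed : IsZariskiClosed (𝒢 : Set (GL (Fin n) (AlgebraicClosure F)))
  definedOver : IsDefinedOver F (𝒢 : Set (GL (Fin n) (AlgebraicClosure F)))
  connected : IsZariskiConnected (𝒢 : Set (GL (Fin n) (AlgebraicClosure F)))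
  unipotentRadical_trivial : ∀ X : Subgroup (GL (Fin n) (AlgebraicClosure F)), X ≤ 𝒢 →
    IsZariskiClosed (X : Set (GL (Fin n) (AlgebraicClosure F))) →
    IsZariskiConnected (X : Set (GL (Fin n) (AlgebraicClosure F))) →
    IsUnipotentGroup X → (∀ g ∈ 𝒢, ∀ x ∈ X, g * x * g⁻¹ ∈ X) → X = ⊥

/-- The map `GL_n(F) → GL_n(F̄)`. -/
def toClosure : GL (Fin n) F →* GL (Fin n) (AlgebraicClosure F) :=
  Matrix.GeneralLinearGroup.map (algebraMap F (AlgebraicClosure F))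

/-- The group `𝒢(F)` of `F`-rational points. -/
def rationalPoints (𝒢 : Subgroup (GL (Fin n) (AlgebraicClosure F))) : Subgroup (GL (Fin n) F) :=
  𝒢.comap (toClosure F)

/-- For a subgroup `X` of `𝒢`, the `F`-rational points of `X` as a subgroup of `𝒢(F)`. -/
def rationalSubgroup (𝒢 X : Subgroup (GL (Fin n) (AlgebraicClosure F))) :
    Subgroup (rationalPoints F 𝒢) :=
  X.comap ((toClosure F).comp (rationalPoints F 𝒢).subtype)

/-- `S` is an `F`-split torus: a closed connected group that is conjugate by an element of
`GL_n(F)` to a group of diagonal matrices (such a group is automatically defined over `F`). -/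
structure IsSplitTorus (S : Subgroup (GL (Fin n) (AlgebraicClosure F))) : Prop where
  closed : IsZariskiClosed (S : Set (GL (Fin n) (AlgebraicClosure F)))
  connected : IsZariskiConnected (S : Set (GL (Fin n) (AlgebraicClosure F)))
  diagonalisable : ∃ g : GL (Fin n) F, ∀ s ∈ S, Matrix.IsDiag
    ((toClosure F g * s * (toClosure F g)⁻¹ : GL (Fin n) (AlgebraicClosure F)) :
      Matrix (Fin n) (Fin n) (AlgebraicClosure F))

/-- `S` is a maximal `F`-split torus of `𝒢`. -/
structure IsMaximalSplitTorus (𝒢 S : Subgroup (GL (Fin n) (AlgebraicClosure F))) : Prop where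
  splitTorus : IsSplitTorus F S
  le : S ≤ 𝒢
  maximal : ∀ S' : Subgroup (GL (Fin n) (AlgebraicClosure F)),
    IsSplitTorus F S' → S' ≤ 𝒢 → S ≤ S' → S' = S

end Rational

/-- The root system `P` (in a real vector space) is the root system of `(𝒢, S)`; the character of
`S` that belongs to the index `a` is `χ a`.  The second condition says that `χ a ↦ P.root a`
extends to an isomorphism between the lattices generated by the roots. -/
structure IsRelativeRootSystem {K : Type*} [Field K] {n : ℕ} (𝒢 S : Subgroup (GL (Fin n) K))
    {ι V W : Type*} [AddCommGroup V] [Module ℝ V] [AddCommGroup W] [Module ℝ W]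
    (P : RootPairing ι ℝ V W) (χ : ι → (S →* Kˣ)) : Prop where
  range_eq : Set.range χ = {ψ | IsRoot 𝒢 S ψ}
  relations : ∀ c : ι →₀ ℤ,
    (c.sum fun a m => m • P.root a) = 0 ↔ (c.prod fun a m => χ a ^ m) = 1

end LinAlgGroup

/-! ### Valuated root data in the sense of Bruhat and Tits -/

namespace BruhatTits

section RootData

variable {ι V W : Type*} [AddCommGroup V] [Module ℝ V] [AddCommGroup W] [Module ℝ W]

/-- The index of the root `-a`. -/
def negIdx (P : RootPairing ι ℝ V W) (a : ι) : ι := P.reflectionPerm a a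

/-- `b` is not a negative multiple of `a`. -/
def NotOpposite (P : RootPairing ι ℝ V W) (a b : ι) : Prop :=
  ∀ c : ℝ, 0 ≤ c → P.root b ≠ -(c • P.root a)

/-- A root datum `(T, (U_a, M_a))` of type `P` in the group `Γ`. -/
structure GroupRootDatum (P : RootPairing ι ℝ V W) (Γ : Type*) [Group Γ] where
  T : Subgroup Γ
  U : ι → Subgroup Γ
  M : ι → Set Γ
  U_ne_bot : ∀ a, U a ≠ ⊥
  commutator_le : ∀ a b, NotOpposite P a b →
    ⁅U a, U b⁆ ≤ ⨆ (c : ι) (_ : ∃ i j : ℕ, 0 < i ∧ 0 < j ∧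
      P.root c = i • P.root a + j • P.root b), U c
  double_lt : ∀ a b, P.root b = (2 : ℕ) • P.root a → U b < U a
  M_coset : ∀ a, ∃ m, M a = {g | ∃ t ∈ T, g = t * m}
  subset_UMU : ∀ a, ∀ u ∈ U (negIdx P a), u ≠ 1 →
    ∃ v ∈ U a, ∃ m ∈ M a, ∃ v' ∈ U a, u = v * m * v'
  conj_U : ∀ a b, ∀ m ∈ M a, (U b).map (MulAut.conj m).toMonoidHom = U (P.reflectionPerm a b)
  /-- for every system of positive roots, given by a regular linear functional,
  `T U⁺ ∩ U⁻ = {1}` -/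
  triangular : ∀ f : W, (∀ a, P.toLinearMap (P.root a) f ≠ 0) → ∀ t ∈ T,
    ∀ u ∈ ⨆ (a : ι) (_ : 0 < P.toLinearMap (P.root a) f), U a,
    t * u ∈ ⨆ (a : ι) (_ : P.toLinearMap (P.root a) f < 0), U a → t * u = 1

variable {P : RootPairing ι ℝ V W} {Γ : Type*} [Group Γ]

/-- The group `N` generated by `T` and the cosets `M_a`. -/
def GroupRootDatum.N (D : GroupRootDatum P Γ) : Subgroup Γ :=
  D.T ⊔ Subgroup.closure (⋃ a, D.M a)

/-- The first axiom of a valuation: `val` defines a decreasing separated filtration of `X` by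
subgroups.  The function is only relevant on `X`. -/
structure IsGroupValuation (X : Subgroup Γ) (val : Γ → WithTop ℝ) : Prop where
  eq_top_iff : ∀ x ∈ X, val x = ⊤ ↔ x = 1
  le_mul : ∀ x ∈ X, ∀ y ∈ X, min (val x) (val y) ≤ val (x * y)
  inv : ∀ x ∈ X, val x⁻¹ = val x

/-- `{x ∈ X | k ≤ val x}` -/
def IsGroupValuation.level {X : Subgroup Γ} {val : Γ → WithTop ℝ} (h : IsGroupValuation X val)
    (k : ℝ) : Subgroup Γ where
  carrier := {x | x ∈ X ∧ (k : WithTop ℝ) ≤ val x}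
  mul_mem' := fun {x y} hx hy => ⟨mul_mem hx.1 hy.1, (le_min hx.2 hy.2).trans
    (h.le_mul x hx.1 y hy.1)⟩
  one_mem' := ⟨one_mem _, by rw [(h.eq_top_iff 1 (one_mem _)).2 rfl]; exact le_top⟩
  inv_mem' := fun {x} hx => ⟨inv_mem hx.1, by rw [h.inv x hx.1]; exact hx.2⟩

/-- `{x ∈ X | k < val x}` -/
def IsGroupValuation.levelPlus {X : Subgroup Γ} {val : Γ → WithTop ℝ} (h : IsGroupValuation X val)
    (k : ℝ) : Subgroup Γ where
  carrier := {x | x ∈ X ∧ (k : WithTop ℝ) < val x}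
  mul_mem' := fun {x y} hx hy => ⟨mul_mem hx.1 hy.1, (lt_min hx.2 hy.2).trans_le
    (h.le_mul x hx.1 y hy.1)⟩
  one_mem' := ⟨one_mem _, by
    rw [(h.eq_top_iff 1 (one_mem _)).2 rfl]; exact WithTop.coe_lt_top k⟩
  inv_mem' := fun {x} hx => ⟨inv_mem hx.1, by rw [h.inv x hx.1]; exact hx.2⟩

/-- A valuation `φ = (φ_a)` of a root datum. -/
structure RootDatumValuation (D : GroupRootDatum P Γ) where
  val : ι → Γ → WithTop ℝ
  nontrivial : ∀ a, ∃ u ∈ D.U a, ∃ v ∈ D.U a, u ≠ 1 ∧ v ≠ 1 ∧ val a u ≠ val a v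
  isGroupValuation : ∀ a, IsGroupValuation (D.U a) (val a)
  conj_M : ∀ a, ∀ m ∈ D.M a, ∃ c : ℝ, ∀ u ∈ D.U (negIdx P a), u ≠ 1 →
    val (negIdx P a) u = val a (m * u * m⁻¹) + c
  commutator_le : ∀ a b, NotOpposite P a b → ∀ k l : ℝ,
    ⁅(isGroupValuation a).level k, (isGroupValuation b).level l⁆ ≤
      ⨆ (c : ι) (i : ℕ) (j : ℕ) (_ : 0 < i ∧ 0 < j ∧ P.root c = i • P.root a + j • P.root b),
        (isGroupValuation c).level (i * k + j * l)
  double : ∀ a b, P.root b = (2 : ℕ) • P.root a → ∀ u ∈ D.U b, val b u = val a u + val a u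
  val_add_val : ∀ a, ∀ u ∈ D.U a, ∀ u' ∈ D.U (negIdx P a), ∀ u'' ∈ D.U (negIdx P a),
    u' * u * u'' ∈ D.M a → val (negIdx P a) u' + val a u = 0

/-- The group `U_{a,k}`. -/
def RootDatumValuation.filt {D : GroupRootDatum P Γ} (φ : RootDatumValuation D) (a : ι) (k : ℝ) :
    Subgroup Γ := (φ.isGroupValuation a).level k

/-- The group `U_{a,k+}`, the union of the groups `U_{a,s}` for `s > k`. -/
def RootDatumValuation.filtPlus {D : GroupRootDatum P Γ} (φ : RootDatumValuation D) (a : ι)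
    (k : ℝ) : Subgroup Γ := (φ.isGroupValuation a).levelPlus k

/-- The elements of `Φ ∪ {0}`; the index `none` stands for `0`. -/
def extRoot (P : RootPairing ι ℝ V W) : Option ι → V
  | some a => P.root a
  | none => 0

/-- The groups `U_{a,k}` for `a ∈ Φ ∪ {0}`, where `U_{0,k} = H_k`. -/
def extFilt {D : GroupRootDatum P Γ} (φ : RootDatumValuation D) (H : ℝ → Subgroup Γ) :
    Option ι → ℝ → Subgroup Γ
  | some a, k => φ.filt a k
  | none, k => H k

/-- A prolongation of the valuation `φ` to `Φ ∪ {0}`: a decreasing filtration `(H_r)_{r ≥ 0}` of a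
subgroup of `T` by subgroups that are normalised by `N`, such that the commutator condition
for a valuation extends to all `a, b ∈ Φ ∪ {0}`, opposite roots included, whenever the groups `H_r`
that occur in it have positive index.  (The values of `H` at negative numbers are irrelevant.) -/
structure Prolongation {D : GroupRootDatum P Γ} (φ : RootDatumValuation D) where
  H : ℝ → Subgroup Γ
  le_T : ∀ r, 0 ≤ r → H r ≤ D.T
  anti : ∀ r s, 0 ≤ r → r ≤ s → H s ≤ H r
  conj_N : ∀ r, 0 ≤ r → ∀ g ∈ D.N, ∀ h ∈ H r, g * h * g⁻¹ ∈ H r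
  commutator_le : ∀ (a b : Option ι) (k l : ℝ), (a = none → 0 < k) → (b = none → 0 < l) →
    (∀ i j : ℕ, 0 < i → 0 < j → i • extRoot P a + j • extRoot P b = 0 → 0 < i * k + j * l) →
    ⁅extFilt φ H a k, extFilt φ H b l⁆ ≤
      ⨆ (c : Option ι) (i : ℕ) (j : ℕ)
        (_ : 0 < i ∧ 0 < j ∧ extRoot P c = i • extRoot P a + j • extRoot P b),
        extFilt φ H c (i * k + j * l)

namespace Prolongation

variable {D : GroupRootDatum P Γ} {φ : RootDatumValuation D} (E : Prolongation φ)

/-- `H_{r+}`, the union of the groups `H_s` for `s > r`. -/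
def Hplus (r : ℝ) : Subgroup Γ := ⨆ s : Set.Ioi r, E.H s

/-- The group `U_y^{(e)}` for a point `y` of the apartment.  The apartment is identified with the
coweight space `W`, the point `y ∈ W` being the valuation `φ + y`. -/
def pointGroup (y : W) (e : ℝ≥0) : Subgroup Γ :=
  E.Hplus e ⊔ ⨆ a, φ.filtPlus a (e - P.toLinearMap (P.root a) y)

end Prolongation

/-- The element `g` of `N` fixes the point `y` of the apartment, that is, it fixes the valuation
`φ + y`: it permutes the root groups and preserves their filtrations by
`φ_a + a(y)`. -/
def RootDatumValuation.FixesPoint {D : GroupRootDatum P Γ} (φ : RootDatumValuation D) (y : W)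
    (g : Γ) : Prop :=
  g ∈ D.N ∧ ∃ w : Equiv.Perm ι, ∀ (a : ι) (k : ℝ),
    (φ.filt a (k - P.toLinearMap (P.root a) y)).map (MulAut.conj g).toMonoidHom =
      φ.filt (w a) (k - P.toLinearMap (P.root (w a)) y)

/-- The stabiliser `P_y` of the point `y` in the Bruhat–Tits building.  The building is the
quotient of `Γ × W` by the relation `(g, x) ∼ (h, x')` if there is `n ∈ N` with `n x = x'` and
`g⁻¹ h n ∈ U_x`, where `U_x` is generated by the groups `U_{a,-a(x)}`; so the stabiliser of the
class of `(1, y)` is `N_y U_y`, where `N_y` is the stabiliser of `y` in `N`. -/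
def RootDatumValuation.stab {D : GroupRootDatum P Γ} (φ : RootDatumValuation D) (y : W) :
    Subgroup Γ :=
  Subgroup.closure ({g | φ.FixesPoint y g} ∪
    ⋃ a, (φ.filt a (-P.toLinearMap (P.root a) y) : Set Γ))

/-- The group `G_α` generated by `U_α` and `U_{-α}`. -/
def GroupRootDatum.rankOne (D : GroupRootDatum P Γ) (α : ι) : Subgroup Γ :=
  D.U α ⊔ D.U (negIdx P α)

/-! Facts needed to form the quotient groups -/

section Facts

variable {D : GroupRootDatum P Γ} {φ : RootDatumValuation D}

lemma mem_filtPlus_iff {a : ι} {k : ℝ} {x : Γ} :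
    x ∈ φ.filtPlus a k ↔ ∃ l, k < l ∧ x ∈ φ.filt a l := by
  constructor
  · rintro ⟨hx, hk⟩
    rcases h : φ.val a x with _ | l
    · refine ⟨k + 1, by linarith, hx, ?_⟩
      rw [h]; exact le_top
    · refine ⟨l, ?_, hx, ?_⟩
      · rw [h] at hk; exact WithTop.coe_lt_coe.1 hk
      · rw [h]; exact le_rfl
  · rintro ⟨l, hl, hx, h⟩
    exact ⟨hx, (WithTop.coe_lt_coe.2 hl).trans_le h⟩

lemma filt_anti {a : ι} {k l : ℝ} (h : k ≤ l) : φ.filt a l ≤ φ.filt a k :=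
  fun _ hx => ⟨hx.1, (WithTop.coe_le_coe.2 h).trans hx.2⟩

lemma FixesPoint.inv {y : W} {g : Γ} (h : φ.FixesPoint y g) : φ.FixesPoint y g⁻¹ := by
  obtain ⟨hN, w, hw⟩ := h
  refine ⟨inv_mem hN, w⁻¹, fun a k => ?_⟩
  have h1 := hw (w⁻¹ a) k
  have h2 : w (w⁻¹ a) = a := w.apply_symm_apply a
  rw [h2] at h1
  rw [← h1]
  ext x
  simp only [Subgroup.mem_map]
  constructor
  · rintro ⟨_, ⟨z, hz, rfl⟩, rfl⟩
    simpa [mul_assoc] using hz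
  · intro hx
    exact ⟨_, ⟨x, hx, rfl⟩, by simp [mul_assoc]⟩

namespace Prolongation

variable (E : Prolongation φ)

lemma H_le_Hplus {r s : ℝ} (h : r < s) : E.H s ≤ E.Hplus r :=
  le_iSup (fun s : Set.Ioi r => E.H s) ⟨s, h⟩

lemma conj_mem_Hplus {r : ℝ} (hr : 0 ≤ r) {g : Γ} (hg : g ∈ D.N) {h : Γ} (hh : h ∈ E.Hplus r) :
    g * h * g⁻¹ ∈ E.Hplus r := by
  have : E.Hplus r ≤ (E.Hplus r).comap (MulAut.conj g).toMonoidHom := by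
    refine iSup_le fun s x hx => ?_
    exact E.H_le_Hplus s.2 (E.conj_N _ (hr.trans (le_of_lt s.2)) g hg x hx)
  exact this hh

lemma extFilt_le_pointGroup {y : W} {e : ℝ≥0} {c : Option ι} {l : ℝ}
    (h : e - P.toLinearMap (extRoot P c) y < l) : extFilt φ E.H c l ≤ E.pointGroup y e := by
  cases c with
  | none =>
    have h' : (e : ℝ) < l := by simpa [extRoot] using h
    exact (E.H_le_Hplus h').trans le_sup_left
  | some a =>
    refine le_trans ?_ ((le_iSup (fun a => φ.filtPlus a (e - P.toLinearMap (P.root a) y)) a).trans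
      le_sup_right)
    intro x hx
    exact mem_filtPlus_iff.2 ⟨l, h, hx⟩

/-- Induction on generators of `U_y^{(e)}`. -/
lemma pointGroup_le {y : W} {e : ℝ≥0} {X : Subgroup Γ}
    (h : ∀ (c : Option ι) (l : ℝ), e - P.toLinearMap (extRoot P c) y < l →
      extFilt φ E.H c l ≤ X) : E.pointGroup y e ≤ X := by
  refine sup_le (iSup_le fun s => ?_) (iSup_le fun a x hx => ?_)
  · exact h none s (by simpa [extRoot] using Set.mem_Ioi.1 s.2)
  · obtain ⟨l, hl, hx⟩ := mem_filtPlus_iff.1 hx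
    exact h (some a) l hl hx

lemma conj_mem_of_fixesPoint {y : W} {e : ℝ≥0} {g : Γ} (hg : φ.FixesPoint y g) {x : Γ}
    (hx : x ∈ E.pointGroup y e) : g * x * g⁻¹ ∈ E.pointGroup y e := by
  have : E.pointGroup y e ≤ (E.pointGroup y e).comap (MulAut.conj g).toMonoidHom := by
    refine E.pointGroup_le fun c l hl x hx => ?_
    cases c with
    | none =>
      have h' : (e : ℝ) < l := by simpa [extRoot] using hl
      exact E.extFilt_le_pointGroup (c := none) hl
        (E.conj_N l (e.2.trans h'.le) g hg.1 x hx)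
    | some a =>
      obtain ⟨_, w, hw⟩ := hg
      have h1 := hw a (l + P.toLinearMap (P.root a) y)
      rw [add_sub_cancel_right] at h1
      have h2 : g * x * g⁻¹ ∈ φ.filt (w a)
          (l + P.toLinearMap (P.root a) y - P.toLinearMap (P.root (w a)) y) := by
        rw [← h1]; exact ⟨x, hx, rfl⟩
      refine E.extFilt_le_pointGroup (c := some (w a)) ?_ h2
      simp only [extRoot] at hl ⊢
      linarith
  exact this hx

lemma conj_mem_of_filt {y : W} {e : ℝ≥0} {a : ι} {g : Γ}
    (hg : g ∈ φ.filt a (-P.toLinearMap (P.root a) y)) {x : Γ}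
    (hx : x ∈ E.pointGroup y e) : g * x * g⁻¹ ∈ E.pointGroup y e := by
  have : E.pointGroup y e ≤ (E.pointGroup y e).comap (MulAut.conj g).toMonoidHom := by
    refine E.pointGroup_le fun b l hl x hx => ?_
    have he : (0 : ℝ) ≤ e := e.2
    have key : ∀ i j : ℕ, 0 < i → 0 < j → (e : ℝ) -
        P.toLinearMap (i • extRoot P (some a) + j • extRoot P b) y <
        i * (-P.toLinearMap (P.root a) y) + j * l := by
      intro i j _ hj
      have hj' : (1 : ℝ) ≤ j := by exact_mod_cast hj
      have h1 : (j : ℝ) * (e - P.toLinearMap (extRoot P b) y) < j * l :=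
        mul_lt_mul_of_pos_left hl (by linarith)
      have h2 : (e : ℝ) ≤ j * e := by nlinarith
      simp only [extRoot, map_add, map_nsmul, LinearMap.add_apply, LinearMap.smul_apply,
        nsmul_eq_mul] at h1 ⊢
      linarith
    have hc := E.commutator_le (some a) b (-P.toLinearMap (P.root a) y) l (by simp)
      (by
        rintro rfl
        have h' : (e : ℝ) < l := by simpa [extRoot] using hl
        linarith)
      (by
        intro i j hi hj h0
        have := key i j hi hj
        rw [h0] at this
        simp only [map_zero, LinearMap.zero_apply, sub_zero] at this
        linarith)
    have hm : g * x * g⁻¹ * x⁻¹ ∈ E.pointGroup y e := by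
      refine (hc.trans ?_) (Subgroup.commutator_mem_commutator hg hx)
      refine iSup_le fun c => iSup_le fun i => iSup_le fun j => iSup_le fun h => ?_
      refine E.extFilt_le_pointGroup ?_
      rw [h.2.2]
      exact key i j h.1 h.2.1
    have h3 := mul_mem hm (E.extFilt_le_pointGroup hl hx)
    simpa [mul_assoc] using h3
  exact this hx

lemma stab_le_normalizer (y : W) (e : ℝ≥0) :
    φ.stab y ≤ Subgroup.normalizer (E.pointGroup y e : Set Γ) := by
  have key : ∀ g ∈ ({g | φ.FixesPoint y g} ∪
      ⋃ a, (φ.filt a (-P.toLinearMap (P.root a) y) : Set Γ)),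
      ∀ x ∈ E.pointGroup y e, g * x * g⁻¹ ∈ E.pointGroup y e := by
    rintro g (hg | hg) x hx
    · exact E.conj_mem_of_fixesPoint hg hx
    · obtain ⟨a, hg⟩ := Set.mem_iUnion.1 hg
      exact E.conj_mem_of_filt hg hx
  refine (Subgroup.closure_le _).2 fun g hg => ?_
  refine Subgroup.mem_normalizer_iff.2 fun x => ⟨key g hg x, fun hx => ?_⟩
  have hg' : g⁻¹ ∈ ({g | φ.FixesPoint y g} ∪
      ⋃ a, (φ.filt a (-P.toLinearMap (P.root a) y) : Set Γ)) := by
    rcases hg with hg | hg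
    · exact Or.inl (FixesPoint.inv hg)
    · obtain ⟨a, hg⟩ := Set.mem_iUnion.1 hg
      exact Or.inr (Set.mem_iUnion.2 ⟨a, inv_mem hg⟩)
  simpa [mul_assoc] using key _ hg' _ hx

lemma conj_mem_filt [P.IsCrystallographic] {s : ℝ} (hs : 0 < s) {h : Γ} (hh : h ∈ E.H s) {a : ι} {k : ℝ} {x : Γ}
    (hx : x ∈ φ.filt a k) : h * x * h⁻¹ ∈ φ.filt a k := by
  have hc := E.commutator_le none (some a) s k (fun _ => hs) (by simp) (by
    intro i j _ hj h0
    exfalso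
    simp only [extRoot, smul_zero, zero_add] at h0
    have : (j : ℕ) • P.root a = 0 := h0
    rw [← Nat.cast_smul_eq_nsmul ℝ] at this
    rcases smul_eq_zero.1 this with h1 | h1
    · have : j = 0 := by exact_mod_cast h1
      omega
    · exact P.ne_zero a h1)
  have hm : h * x * h⁻¹ * x⁻¹ ∈ φ.filt a k := by
    refine (hc.trans ?_) (Subgroup.commutator_mem_commutator
      (show h ∈ extFilt φ E.H none s from hh) (show x ∈ extFilt φ E.H (some a) k from hx))
    refine iSup_le fun c => iSup_le fun i => iSup_le fun j => iSup_le fun hij => ?_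
    obtain ⟨hi, hj, hc⟩ := hij
    have hi' : (1 : ℝ) ≤ i := by exact_mod_cast hi
    have hj' : (1 : ℝ) ≤ j := by exact_mod_cast hj
    have hpos : 0 < (i : ℝ) * s := by positivity
    simp only [extRoot, smul_zero, zero_add] at hc
    cases c with
    | none =>
      exfalso
      have : (j : ℕ) • P.root a = 0 := hc.symm
      rw [← Nat.cast_smul_eq_nsmul ℝ] at this
      rcases smul_eq_zero.1 this with h1 | h1
      · have : j = 0 := by exact_mod_cast h1
        omega
      · exact P.ne_zero a h1
    | some c =>
      have hpair : P.pairing a c * j = 2 := by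
        have h2 := P.root_coroot_two c
        rw [show P.root c = j • P.root a from hc, map_nsmul, LinearMap.smul_apply, nsmul_eq_mul, P.root_coroot_eq_pairing] at h2
        linarith
      obtain ⟨z, hz⟩ := P.exists_value (S := ℤ) a c
      have hzj : z * j = 2 := by
        rw [← hz] at hpair
        have : ((z * j : ℤ) : ℝ) = ((2 : ℤ) : ℝ) := by
          push_cast
          simpa using hpair
        exact_mod_cast this
      have hj2 : (j : ℤ) ≤ 2 := Int.le_of_dvd (by norm_num) ⟨z, by linarith⟩
      have hj3 : j = 1 ∨ j = 2 := by omega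
      rcases hj3 with rfl | rfl
      · have hca : c = a := P.root.injective (by simpa using hc)
        subst hca
        exact filt_anti (by simp; linarith)
      · intro u hu
        have hua : u ∈ D.U a := (D.double_lt a c hc).le hu.1
        refine ⟨hua, ?_⟩
        have h4 := hu.2
        rw [φ.double a c hc u hu.1] at h4
        rcases hv : φ.val a u with _ | v
        · exact le_top
        · rw [hv] at h4
          have h5 : (i : ℝ) * s + ((2 : ℕ) : ℝ) * k ≤ v + v := WithTop.coe_le_coe.1 h4
          refine WithTop.coe_le_coe.2 ?_
          push_cast at h5
          linarith
  have h3 := mul_mem hm hx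
  simpa [mul_assoc] using h3

lemma fixesPoint_of_mem_H [P.IsCrystallographic] {s : ℝ} (hs : 0 < s) {h : Γ} (hh : h ∈ E.H s)
    (y : W) : φ.FixesPoint y h := by
  refine ⟨le_sup_left (a := D.T) (E.le_T s hs.le hh), 1, fun a k => ?_⟩
  refine le_antisymm ?_ fun x hx => ?_
  · rintro _ ⟨x, hx, rfl⟩
    exact E.conj_mem_filt hs hh hx
  · refine ⟨h⁻¹ * x * h, ?_, by simp [mul_assoc]⟩
    simpa using E.conj_mem_filt hs (inv_mem hh) hx

lemma Hplus_le_stab [P.IsCrystallographic] (y : W) : E.Hplus 0 ≤ φ.stab y :=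
  iSup_le fun s _ hx => Subgroup.subset_closure (Or.inl (E.fixesPoint_of_mem_H s.2 hx y))

end Prolongation

end Facts

/-! ### The finite subquotient of rank one -/

namespace Prolongation

variable {D : GroupRootDatum P Γ} {φ : RootDatumValuation D} (E : Prolongation φ)

/-- The group `T_α^{(e)} = T_α ∩ H_{e+}`, where `T_α = G_α ∩ T`. -/
def torusFilt (α : ι) (e : ℝ≥0) : Subgroup Γ := D.rankOne α ⊓ D.T ⊓ E.Hplus e

lemma Hplus_anti {r s : ℝ} (h : r ≤ s) : E.Hplus s ≤ E.Hplus r :=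
  iSup_le fun t => E.H_le_Hplus (h.trans_lt t.2)

instance torusFilt_normal (α : ι) (e : ℝ≥0) :
    ((E.torusFilt α e).subgroupOf (E.torusFilt α 0)).Normal where
  conj_mem := by
    rintro ⟨x, _⟩ hx ⟨g, hg⟩
    have hx' : x ∈ E.torusFilt α e := hx
    change g * x * g⁻¹ ∈ E.torusFilt α e
    exact ⟨Subgroup.mul_mem _ (Subgroup.mul_mem _ hg.1 hx'.1) (Subgroup.inv_mem _ hg.1),
      E.conj_mem_Hplus e.2 (le_sup_left (a := D.T) hg.1.2) hx'.2⟩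

/-- The group `T_α^{(0)} / T_α^{(e)}`. -/
abbrev TorusQuot (α : ι) (e : ℝ≥0) : Type _ :=
  E.torusFilt α 0 ⧸ (E.torusFilt α e).subgroupOf (E.torusFilt α 0)

/-- The group `U_y^{(e)} ∩ G_α`, as a subgroup of `P_y ∩ G_α`. -/
def pointGroupIn (α : ι) (y : W) (e : ℝ≥0) :
    Subgroup (φ.stab y ⊓ D.rankOne α : Subgroup Γ) :=
  (E.pointGroup y e).subgroupOf (φ.stab y ⊓ D.rankOne α)

instance pointGroupIn_normal (α : ι) (y : W) (e : ℝ≥0) : (E.pointGroupIn α y e).Normal where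
  conj_mem := by
    rintro ⟨x, _⟩ hx ⟨g, hg⟩
    exact (Subgroup.mem_normalizer_iff.1 (E.stab_le_normalizer y e hg.1) x).1 hx

/-- The group `L_{α,e,r} = (P_y ∩ G_α) / (U_y^{(e)} ∩ G_α)`, where `r = -α(y)`. -/
abbrev L (α : ι) (y : W) (e : ℝ≥0) : Type _ :=
  (φ.stab y ⊓ D.rankOne α : Subgroup Γ) ⧸ E.pointGroupIn α y e

/-- The image of a subgroup of `P_y ∩ G_α` in `L_{α,e,r}`. -/
def imageL (α : ι) (y : W) (e : ℝ≥0) (X : Subgroup Γ) : Subgroup (E.L α y e) :=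
  (X.subgroupOf (φ.stab y ⊓ D.rankOne α)).map (QuotientGroup.mk' (E.pointGroupIn α y e))

/-- The image of `U_{α,r}` in `L_{α,e,r}`, where `r = -α(y)`. -/
def imU (α : ι) (y : W) (e : ℝ≥0) : Subgroup (E.L α y e) :=
  E.imageL α y e (φ.filt α (-P.toLinearMap (P.root α) y))

/-- The image of `U_{α,r+}` in `L_{α,e,r}`, where `r = -α(y)`. -/
def imUplus (α : ι) (y : W) (e : ℝ≥0) : Subgroup (E.L α y e) :=
  E.imageL α y e (φ.filtPlus α (-P.toLinearMap (P.root α) y))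

/-- The image of `U_{-α,-r}` in `L_{α,e,r}`, where `-r = α(y)`. -/
def imUbar (α : ι) (y : W) (e : ℝ≥0) : Subgroup (E.L α y e) :=
  E.imageL α y e (φ.filt (negIdx P α) (P.toLinearMap (P.root α) y))

/-- The homomorphism `T_α^{(0)} / T_α^{(e)} → L_{α,e,r}` induced by the inclusion. -/
def torusToL [P.IsCrystallographic] (α : ι) (y : W) (e : ℝ≥0) :
    E.TorusQuot α e →* E.L α y e :=
  QuotientGroup.map _ _
    (Subgroup.inclusion (show E.torusFilt α 0 ≤ φ.stab y ⊓ D.rankOne α from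
      fun _ hx => ⟨E.Hplus_le_stab y (by simpa using hx.2), hx.1.1⟩))
    (fun _ hx => (le_sup_left : E.Hplus e ≤ E.pointGroup y e)
      (show _ ∈ E.torusFilt α e from hx).2)

/-- The element `[X] = ∑_{x ∈ X} [x]` of the group algebra of `L_{α,e,r}` over `R`. -/
def bracket (R : Type*) [Semiring R] {α : ι} {y : W} {e : ℝ≥0} (X : Subgroup (E.L α y e)) :
    MonoidAlgebra R (E.L α y e) :=
  ∑ᶠ x : X, MonoidAlgebra.of R (E.L α y e) x

/-- The map from the group algebra of `T_α^{(0)} / T_α^{(e)}` to the group algebra of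
`L_{α,e,r}`. -/
def toHeckeL (R : Type*) [Semiring R] [P.IsCrystallographic] (α : ι) (y : W) (e : ℝ≥0) :
    MonoidAlgebra R (E.TorusQuot α e) →+* MonoidAlgebra R (E.L α y e) :=
  MonoidAlgebra.mapDomainRingHom R (E.torusToL α y e)

/-- The element `t(x, x̄)` of `T_α^{(0)} / T_α^{(e)}`, determined by
`x x̄ = ū(x, x̄) t(x, x̄) u(x, x̄)` for `x, u(x, x̄)` in the image of `U_{α,r+}` and
`x̄, ū(x, x̄)` in the image of `U_{-α,-r}`. -/
def tElt [P.IsCrystallographic] (α : ι) (y : W) (e : ℝ≥0) (x xbar : E.L α y e) :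
    E.TorusQuot α e :=
  Classical.epsilon fun t => ∃ ubar ∈ E.imUbar α y e, ∃ u ∈ E.imUplus α y e,
    x * xbar = ubar * E.torusToL α y e t * u

/-- The element `S = ∑_{x, x̄} [t(x, x̄)]` of the group algebra of `T_α^{(0)} / T_α^{(e)}`. -/
def elementS (R : Type*) [Semiring R] [P.IsCrystallographic] (α : ι) (y : W) (e : ℝ≥0) :
    MonoidAlgebra R (E.TorusQuot α e) :=
  ∑ᶠ q : E.imUplus α y e × E.imUbar α y e,
    MonoidAlgebra.of R (E.TorusQuot α e) (E.tElt α y e q.1 q.2)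

end Prolongation

end RootData

/-! ### Valuated root data of reductive groups over local fields -/

section Local

open LinAlgGroup

variable (F : Type*) [NontriviallyNormedField F] {n : ℕ}
  {ι V W : Type*} [AddCommGroup V] [Module ℝ V] [AddCommGroup W] [Module ℝ W]
  {P : RootPairing ι ℝ V W}

/-- `D` is the root datum of `(𝒢, S)` in `𝒢(F)`: `T = Z_G(S)`, and the `U_a` are the groups of
`F`-rational points of the root subgroups. -/
structure IsRootDatumOf (𝒢 S : Subgroup (GL (Fin n) (AlgebraicClosure F)))
    (χ : ι → (S →* (AlgebraicClosure F)ˣ)) (D : GroupRootDatum P (rationalPoints F 𝒢)) :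
    Prop where
  T_eq : D.T = rationalSubgroup F 𝒢 (centralizerIn 𝒢 S)
  U_eq : ∀ a, ∃ X, IsRootSubgroup 𝒢 S (χ a) X ∧ D.U a = rationalSubgroup F 𝒢 X

/-- The valuation `φ` of the root datum is compatible with the valuation `υ = -log ‖·‖` and the
topology of `F`: an element `s` of `S(F)` shifts `φ_a` by `υ(a(s))`, and the groups `U_{a,k}` are
compact open subgroups of `U_a`. -/
structure IsCompatibleValuation {𝒢 S : Subgroup (GL (Fin n) (AlgebraicClosure F))}
    (χ : ι → (S →* (AlgebraicClosure F)ˣ)) {D : GroupRootDatum P (rationalPoints F 𝒢)}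
    (φ : RootDatumValuation D) : Prop where
  torus : ∀ (s : rationalPoints F 𝒢) (hs : toClosure F s ∈ S) (a : ι) (c : F),
    algebraMap F (AlgebraicClosure F) c = (χ a ⟨toClosure F s, hs⟩ : AlgebraicClosure F) →
    ∀ u ∈ D.U a, φ.val a (s * u * s⁻¹) = φ.val a u + ((-Real.log ‖c‖ : ℝ) : WithTop ℝ)
  compact : ∀ a k, IsCompact (φ.filt a k : Set (rationalPoints F 𝒢))
  isOpen : ∀ a k, ∃ O : Set (rationalPoints F 𝒢), IsOpen O ∧
    O ∩ (D.U a : Set (rationalPoints F 𝒢)) = φ.filt a k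

/-- The groups `H_r` are compact open subgroups of `Z_G(S)` for `r ≥ 0`, and pro-`p` for `r > 0`:
all their open subgroups have `p`-power index. -/
structure IsCompactOpenProP (p : ℕ) {𝒢 : Subgroup (GL (Fin n) (AlgebraicClosure F))}
    {D : GroupRootDatum P (rationalPoints F 𝒢)} {φ : RootDatumValuation D}
    (E : Prolongation φ) : Prop where
  compact : ∀ r, 0 ≤ r → IsCompact (E.H r : Set (rationalPoints F 𝒢))
  isOpen : ∀ r, 0 ≤ r → ∃ O : Set (rationalPoints F 𝒢), IsOpen O ∧
    O ∩ (D.T : Set (rationalPoints F 𝒢)) = E.H r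
  pro_p : ∀ r, 0 < r → ∀ X : Subgroup (E.H r), IsOpen (X : Set (E.H r)) → ∃ j, X.index = p ^ j

end Local

end BruhatTits

end

/-! Write N, U⁺, U for the images in L of U_{-α,-r}, U_{α,r+}, U_{α,r}, and Q for
T_α^{(0)}/T_α^{(e)}. Everything rests on unique factorisations in N Q U⁺ and on the fact that x x̄
has one. Uniqueness follows from the triangular axiom of the root datum, because the factors of an
element of U_y^{(e)} again lie in U_y^{(e)} (`mem_pointGroup_of_mul`). For existence, y is moved to
y - (d/2)α^∨ with a small d > 0. The filtration groups of positive depth at the new point, for the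
roots on the line through α, generate a group whose image contains N and U⁺. Filtering it by depth
gives a central chain, and compactness factorises each term (`exists_factorization`,
`exists_isDecomposedChain`).

Given this, (a) holds because the outer factors of x x̄ are absorbed by [N] and [U⁺], and (b)
because t(x, x̄) is equivariant under conjugation by Q. For (c), write [U] = [U⁺][J] with coset
representatives J containing 1. In [N][U][N][U⁺] the term of 1 is the square in (a). Any other j in
J comes from an element of valuation exactly r, so j = v m v' with v, v' in N and m exchanging N and
U (`exists_swap`); its term therefore lies in [N][U]R[L] and can be subtracted.

Invertibility is the hard part, `eq_zero_of_triSum_eq_zero`: if Q acts on an abelian group M without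
p-torsion, then S acts injectively. The statement is generalised to pairs K ⊆ B of subgroups of L,
with K normal in B, and to vectors fixed by the torus part of K; the induction enlarges K or shrinks
B. An obstructing z is chosen so deep in the chain that its commutators are, modulo K, torus
elements c central in B/K. If z in N or U⁺ is central modulo K, it is added to K. Otherwise B is
replaced by the centraliser of z: translation by z shows that each discarded partial sum is fixed by
some c outside K, and induction, with c added to K, makes it vanish. At the end S acts by |N ∩ B|
|U⁺ ∩ B|, a power of p. Applied to the class of 1 in M = R[Q]/R[Q]S this gives 1 ∈ R[Q]S. The groups
N and U⁺ are p-groups because g^(p^k) tends to 1 for unipotent g. -/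

noncomputable section

/-! ### Abstract triangular decompositions, and pairs K ⊆ B compatible with them. -/

namespace TriangularDecomposition

open scoped Classical

variable {G Q M : Type*} [Group G] [Group Q] [AddCommGroup M]

/-- `θ(Q)` normalises `N` and `U`, factorisations in `N θ(Q) U` are unique, and `τ` reads off the
middle factor. -/
structure IsTriangular (N U : Subgroup G) (θ : Q →* G) (τ : G → Q) : Prop where
  conjN : ∀ q, ∀ n ∈ N, θ q * n * (θ q)⁻¹ ∈ N
  conjU : ∀ q, ∀ u ∈ U, θ q * u * (θ q)⁻¹ ∈ U
  unique : ∀ n ∈ N, ∀ n' ∈ N, ∀ q q', ∀ u ∈ U, ∀ u' ∈ U, n * θ q * u = n' * θ q' * u' →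
    n = n' ∧ q = q' ∧ u = u'
  tau : ∀ n ∈ N, ∀ q, ∀ u ∈ U, τ (n * θ q * u) = q

/-- The elements of `X` factorise in `(X ∩ N) (X ∩ θ(Q)) (X ∩ U)`. -/
def Decomposed (N U : Subgroup G) (θ : Q →* G) (X : Subgroup G) : Prop :=
  ∀ x ∈ X, ∃ n ∈ N, ∃ q, ∃ u ∈ U, n ∈ X ∧ θ q ∈ X ∧ u ∈ X ∧ x = n * θ q * u

variable {N U : Subgroup G} {θ : Q →* G} {τ : G → Q}

namespace IsTriangular

variable (T : IsTriangular N U θ τ)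
include T

lemma eq_of_eq_theta {n u : G} {q t : Q} (hn : n ∈ N) (hu : u ∈ U)
    (h : θ t = n * θ q * u) : q = t := by
  have := T.unique 1 (one_mem _) n hn t q 1 (one_mem _) u hu (by simpa using h)
  exact this.2.1.symm

lemma tau_mul_left {n b : G} (hn : n ∈ N) (hb : ∃ n ∈ N, ∃ q, ∃ u ∈ U, b = n * θ q * u) :
    τ (n * b) = τ b := by
  obtain ⟨n', hn', q, u, hu, rfl⟩ := hb
  rw [T.tau _ hn' _ _ hu, ← mul_assoc, ← mul_assoc, T.tau _ (mul_mem hn hn') _ _ hu]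

lemma tau_mul_right {u b : G} (hu : u ∈ U) (hb : ∃ n ∈ N, ∃ q, ∃ u ∈ U, b = n * θ q * u) :
    τ (b * u) = τ b := by
  obtain ⟨n', hn', q, u', hu', rfl⟩ := hb
  rw [T.tau _ hn' _ _ hu', mul_assoc, T.tau _ hn' _ _ (mul_mem hu' hu)]

lemma tau_theta_mul {c : Q} {b : G} (hb : ∃ n ∈ N, ∃ q, ∃ u ∈ U, b = n * θ q * u) :
    τ (θ c * b) = c * τ b := by
  obtain ⟨n', hn', q, u', hu', rfl⟩ := hb
  have h : θ c * (n' * θ q * u') = (θ c * n' * (θ c)⁻¹) * θ (c * q) * u' := by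
    simp [mul_assoc]
  rw [T.tau _ hn' _ _ hu', h, T.tau _ (T.conjN _ _ hn') _ _ hu']

lemma tau_conj {c : Q} {b : G} (hb : ∃ n ∈ N, ∃ q, ∃ u ∈ U, b = n * θ q * u) :
    τ (θ c * b * (θ c)⁻¹) = c * τ b * c⁻¹ := by
  obtain ⟨n', hn', q, u', hu', rfl⟩ := hb
  have h : θ c * (n' * θ q * u') * (θ c)⁻¹ =
      (θ c * n' * (θ c)⁻¹) * θ (c * q * c⁻¹) * (θ c * u' * (θ c)⁻¹) := by
    simp [mul_assoc]
  rw [T.tau _ hn' _ _ hu', h, T.tau _ (T.conjN _ _ hn') _ _ (T.conjU _ _ hu')]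

/-- By uniqueness, the factors found in X and those found in Y are the same. -/
lemma decomposed_inf {X Y : Subgroup G} (hX : Decomposed N U θ X) (hY : Decomposed N U θ Y) :
    Decomposed N U θ (X ⊓ Y) := by
  intro x hx
  obtain ⟨n, hn, q, u, hu, h1, h2, h3, h4⟩ := hX x hx.1
  obtain ⟨n', hn', q', u', hu', h1', h2', h3', h4'⟩ := hY x hx.2
  obtain ⟨rfl, rfl, rfl⟩ := T.unique n hn n' hn' q q' u hu u' hu' (h4 ▸ h4')
  exact ⟨n, hn, q, u, hu, ⟨h1, h1'⟩, ⟨h2, h2'⟩, ⟨h3, h3'⟩, h4⟩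

end IsTriangular

lemma Decomposed.exists_eq {X : Subgroup G} (hX : Decomposed N U θ X) {x : G} (hx : x ∈ X) :
    ∃ n ∈ N, ∃ q, ∃ u ∈ U, x = n * θ q * u := by
  obtain ⟨n, hn, q, u, hu, -, -, -, h⟩ := hX x hx
  exact ⟨n, hn, q, u, hu, h⟩

/-- A normal pair of decomposed subgroups. -/
structure IsNormalPair (N U : Subgroup G) (θ : Q →* G) (B K : Subgroup G) : Prop where
  le : K ≤ B
  conj : ∀ b ∈ B, ∀ k ∈ K, b * k * b⁻¹ ∈ K
  decB : Decomposed N U θ B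
  decK : Decomposed N U θ K

namespace IsNormalPair

variable {B K : Subgroup G} (h : IsNormalPair N U θ B K)
include h

lemma conj' {b k : G} (hb : b ∈ B) (hk : k ∈ K) : b⁻¹ * k * b ∈ K := by
  simpa using h.conj b⁻¹ (inv_mem hb) k hk

/-- The centraliser of `z` modulo `K`. -/
def cent {z : G} (_hz : z ∈ B) : Subgroup G where
  carrier := {b | b ∈ B ∧ b * z * b⁻¹ * z⁻¹ ∈ K}
  mul_mem' := by
    rintro a b ⟨ha, ha'⟩ ⟨hb, hb'⟩
    refine ⟨mul_mem ha hb, ?_⟩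
    have := mul_mem (h.conj a ha _ hb') ha'
    simpa [mul_assoc] using this
  one_mem' := ⟨one_mem _, by simp⟩
  inv_mem' := by
    rintro b ⟨hb, hb'⟩
    refine ⟨inv_mem hb, ?_⟩
    have := h.conj b⁻¹ (inv_mem hb) _ (inv_mem hb')
    simpa [mul_assoc] using this

lemma le_cent {z : G} (hz : z ∈ B) : K ≤ h.cent hz := fun k hk => by
  refine ⟨h.le hk, ?_⟩
  have := mul_mem hk (h.conj z hz _ (inv_mem hk))
  simpa [mul_assoc] using this

lemma cent_pair {z : G} (hz : z ∈ B) (hd : Decomposed N U θ (h.cent hz)) :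
    IsNormalPair N U θ (h.cent hz) K :=
  ⟨h.le_cent hz, fun b hb => h.conj b hb.1, hd, h.decK⟩

/-- The subgroup generated by `K` and an element that is central modulo `K`. -/
def adjoin {z : G} (hz : z ∈ B) (_hc : ∀ b ∈ B, b * z * b⁻¹ * z⁻¹ ∈ K) : Subgroup G where
  carrier := {x | ∃ i : ℤ, ∃ k ∈ K, x = z ^ i * k}
  mul_mem' := by
    rintro _ _ ⟨i, k, hk, rfl⟩ ⟨j, l, hl, rfl⟩
    refine ⟨i + j, ((z ^ j)⁻¹ * k * z ^ j) * l, mul_mem (h.conj' (zpow_mem hz j) hk) hl, ?_⟩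
    rw [zpow_add]; group
  one_mem' := ⟨0, 1, one_mem _, by simp⟩
  inv_mem' := by
    rintro _ ⟨i, k, hk, rfl⟩
    refine ⟨-i, z ^ i * k⁻¹ * (z ^ i)⁻¹, h.conj _ (zpow_mem hz i) _ (inv_mem hk), ?_⟩
    group

/-- Commuting modulo K is symmetric, so z lies in the centraliser of b, and so do its powers. -/
lemma conj_zpow {z : G} (hz : z ∈ B) (hc : ∀ b ∈ B, b * z * b⁻¹ * z⁻¹ ∈ K) (i : ℤ) {b : G}
    (hb : b ∈ B) : b * z ^ i * b⁻¹ * (z ^ i)⁻¹ ∈ K := by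
  have hz' : z ∈ h.cent hb := by
    refine ⟨hz, ?_⟩
    have := inv_mem (hc b hb)
    simpa [mul_assoc] using this
  have := inv_mem (zpow_mem hz' i).2
  simpa [mul_assoc] using this

lemma le_adjoin {z : G} (hz : z ∈ B) (hc : ∀ b ∈ B, b * z * b⁻¹ * z⁻¹ ∈ K) :
    K ≤ h.adjoin hz hc := fun k hk => ⟨0, k, hk, by simp⟩

lemma mem_adjoin {z : G} (hz : z ∈ B) (hc : ∀ b ∈ B, b * z * b⁻¹ * z⁻¹ ∈ K) :
    z ∈ h.adjoin hz hc := ⟨1, 1, one_mem _, by simp⟩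

lemma adjoin_pair {z : G} (hz : z ∈ B) (hc : ∀ b ∈ B, b * z * b⁻¹ * z⁻¹ ∈ K)
    (hd : Decomposed N U θ (h.adjoin hz hc)) : IsNormalPair N U θ B (h.adjoin hz hc) where
  le := by
    rintro _ ⟨i, k, hk, rfl⟩
    exact mul_mem (zpow_mem hz i) (h.le hk)
  conj := by
    rintro b hb _ ⟨i, k, hk, rfl⟩
    refine ⟨i, ((z ^ i)⁻¹ * (b * z ^ i * b⁻¹ * (z ^ i)⁻¹) * z ^ i) * (b * k * b⁻¹),
      mul_mem (h.conj' (zpow_mem hz i) (h.conj_zpow hz hc i hb)) (h.conj b hb k hk), ?_⟩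
    group
  decB := h.decB
  decK := hd

/-- Powers of z are absorbed by the left factor. The torus part therefore does not grow, and a
vector fixed by it needs no new check. -/
lemma decomposed_adjoin_N (T : IsTriangular N U θ τ) {z : G} (hz : z ∈ B)
    (hc : ∀ b ∈ B, b * z * b⁻¹ * z⁻¹ ∈ K) (hzN : z ∈ N) :
    Decomposed N U θ (h.adjoin hz hc) ∧ ∀ q, θ q ∈ h.adjoin hz hc → θ q ∈ K := by
  constructor
  · rintro _ ⟨i, k, hk, rfl⟩
    obtain ⟨n, hn, q, u, hu, h1, h2, h3, rfl⟩ := h.decK k hk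
    exact ⟨z ^ i * n, mul_mem (zpow_mem hzN i) hn, q, u, hu,
      ⟨i, n, h1, rfl⟩, h.le_adjoin hz hc h2, h.le_adjoin hz hc h3, by simp [mul_assoc]⟩
  · rintro t ⟨i, k, hk, ht⟩
    obtain ⟨n, hn, q, u, hu, h1, h2, h3, rfl⟩ := h.decK k hk
    have := T.eq_of_eq_theta (n := z ^ i * n) (q := q) (mul_mem (zpow_mem hzN i) hn) hu
      (by rw [ht]; simp [mul_assoc])
    exact this ▸ h2

lemma decomposed_adjoin_U (T : IsTriangular N U θ τ) {z : G} (hz : z ∈ B)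
    (hc : ∀ b ∈ B, b * z * b⁻¹ * z⁻¹ ∈ K) (hzU : z ∈ U) :
    Decomposed N U θ (h.adjoin hz hc) ∧ ∀ q, θ q ∈ h.adjoin hz hc → θ q ∈ K := by
  -- Conjugating k by z^i moves the power of z to the right, where the factor in U absorbs it.
  have key : ∀ i : ℤ, ∀ k ∈ K, ∃ n ∈ N, ∃ q, ∃ u ∈ U, n ∈ K ∧ θ q ∈ K ∧ u ∈ K ∧
      z ^ i * k = n * θ q * (u * z ^ i) := by
    intro i k hk
    obtain ⟨n, hn, q, u, hu, h1, h2, h3, h4⟩ := h.decK _ (h.conj _ (zpow_mem hz i) k hk)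
    refine ⟨n, hn, q, u, hu, h1, h2, h3, ?_⟩
    rw [← mul_assoc, ← h4]; group
  constructor
  · rintro _ ⟨i, k, hk, rfl⟩
    obtain ⟨n, hn, q, u, hu, h1, h2, h3, h4⟩ := key i k hk
    exact ⟨n, hn, q, u * z ^ i, mul_mem hu (zpow_mem hzU i), h.le_adjoin hz hc h1,
      h.le_adjoin hz hc h2, mul_mem (h.le_adjoin hz hc h3) (zpow_mem (h.mem_adjoin hz hc) i), h4⟩
  · rintro t ⟨i, k, hk, ht⟩
    obtain ⟨n, hn, q, u, hu, h1, h2, h3, h4⟩ := key i k hk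
    have := T.eq_of_eq_theta hn (mul_mem hu (zpow_mem hzU i)) (ht.trans h4)
    exact this ▸ h2

/-- Here the torus part does grow, but only by powers of c, so a vector fixed by the old part is
fixed by the new one as soon as c fixes it. -/
lemma decomposed_adjoin_theta (T : IsTriangular N U θ τ) {c : Q} (hz : θ c ∈ B)
    (hc : ∀ b ∈ B, b * θ c * b⁻¹ * (θ c)⁻¹ ∈ K) :
    Decomposed N U θ (h.adjoin hz hc) ∧
      ∀ t, θ t ∈ h.adjoin hz hc → ∃ i : ℤ, ∃ q, θ q ∈ K ∧ t = c ^ i * q := by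
  have key : ∀ i : ℤ, ∀ k ∈ K, ∃ n ∈ N, ∃ q, ∃ u ∈ U, n ∈ K ∧ θ q ∈ K ∧ u ∈ K ∧
      θ c ^ i * k = n * θ (c ^ i * q) * u := by
    intro i k hk
    obtain ⟨n, hn, q, u, hu, h1, h2, h3, rfl⟩ := h.decK k hk
    refine ⟨θ (c ^ i) * n * (θ (c ^ i))⁻¹, T.conjN _ _ hn, q, u, hu, ?_, h2, h3, ?_⟩
    · exact h.conj _ (by rw [map_zpow]; exact zpow_mem hz i) _ h1
    · simp [mul_assoc]
  constructor
  · rintro _ ⟨i, k, hk, rfl⟩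
    obtain ⟨n, hn, q, u, hu, h1, h2, h3, h4⟩ := key i k hk
    exact ⟨n, hn, c ^ i * q, u, hu, h.le_adjoin hz hc h1, ⟨i, θ q, h2, by simp⟩,
      h.le_adjoin hz hc h3, h4⟩
  · rintro t ⟨i, k, hk, ht⟩
    obtain ⟨n, hn, q, u, hu, h1, h2, h3, h4⟩ := key i k hk
    exact ⟨i, q, h2, (T.eq_of_eq_theta hn hu (ht.trans h4)).symm⟩

/-- Write b = n θ(t) u. As K is normal in B, u k u⁻¹ factorises inside K, so the middle factor
changes from t to t q with θ(q) ∈ K, and q fixes f. On such f the operator ρ(τ(b)) depends only on b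
modulo K. -/
lemma rho_tau_mul (T : IsTriangular N U θ τ) (ρ : Q →* AddMonoid.End M) {f : M}
    (hf : ∀ q, θ q ∈ K → ρ q f = f) {b k : G} (hb : b ∈ B) (hk : k ∈ K) :
    ρ (τ (b * k)) f = ρ (τ b) f := by
  obtain ⟨n, hn, t, u, hu, h1, h2, h3, rfl⟩ := h.decB b hb
  obtain ⟨n', hn', q, u', hu', h1', h2', h3', h4⟩ := h.decK _ (h.conj u h3 k hk)
  have : n * θ t * u * k = (n * (θ t * n' * (θ t)⁻¹)) * θ (t * q) * (u' * u) := by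
    have : k = u⁻¹ * (n' * θ q * u') * u := by rw [← h4]; group
    rw [this]; simp [mul_assoc]
  rw [this, T.tau _ (mul_mem hn (T.conjN _ _ hn')) _ _ (mul_mem hu' hu), T.tau _ hn _ _ hu,
    map_mul]
  change ρ t (ρ q f) = _
  rw [hf q h2']

end IsNormalPair

end TriangularDecomposition
end

/-! ### The operator attached to the middle factors, and its behaviour under translation. -/

noncomputable section

namespace TriangularDecomposition

open scoped Classical

variable {G Q M : Type*} [Group G] [Group Q] [AddCommGroup M]
variable {N U : Subgroup G} {θ : Q →* G} {τ : G → Q}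

/-- The operator `∑ ρ(τ(x n))`, where `x` and `n` run through the elements of `B` in two given
finite sets. -/
def triSum (FN FU : Finset G) (τ : G → Q) (ρ : Q →* AddMonoid.End M) (B : Subgroup G) :
    AddMonoid.End M :=
  ∑ x ∈ FU with x ∈ B, ∑ n ∈ FN with n ∈ B, ρ (τ (x * n))

omit [Group G] in
lemma end_sum_apply (s : Finset G) (φ : G → AddMonoid.End M) (f : M) :
    (∑ x ∈ s, φ x) f = ∑ x ∈ s, φ x f :=
  map_sum (AddMonoidHom.mk' (fun g : AddMonoid.End M => g f) fun _ _ => rfl) φ s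

lemma triSum_apply (FN FU : Finset G) (τ : G → Q) (ρ : Q →* AddMonoid.End M) (B : Subgroup G)
    (f : M) : triSum FN FU τ ρ B f =
      ∑ x ∈ FU with x ∈ B, ∑ n ∈ FN with n ∈ B, ρ (τ (x * n)) f := by
  simp only [triSum, end_sum_apply]

lemma sum_conj_eq {A : Type*} [AddCommMonoid A] {F : Finset G} {X B : Subgroup G} {g : G}
    (hF : ∀ x, x ∈ F ↔ x ∈ X) (hg : g ∈ B) (hX : ∀ x ∈ X, g * x * g⁻¹ ∈ X)
    (hX' : ∀ x ∈ X, g⁻¹ * x * g ∈ X) (φ : G → A) :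
    ∑ x ∈ F with x ∈ B, φ (g * x * g⁻¹) = ∑ x ∈ F with x ∈ B, φ x := by
  refine Finset.sum_nbij' (fun x => g * x * g⁻¹) (fun x => g⁻¹ * x * g) ?_ ?_ ?_ ?_ ?_
  · intro x hx
    simp only [Finset.mem_filter, hF] at hx ⊢
    exact ⟨hX x hx.1, mul_mem (mul_mem hg hx.2) (inv_mem hg)⟩
  · intro x hx
    simp only [Finset.mem_filter, hF] at hx ⊢
    exact ⟨hX' x hx.1, mul_mem (mul_mem (inv_mem hg) hx.2) hg⟩
  · intro x _; group
  · intro x _; group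
  · intro x _; rfl

section

variable {FN FU : Finset G} (T : IsTriangular N U θ τ) (hFN : ∀ x, x ∈ FN ↔ x ∈ N)
  (hFU : ∀ x, x ∈ FU ↔ x ∈ U) (ρ : Q →* AddMonoid.End M)
include T hFN hFU

/-- Conjugation by θ(c) permutes N ∩ B and U ∩ B, and τ is equivariant for it. -/
lemma triSum_commute {B : Subgroup G} (hB : Decomposed N U θ B) {c : Q} (hc : θ c ∈ B) :
    ρ c * triSum FN FU τ ρ B = triSum FN FU τ ρ B * ρ c := by
  have hN' : ∀ x ∈ N, (θ c)⁻¹ * x * θ c ∈ N := fun x hx => by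
    simpa using T.conjN c⁻¹ x hx
  have hU' : ∀ x ∈ U, (θ c)⁻¹ * x * θ c ∈ U := fun x hx => by
    simpa using T.conjU c⁻¹ x hx
  rw [triSum, Finset.mul_sum, Finset.sum_mul]
  rw [← sum_conj_eq hFU hc (T.conjU c) hU'
    (fun x => (∑ n ∈ FN with n ∈ B, ρ (τ (x * n))) * ρ c)]
  refine Finset.sum_congr rfl fun x hx => ?_
  rw [Finset.mul_sum, Finset.sum_mul, ← sum_conj_eq hFN hc (T.conjN c) hN'
    (fun n => ρ (τ (θ c * x * (θ c)⁻¹ * n)) * ρ c)]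
  refine Finset.sum_congr rfl fun n hn => ?_
  simp only [Finset.mem_filter] at hx hn
  rw [← map_mul, ← map_mul]
  have h := T.tau_conj (c := c) (hB.exists_eq (mul_mem hx.2 hn.2))
  rw [show θ c * x * (θ c)⁻¹ * (θ c * n * (θ c)⁻¹) = θ c * (x * n) * (θ c)⁻¹ by group, h]
  simp

end

lemma IsTriangular.theta_tau_mem (T : IsTriangular N U θ τ) {B : Subgroup G}
    (hB : Decomposed N U θ B) {b : G} (hb : b ∈ B) : θ (τ b) ∈ B := by
  obtain ⟨n, hn, q, u, hu, h1, h2, h3, rfl⟩ := hB b hb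
  rwa [T.tau n hn q u hu]

lemma IsNormalPair.rho_fix {B K : Subgroup G} (h : IsNormalPair N U θ B K)
    (ρ : Q →* AddMonoid.End M) {f : M} (hf : ∀ q, θ q ∈ K → ρ q f = f) {t : Q} (ht : θ t ∈ B)
    {q : Q} (hq : θ q ∈ K) : ρ q (ρ t f) = ρ t f := by
  have h1 : ρ (t⁻¹ * q * t) f = f := hf _ (by simpa using h.conj' ht hq)
  conv_rhs => rw [← h1]
  change (ρ q * ρ t) f = (ρ t * ρ (t⁻¹ * q * t)) f
  rw [← map_mul, ← map_mul]
  congr 2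
  group

/-- The main induction runs on |B| - |K|. Truncated subtraction is harmless because K stays inside
the smaller group. -/
lemma ncard_sub_lt_of_cent {B B' K : Subgroup G} (hfin : (B : Set G).Finite) (h : B' < B)
    (hK : K ≤ B') : (B' : Set G).ncard - (K : Set G).ncard <
      (B : Set G).ncard - (K : Set G).ncard := by
  have h1 := Set.ncard_lt_ncard (SetLike.coe_ssubset_coe.2 h) hfin
  have h2 := Set.ncard_le_ncard (SetLike.coe_subset_coe.2 hK)
    (hfin.subset (SetLike.coe_subset_coe.2 h.le))
  omega

lemma ncard_sub_lt_of_adjoin {B K K' : Subgroup G} (hfin : (B : Set G).Finite) (h : K < K')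
    (hK : K' ≤ B) : (B : Set G).ncard - (K' : Set G).ncard <
      (B : Set G).ncard - (K : Set G).ncard := by
  have h1 := Set.ncard_lt_ncard (SetLike.coe_ssubset_coe.2 h)
    (hfin.subset (SetLike.coe_subset_coe.2 hK))
  have h2 := Set.ncard_le_ncard (SetLike.coe_subset_coe.2 hK) hfin
  omega

lemma rho_zpow_fix (ρ : Q →* AddMonoid.End M) {f : M} {c : Q} (hc : ρ c f = f) (i : ℤ) :
    ρ (c ^ i) f = f := by
  have hinv : ρ c⁻¹ f = f := by
    conv_lhs => rw [← hc]
    change (ρ c⁻¹ * ρ c) f = f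
    rw [← map_mul]; simp
  induction i with
  | zero => simp
  | succ n ih =>
    rw [zpow_add_one, map_mul]
    change ρ _ (ρ c f) = f
    rw [hc, ih]
  | pred n ih =>
    rw [zpow_sub_one, map_mul]
    change ρ _ (ρ c⁻¹ f) = f
    rw [hinv, ih]

/-- The number in question is the order of X ⊓ B, which divides p^a and so is itself a power of p.
-/
lemma eq_zero_of_card_nsmul {p : ℕ} (hp : p.Prime) (hM : ∀ f : M, p • f = 0 → f = 0)
    {F : Finset G} {X B : Subgroup G} (hF : ∀ x, x ∈ F ↔ x ∈ X) (hX : ∃ a, Nat.card X = p ^ a)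
    {f : M} (hf : (F.filter (· ∈ B)).card • f = 0) : f = 0 := by
  obtain ⟨a, ha⟩ := hX
  have h1 : (F.filter (· ∈ B)).card = Nat.card (X ⊓ B : Subgroup G) := by
    rw [← SetLike.coe_sort_coe, Nat.card_coe_set_eq, ← Set.ncard_coe_finset]
    congr 1
    ext x
    simp [hF]
  have h2 : Nat.card (X ⊓ B : Subgroup G) ∣ p ^ a := ha ▸ Subgroup.card_dvd_of_le inf_le_left
  obtain ⟨i, -, hi⟩ := (Nat.dvd_prime_pow hp).1 h2
  rw [h1, hi] at hf
  clear h1 h2 hi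
  induction i with
  | zero => simpa using hf
  | succ i ih =>
    refine ih (hM _ ?_)
    rwa [← mul_smul, ← pow_succ']

section Induction

variable {FN FU : Finset G} (T : IsTriangular N U θ τ) (hFN : ∀ x, x ∈ FN ↔ x ∈ N)
  (hFU : ∀ x, x ∈ FU ↔ x ∈ U) (ρ : Q →* AddMonoid.End M)
include T hFN hFU

/-- If the parts of `B` in `N` and `U` lie in `K`, then `triSum` acts by a scalar. -/
lemma eq_zero_of_terminal {p : ℕ} (hp : p.Prime) (hM : ∀ f : M, p • f = 0 → f = 0)
    (hN : ∃ a, Nat.card N = p ^ a) (hU : ∃ a, Nat.card U = p ^ a) {B K : Subgroup G}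
    (h : IsNormalPair N U θ B K) (hNK : ∀ x ∈ N, x ∈ B → x ∈ K) (hUK : ∀ x ∈ U, x ∈ B → x ∈ K)
    {f : M} (hf : ∀ q, θ q ∈ K → ρ q f = f) (h0 : triSum FN FU τ ρ B f = 0) : f = 0 := by
  rw [triSum_apply, Finset.sum_congr rfl fun x hx => Finset.sum_congr rfl fun n hn => by
    rw [hf]
    simp only [Finset.mem_filter, hFN, hFU] at hx hn
    exact T.theta_tau_mem h.decK (mul_mem (hUK x hx.1 hx.2) (hNK n hn.1 hn.2))] at h0
  rw [Finset.sum_const, Finset.sum_const] at h0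
  exact eq_zero_of_card_nsmul hp hM hFN hN (eq_zero_of_card_nsmul hp hM hFU hU h0)

-- Modulo K, x z n equals θ(c) z x n: the error k moves to the right end by normality of K, and z on
-- the left does not affect τ. Translating the summation variable by z thus multiplies the summand
-- by ρ(c).
omit hFN hFU in
lemma translate_N {B K : Subgroup G} (h : IsNormalPair N U θ B K) {f : M}
    (hf : ∀ q, θ q ∈ K → ρ q f = f) {x z n k : G} {c : Q} (hx : x ∈ B) (hz : z ∈ B) (hzN : z ∈ N)
    (hn : n ∈ B) (hk : k ∈ K) (hw : x * z * x⁻¹ * z⁻¹ = θ c * k) :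
    ρ (τ (x * (z * n))) f = ρ c (ρ (τ (x * n)) f) := by
  have hb := mul_mem hx hn
  have hzb := mul_mem hz hb
  have h1 : x * (z * n) = (θ c * (z * (x * n))) * ((z * (x * n))⁻¹ * k * (z * (x * n))) := by
    have : x * z = θ c * k * z * x := by rw [← hw]; group
    rw [← mul_assoc, this]; group
  have hcB : θ c ∈ B := by
    have : θ c = x * z * x⁻¹ * z⁻¹ * k⁻¹ := by rw [hw]; group
    rw [this]
    exact mul_mem (mul_mem (mul_mem (mul_mem hx hz) (inv_mem hx)) (inv_mem hz))
      (inv_mem (h.le hk))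
  rw [h1, h.rho_tau_mul T ρ hf (mul_mem hcB hzb) (h.conj' hzb hk),
    T.tau_theta_mul (h.decB.exists_eq hzb), T.tau_mul_left hzN (h.decB.exists_eq hb), map_mul]
  rfl

-- The mirror image: z n is (θ(c) k)⁻¹ n z, which accounts for c⁻¹. The factor θ(c)⁻¹ must also pass
-- x, hence the extra hypothesis that θ(c) is central modulo K.
omit hFN hFU in
lemma translate_U {B K : Subgroup G} (h : IsNormalPair N U θ B K) {f : M}
    (hf : ∀ q, θ q ∈ K → ρ q f = f) {x z n k : G} {c : Q} (hx : x ∈ B) (hz : z ∈ B) (hzU : z ∈ U)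
    (hn : n ∈ B) (hk : k ∈ K) (hc : ∀ b ∈ B, b * θ c * b⁻¹ * (θ c)⁻¹ ∈ K)
    (hw : n * z * n⁻¹ * z⁻¹ = θ c * k) :
    ρ (τ (x * z * n)) f = ρ c⁻¹ (ρ (τ (x * n)) f) := by
  have hb := mul_mem hx hn
  have hcB : θ c ∈ B := by
    have : θ c = n * z * n⁻¹ * z⁻¹ * k⁻¹ := by rw [hw]; group
    rw [this]
    exact mul_mem (mul_mem (mul_mem (mul_mem hn hz) (inv_mem hn)) (inv_mem hz))
      (inv_mem (h.le hk))
  have hbz := mul_mem hb hz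
  have hcB' : θ c⁻¹ ∈ B := by simpa using inv_mem hcB
  have h2 := hc _ (inv_mem hx)
  have h3 := h.conj _ hcB _ (inv_mem hk)
  have h1 : x * z * n = θ c⁻¹ * (x * n * z) * ((n * z)⁻¹ *
      ((x⁻¹ * θ c * (x⁻¹)⁻¹ * (θ c)⁻¹) * (θ c * k⁻¹ * (θ c)⁻¹)) * (n * z)) := by
    have : x * z * n = x * (θ c * k)⁻¹ * n * z := by rw [← hw]; group
    rw [this, map_inv]; group
  rw [h1, h.rho_tau_mul T ρ hf (mul_mem hcB' hbz) (h.conj' (mul_mem hn hz) (mul_mem h2 h3)),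
    T.tau_theta_mul (h.decB.exists_eq hbz), T.tau_mul_right hzU (h.decB.exists_eq hb), map_mul]
  rfl

end Induction

end TriangularDecomposition
end

/-! ### Injectivity of the operator, by induction along a central chain. -/

noncomputable section

namespace TriangularDecomposition

open scoped Classical

variable {G Q M : Type*} [Group G] [Group Q] [AddCommGroup M]
variable {N U : Subgroup G} {θ : Q →* G} {τ : G → Q}

/-- A finite central series consisting of decomposed subgroups. -/
structure IsDecomposedChain (N U : Subgroup G) (θ : Q →* G) (C : ℕ → Subgroup G) : Prop where
  dec : ∀ i, Decomposed N U θ (C i)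
  comm : ∀ i, ∀ b ∈ C 0, ∀ c ∈ C i, b * c * b⁻¹ * c⁻¹ ∈ C (i + 1)
  bot : ∃ m, C m = ⊥
  finite : (C 0 : Set G).Finite

section Induction

variable {FN FU : Finset G} (T : IsTriangular N U θ τ) (hFN : ∀ x, x ∈ FN ↔ x ∈ N)
  (hFU : ∀ x, x ∈ FU ↔ x ∈ U) (ρ : Q →* AddMonoid.End M)
include T hFN hFU

-- The substitution n ↦ z n permutes the summation range, so the sum is fixed by ρ(c); `h0` says
-- that a sum fixed by c vanishes.
omit T hFU in
lemma sum_eq_zero_of_translate {B : Subgroup G} {z : G} (hz : z ∈ B) (hzN : z ∈ N)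
    (g : G → M) (c : Q)
    (hg : ∀ n ∈ N, n ∈ B → g (z * n) = ρ c (g n))
    (h0 : ρ c (∑ n ∈ FN with n ∈ B, g n) = ∑ n ∈ FN with n ∈ B, g n →
      ∑ n ∈ FN with n ∈ B, g n = 0) : ∑ n ∈ FN with n ∈ B, g n = 0 := by
  refine h0 ?_
  rw [map_sum, Finset.sum_congr rfl fun n hn => by
    simp only [Finset.mem_filter, hFN] at hn
    rw [← hg n hn.1 hn.2]]
  refine Finset.sum_nbij' (fun n => z * n) (fun n => z⁻¹ * n) ?_ ?_ ?_ ?_ ?_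
  · intro x hx
    simp only [Finset.mem_filter, hFN] at hx ⊢
    exact ⟨mul_mem hzN hx.1, mul_mem hz hx.2⟩
  · intro x hx
    simp only [Finset.mem_filter, hFN] at hx ⊢
    exact ⟨mul_mem (inv_mem hzN) hx.1, mul_mem (inv_mem hz) hx.2⟩
  · intro x _; simp
  · intro x _; simp
  · intro x _; rfl

omit T hFN in
lemma sum_eq_zero_of_translate_right {B : Subgroup G} {z : G} (hz : z ∈ B) (hzU : z ∈ U)
    (g : G → M) (c : Q)
    (hg : ∀ n ∈ U, n ∈ B → g (n * z) = ρ c (g n))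
    (h0 : ρ c (∑ n ∈ FU with n ∈ B, g n) = ∑ n ∈ FU with n ∈ B, g n →
      ∑ n ∈ FU with n ∈ B, g n = 0) : ∑ n ∈ FU with n ∈ B, g n = 0 := by
  refine h0 ?_
  rw [map_sum, Finset.sum_congr rfl fun n hn => by
    simp only [Finset.mem_filter, hFU] at hn
    rw [← hg n hn.1 hn.2]]
  refine Finset.sum_nbij' (fun n => n * z) (fun n => n * z⁻¹) ?_ ?_ ?_ ?_ ?_
  · intro x hx
    simp only [Finset.mem_filter, hFU] at hx ⊢
    exact ⟨mul_mem hx.1 hzU, mul_mem hx.2 hz⟩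
  · intro x hx
    simp only [Finset.mem_filter, hFU] at hx ⊢
    exact ⟨mul_mem hx.1 (inv_mem hzU), mul_mem hx.2 (inv_mem hz)⟩
  · intro x _; simp
  · intro x _; simp
  · intro x _; rfl

omit T in
lemma triSum_eq_of_le {B B' : Subgroup G} (hle : B' ≤ B) (hN : ∀ x ∈ N, x ∈ B → x ∈ B') (f : M)
    (h : ∀ x ∈ U, x ∈ B → x ∉ B' → ∑ n ∈ FN with n ∈ B, ρ (τ (x * n)) f = 0) :
    triSum FN FU τ ρ B' f = triSum FN FU τ ρ B f := by
  have hf : FN.filter (· ∈ B') = FN.filter (· ∈ B) := by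
    ext x
    simp only [Finset.mem_filter, hFN]
    exact ⟨fun hx => ⟨hx.1, hle hx.2⟩, fun hx => ⟨hx.1, hN x hx.1 hx.2⟩⟩
  rw [triSum_apply, triSum_apply, hf]
  refine Finset.sum_subset (fun x hx => ?_) fun x hx hx' => ?_
  · simp only [Finset.mem_filter] at hx ⊢
    exact ⟨hx.1, hle hx.2⟩
  · simp only [Finset.mem_filter, hFU] at hx hx'
    exact h x hx.1 hx.2 fun h => hx' ⟨hx.1, h⟩

omit T in
lemma triSum_eq_of_le' {B B' : Subgroup G} (hle : B' ≤ B) (hU : ∀ x ∈ U, x ∈ B → x ∈ B') (f : M)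
    (h : ∀ n ∈ N, n ∈ B → n ∉ B' → ∑ x ∈ FU with x ∈ B, ρ (τ (x * n)) f = 0) :
    triSum FN FU τ ρ B' f = triSum FN FU τ ρ B f := by
  have hf : FU.filter (· ∈ B') = FU.filter (· ∈ B) := by
    ext x
    simp only [Finset.mem_filter, hFU]
    exact ⟨fun hx => ⟨hx.1, hle hx.2⟩, fun hx => ⟨hx.1, hU x hx.1 hx.2⟩⟩
  rw [triSum_apply, triSum_apply, Finset.sum_comm, Finset.sum_comm (s := FU.filter (· ∈ B)), hf]
  refine Finset.sum_subset (fun x hx => ?_) fun x hx hx' => ?_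
  · simp only [Finset.mem_filter] at hx ⊢
    exact ⟨hx.1, hle hx.2⟩
  · simp only [Finset.mem_filter, hFN] at hx hx'
    exact h x hx.1 hx.2 fun h => hx' ⟨hx.1, h⟩

/-- Two moves decrease |B| - |K|: adjoining to K an element central modulo K, and replacing B by the
centraliser modulo K of a noncentral element. The chain supplies an element for which one of the
moves is compatible with the triangular decomposition and with the sum. -/
theorem eq_zero_of_triSum_eq_zero {p : ℕ} (hp : p.Prime) (hM : ∀ f : M, p • f = 0 → f = 0)
    (hN : ∃ a, Nat.card N = p ^ a) (hU : ∃ a, Nat.card U = p ^ a) {C : ℕ → Subgroup G}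
    (hC : IsDecomposedChain N U θ C) (B K : Subgroup G) (h : IsNormalPair N U θ B K)
    (hBC : B ≤ C 0) (f : M) (hf : ∀ q, θ q ∈ K → ρ q f = f)
    (h0 : triSum FN FU τ ρ B f = 0) : f = 0 := by
  induction hk : (B : Set G).ncard - (K : Set G).ncard using Nat.strong_induction_on
    generalizing B K f with
  | _ k ih =>
  subst hk
  have hfin : (B : Set G).Finite := hC.finite.subset hBC
  -- The induction hypothesis with θ(c) adjoined to K; it is applied below to partial sums rather
  -- than to f.
  have fixed_central : ∀ c, θ c ∈ B → (∀ b ∈ B, b * θ c * b⁻¹ * (θ c)⁻¹ ∈ K) → θ c ∉ K →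
      ∀ f' : M, (∀ q, θ q ∈ K → ρ q f' = f') → triSum FN FU τ ρ B f' = 0 → ρ c f' = f' →
      f' = 0 := by
    intro c hcB hc hcK f' hf' h0' hcf
    obtain ⟨hd, hq⟩ := h.decomposed_adjoin_theta T hcB hc
    have hp' := h.adjoin_pair hcB hc hd
    refine ih _ (ncard_sub_lt_of_adjoin hfin ?_ hp'.le) B _ hp' hBC f' ?_ h0' rfl
    · exact lt_of_le_of_ne (h.le_adjoin hcB hc) fun he => hcK (he ▸ h.mem_adjoin hcB hc)
    · intro t ht
      obtain ⟨i, q, hqK, rfl⟩ := hq t ht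
      rw [map_mul]
      change ρ _ (ρ q f') = f'
      rw [hf' q hqK, rho_zpow_fix ρ hcf]
  -- Sums of translates of f inherit both hypotheses on f, since K is normal in B and the operator
  -- commutes with the torus part of B.
  have orbit_sum : ∀ (s : Finset G) (g : G → Q), (∀ x ∈ s, θ (g x) ∈ B) →
      (∀ q, θ q ∈ K → ρ q (∑ x ∈ s, ρ (g x) f) = ∑ x ∈ s, ρ (g x) f) ∧
      triSum FN FU τ ρ B (∑ x ∈ s, ρ (g x) f) = 0 := by
    intro s g hg
    constructor
    · intro q hq
      rw [map_sum]
      exact Finset.sum_congr rfl fun x hx => h.rho_fix ρ hf (hg x hx) hq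
    · rw [map_sum]
      refine Finset.sum_eq_zero fun x hx => ?_
      have := triSum_commute T hFN hFU ρ h.decB (hg x hx)
      change (triSum FN FU τ ρ B * ρ (g x)) f = 0
      rw [← this]
      change ρ (g x) (triSum FN FU τ ρ B f) = 0
      rw [h0, map_zero]
  -- Obstructions to the terminal situation. Noncentral torus elements are included so that one
  -- level deeper every torus element is central modulo K.
  let bad : ℕ → Prop := fun j => ∃ z ∈ C j, z ∈ B ∧ ((z ∈ N ∧ z ∉ K) ∨ (z ∈ U ∧ z ∉ K) ∨
    ∃ t, z = θ t ∧ ¬ ∀ b ∈ B, b * θ t * b⁻¹ * (θ t)⁻¹ ∈ K)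
  by_cases hb0 : bad 0
  swap
  · refine eq_zero_of_terminal T hFN hFU ρ hp hM hN hU h ?_ ?_ hf h0
    · intro x hx hxB
      by_contra hxK
      exact hb0 ⟨x, hBC hxB, hxB, Or.inl ⟨hx, hxK⟩⟩
    · intro x hx hxB
      by_contra hxK
      exact hb0 ⟨x, hBC hxB, hxB, Or.inr (Or.inl ⟨hx, hxK⟩)⟩
  -- The chain reaches the trivial group, and 1 is never bad, so badness stops at some level.
  obtain ⟨j, hj, hj'⟩ : ∃ j, bad j ∧ ¬ bad (j + 1) := by
    by_contra hcon
    push Not at hcon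
    have hall : ∀ j, bad j := fun j => by
      induction j with
      | zero => exact hb0
      | succ j ihj => exact hcon j ihj
    obtain ⟨m, hm⟩ := hC.bot
    obtain ⟨z, hz, -, hz'⟩ := hall m
    rw [hm, Subgroup.mem_bot] at hz
    subst hz
    rcases hz' with hz' | hz' | ⟨t, ht, hz'⟩
    · exact hz'.2 (one_mem _)
    · exact hz'.2 (one_mem _)
    · rw [← ht] at hz'
      exact hz' fun b _ => by simp
  -- Below the bad level both outer factors lie in K, so every element is, modulo K, a torus element
  -- central in B/K. This applies to all commutators of z with B.
  have notbad : ∀ w ∈ C (j + 1), w ∈ B → (w ∈ N → w ∈ K) ∧ (w ∈ U → w ∈ K) ∧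
      ∃ c, θ c ∈ B ∧ (∀ b ∈ B, b * θ c * b⁻¹ * (θ c)⁻¹ ∈ K) ∧ ∃ k ∈ K, w = θ c * k := by
    intro w hwC hwB
    have hd := T.decomposed_inf (hC.dec (j + 1)) h.decB
    have h1 : ∀ x ∈ C (j + 1), x ∈ B → x ∈ N → x ∈ K := by
      intro x hxC hxB hx
      by_contra hxK
      exact hj' ⟨x, hxC, hxB, Or.inl ⟨hx, hxK⟩⟩
    have h2 : ∀ x ∈ C (j + 1), x ∈ B → x ∈ U → x ∈ K := by
      intro x hxC hxB hx
      by_contra hxK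
      exact hj' ⟨x, hxC, hxB, Or.inr (Or.inl ⟨hx, hxK⟩)⟩
    refine ⟨h1 w hwC hwB, h2 w hwC hwB, ?_⟩
    obtain ⟨n, hn, c, u, hu, hn', hc', hu', rfl⟩ := hd w ⟨hwC, hwB⟩
    refine ⟨c, hc'.2, ?_, (θ c)⁻¹ * n * θ c * u,
      mul_mem (h.conj' hc'.2 (h1 n hn'.1 hn'.2 hn)) (h2 u hu'.1 hu'.2 hu), by group⟩
    by_contra hcc
    exact hj' ⟨θ c, hc'.1, hc'.2, Or.inr (Or.inr ⟨c, rfl, hcc⟩)⟩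
  obtain ⟨z, hzC, hzB, hz⟩ := hj
  have hcomm : ∀ b ∈ B, b * z * b⁻¹ * z⁻¹ ∈ C (j + 1) ∧ b * z * b⁻¹ * z⁻¹ ∈ B := fun b hb =>
    ⟨hC.comm j b (hBC hb) z hzC, mul_mem (mul_mem (mul_mem hb hzB) (inv_mem hb)) (inv_mem hzB)⟩
  have use_adjoin : ∀ hc : (∀ b ∈ B, b * z * b⁻¹ * z⁻¹ ∈ K), z ∉ K →
      (Decomposed N U θ (h.adjoin hzB hc) ∧ ∀ q, θ q ∈ h.adjoin hzB hc → θ q ∈ K) → f = 0 := by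
    intro hc hzK hd
    have hp' := h.adjoin_pair hzB hc hd.1
    refine ih _ (ncard_sub_lt_of_adjoin hfin ?_ hp'.le) B _ hp' hBC f
      (fun t ht => hf t (hd.2 t ht)) h0 rfl
    exact lt_of_le_of_ne (h.le_adjoin hzB hc) fun he => hzK (he ▸ h.mem_adjoin hzB hc)
  have hle : h.cent hzB ≤ B := fun b hb => hb.1
  have use_cent : ¬ (∀ b ∈ B, b * z * b⁻¹ * z⁻¹ ∈ K) → Decomposed N U θ (h.cent hzB) →
      triSum FN FU τ ρ (h.cent hzB) f = triSum FN FU τ ρ B f → f = 0 := by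
    intro hnc hd hs
    refine ih _ (ncard_sub_lt_of_cent hfin ?_ (h.le_cent hzB)) _ K (h.cent_pair hzB hd)
      (hle.trans hBC) f hf (hs.trans h0) rfl
    exact lt_of_le_of_ne hle fun he => hnc fun b hb => (he.ge hb).2
  rcases hz with ⟨hzN, hzK⟩ | ⟨hzU, hzK⟩ | ⟨t, rfl, hzc⟩
  · by_cases hc : ∀ b ∈ B, b * z * b⁻¹ * z⁻¹ ∈ K
    · exact use_adjoin hc hzK (h.decomposed_adjoin_N T hzB hc hzN)
    -- Commutators of z ∈ N with N and with the torus lie in N, hence in K by `notbad`. Only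
    -- elements of U can fail to commute with z.
    have hNc : ∀ x ∈ N, x ∈ B → x ∈ h.cent hzB := fun x hx hxB =>
      ⟨hxB, (notbad _ (hcomm x hxB).1 (hcomm x hxB).2).1
        (mul_mem (mul_mem (mul_mem hx hzN) (inv_mem hx)) (inv_mem hzN))⟩
    have hTc : ∀ q, θ q ∈ B → θ q ∈ h.cent hzB := fun q hxB =>
      ⟨hxB, (notbad _ (hcomm _ hxB).1 (hcomm _ hxB).2).1
        (mul_mem (T.conjN q z hzN) (inv_mem hzN))⟩
    refine use_cent hc ?_ (triSum_eq_of_le hFN hFU ρ hle hNc f ?_)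
    · intro b hb
      obtain ⟨n, hn, q, u, hu, h1, h2, h3, rfl⟩ := h.decB b hb.1
      refine ⟨n, hn, q, u, hu, hNc n hn h1, hTc q h2, ?_, rfl⟩
      have := mul_mem (inv_mem (mul_mem (hNc n hn h1) (hTc q h2))) hb
      rwa [inv_mul_cancel_left] at this
    · intro x hx hxB hxc
      obtain ⟨-, -, c, hcB, hcc, k, hk, hw⟩ := notbad _ (hcomm x hxB).1 (hcomm x hxB).2
      -- If θ(c) were in K, then x would centralise z modulo K. So adjoining θ(c) really enlarges K.
      have hcK : θ c ∉ K := fun hcK => hxc ⟨hxB, hw ▸ mul_mem hcK hk⟩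
      obtain ⟨o1, o2⟩ := orbit_sum (FN.filter (· ∈ B)) (fun n => τ (x * n)) fun n hn =>
        T.theta_tau_mem h.decB (mul_mem hxB (Finset.mem_filter.1 hn).2)
      exact sum_eq_zero_of_translate hFN ρ hzB hzN _ c
        (fun n _ hnB => translate_N T ρ h hf hxB hzB hzN hnB hk hw)
        (fixed_central c hcB hcc hcK _ o1 o2)
  · by_cases hc : ∀ b ∈ B, b * z * b⁻¹ * z⁻¹ ∈ K
    · exact use_adjoin hc hzK (h.decomposed_adjoin_U T hzB hc hzU)
    have hUc : ∀ x ∈ U, x ∈ B → x ∈ h.cent hzB := fun x hx hxB =>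
      ⟨hxB, (notbad _ (hcomm x hxB).1 (hcomm x hxB).2).2.1
        (mul_mem (mul_mem (mul_mem hx hzU) (inv_mem hx)) (inv_mem hzU))⟩
    have hTc : ∀ q, θ q ∈ B → θ q ∈ h.cent hzB := fun q hxB =>
      ⟨hxB, (notbad _ (hcomm _ hxB).1 (hcomm _ hxB).2).2.1
        (mul_mem (T.conjU q z hzU) (inv_mem hzU))⟩
    refine use_cent hc ?_ (triSum_eq_of_le' hFN hFU ρ hle hUc f ?_)
    · intro b hb
      obtain ⟨n, hn, q, u, hu, h1, h2, h3, rfl⟩ := h.decB b hb.1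
      refine ⟨n, hn, q, u, hu, ?_, hTc q h2, hUc u hu h3, rfl⟩
      have := mul_mem hb (inv_mem (mul_mem (hTc q h2) (hUc u hu h3)))
      simpa [mul_assoc] using this
    · intro x hx hxB hxc
      obtain ⟨-, -, c, hcB, hcc, k, hk, hw⟩ := notbad _ (hcomm x hxB).1 (hcomm x hxB).2
      have hcK : θ c⁻¹ ∉ K := fun hcK => hxc ⟨hxB, hw ▸ mul_mem (by simpa using hcK) hk⟩
      have hcB' : θ c⁻¹ ∈ B := by simpa using hcB
      have hcc' : ∀ b ∈ B, b * θ c⁻¹ * b⁻¹ * (θ c⁻¹)⁻¹ ∈ K := fun b hb => by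
        simpa using h.conj_zpow hcB hcc (-1) hb
      obtain ⟨o1, o2⟩ := orbit_sum (FU.filter (· ∈ B)) (fun n => τ (n * x)) fun n hn =>
        T.theta_tau_mem h.decB (mul_mem (Finset.mem_filter.1 hn).2 hxB)
      exact sum_eq_zero_of_translate_right hFU ρ hzB hzU _ c⁻¹
        (fun n _ hnB => translate_U T ρ h hf hnB hzB hzU hxB hk hcc hw)
        (fixed_central c⁻¹ hcB' hcc' hcK _ o1 o2)
  -- For z = θ(t), the commutators with N stay in N and those with U stay in U, so both parts
  -- centralise z modulo K. The sum is unchanged and only the torus part of B shrinks.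
  · have hNc : ∀ x ∈ N, x ∈ B → x ∈ h.cent hzB := fun x hx hxB =>
      ⟨hxB, (notbad _ (hcomm x hxB).1 (hcomm x hxB).2).1 (by
        have := mul_mem hx (T.conjN t _ (inv_mem hx))
        simpa [mul_assoc] using this)⟩
    have hUc : ∀ x ∈ U, x ∈ B → x ∈ h.cent hzB := fun x hx hxB =>
      ⟨hxB, (notbad _ (hcomm x hxB).1 (hcomm x hxB).2).2.1 (by
        have := mul_mem hx (T.conjU t _ (inv_mem hx))
        simpa [mul_assoc] using this)⟩
    refine use_cent hzc ?_ (triSum_eq_of_le hFN hFU ρ hle hNc f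
      fun x hx hxB hxc => (hxc (hUc x hx hxB)).elim)
    intro b hb
    obtain ⟨n, hn, q, u, hu, h1, h2, h3, rfl⟩ := h.decB b hb.1
    refine ⟨n, hn, q, u, hu, hNc n hn h1, ?_, hUc u hu h3, rfl⟩
    have := mul_mem (mul_mem (inv_mem (hNc n hn h1)) hb) (inv_mem (hUc u hu h3))
    simpa [mul_assoc] using this

end Induction

end TriangularDecomposition
end

/-! ### Identities and invertibility in the group algebra. -/

noncomputable section

namespace TriangularDecomposition

open scoped Classical

section GroupAlgebra

variable {G Q : Type*} [Group G] [Group Q] (R : Type*) [Ring R]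

/-- The sum of the elements of a finite set in the group algebra. -/
def setSum (F : Finset G) : MonoidAlgebra R G := ∑ x ∈ F, MonoidAlgebra.of R G x

/-- The sum of the middle factors of the products `x n`. -/
def midSum (FN FU : Finset G) (τ : G → Q) : MonoidAlgebra R Q :=
  ∑ x ∈ FU, ∑ n ∈ FN, MonoidAlgebra.of R Q (τ (x * n))

variable {X : Subgroup G} {F : Finset G}

lemma setSum_mul_of (hF : ∀ x, x ∈ F ↔ x ∈ X) {g : G} (hg : g ∈ X) :
    setSum R F * MonoidAlgebra.of R G g = setSum R F := by
  rw [setSum, Finset.sum_mul]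
  refine Finset.sum_nbij' (fun x => x * g) (fun x => x * g⁻¹) ?_ ?_ ?_ ?_ ?_
  · intro x hx; rw [hF] at hx ⊢; exact mul_mem hx hg
  · intro x hx; rw [hF] at hx ⊢; exact mul_mem hx (inv_mem hg)
  · intro x _; simp
  · intro x _; simp
  · intro x _; rw [map_mul]

lemma of_mul_setSum (hF : ∀ x, x ∈ F ↔ x ∈ X) {g : G} (hg : g ∈ X) :
    MonoidAlgebra.of R G g * setSum R F = setSum R F := by
  rw [setSum, Finset.mul_sum]
  refine Finset.sum_nbij' (fun x => g * x) (fun x => g⁻¹ * x) ?_ ?_ ?_ ?_ ?_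
  · intro x hx; rw [hF] at hx ⊢; exact mul_mem hg hx
  · intro x hx; rw [hF] at hx ⊢; exact mul_mem (inv_mem hg) hx
  · intro x _; simp
  · intro x _; simp
  · intro x _; rw [map_mul]

/-- Conjugation moves `[X]` to `[Y]`. -/
lemma of_mul_setSum_eq {Y : Subgroup G} {F' : Finset G} (hF : ∀ x, x ∈ F ↔ x ∈ X)
    (hF' : ∀ x, x ∈ F' ↔ x ∈ Y) {g : G} (h : ∀ x ∈ X, g * x * g⁻¹ ∈ Y)
    (h' : ∀ y ∈ Y, g⁻¹ * y * g ∈ X) :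
    MonoidAlgebra.of R G g * setSum R F = setSum R F' * MonoidAlgebra.of R G g := by
  rw [setSum, setSum, Finset.mul_sum, Finset.sum_mul]
  refine Finset.sum_nbij' (fun x => g * x * g⁻¹) (fun x => g⁻¹ * x * g) ?_ ?_ ?_ ?_ ?_
  · intro x hx; rw [hF] at hx; rw [hF']; exact h x hx
  · intro x hx; rw [hF'] at hx; rw [hF]; exact h' x hx
  · intro x _; group
  · intro x _; group
  · intro x _; rw [← map_mul, ← map_mul]; simp

variable {N U U' : Subgroup G} {θ : Q →* G} {τ : G → Q} {FN FU FU' : Finset G}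
  (T : IsTriangular N U θ τ) (hFN : ∀ x, x ∈ FN ↔ x ∈ N) (hFU : ∀ x, x ∈ FU ↔ x ∈ U)
  (hdec : ∀ x ∈ U, ∀ n ∈ N, ∃ n' ∈ N, ∃ q, ∃ u ∈ U, x * n = n' * θ q * u)
include T hFN hFU hdec

omit hFU in
lemma setSum_mul_of_mul {x n : G} (hx : x ∈ U) (hn : n ∈ N) :
    ∃ u ∈ U, setSum R FN * MonoidAlgebra.of R G (x * n) =
      setSum R FN * MonoidAlgebra.of R G (θ (τ (x * n))) * MonoidAlgebra.of R G u := by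
  obtain ⟨n', hn', q, u, hu, h⟩ := hdec x hx n hn
  refine ⟨u, hu, ?_⟩
  rw [h, T.tau n' hn' q u hu, map_mul, map_mul, ← mul_assoc, ← mul_assoc, setSum_mul_of R hFN hn']

/-- In [N] x n [U] the outer factors of x n = n' θ(t) u are absorbed by [N] and [U]. -/
theorem sq_setSum_mul_setSum : (setSum R FN * setSum R FU) ^ 2 =
    setSum R FN * MonoidAlgebra.mapDomainRingHom R θ (midSum R FN FU τ) * setSum R FU := by
  have h1 : MonoidAlgebra.mapDomainRingHom R θ (midSum R FN FU τ) =
      ∑ x ∈ FU, ∑ n ∈ FN, MonoidAlgebra.of R G (θ (τ (x * n))) := by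
    simp [midSum, map_sum]
  have h2 : (setSum R FN * setSum R FU) ^ 2 =
      ∑ x ∈ FU, ∑ n ∈ FN, setSum R FN * MonoidAlgebra.of R G (x * n) * setSum R FU := by
    have h3 : setSum R FU * setSum R FN =
        ∑ x ∈ FU, ∑ n ∈ FN, MonoidAlgebra.of R G (x * n) := by
      simp only [setSum, Finset.sum_mul_sum, map_mul]
    rw [sq, mul_assoc, ← mul_assoc (setSum R FU), h3, ← mul_assoc, Finset.mul_sum, Finset.sum_mul]
    refine Finset.sum_congr rfl fun x _ => ?_
    rw [Finset.mul_sum, Finset.sum_mul]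
  rw [h1, h2, Finset.mul_sum, Finset.sum_mul]
  refine Finset.sum_congr rfl fun x hx => ?_
  rw [Finset.mul_sum, Finset.sum_mul]
  refine Finset.sum_congr rfl fun n hn => ?_
  obtain ⟨u, hu, h⟩ := setSum_mul_of_mul R T hFN hdec ((hFU x).1 hx) ((hFN n).1 hn)
  rw [h, mul_assoc _ (MonoidAlgebra.of R G u), of_mul_setSum R hFU hu]

theorem midSum_mem_center : midSum R FN FU τ ∈ Subring.center (MonoidAlgebra R Q) := by
  have hc : ∀ c : Q, MonoidAlgebra.of R Q c * midSum R FN FU τ =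
      midSum R FN FU τ * MonoidAlgebra.of R Q c := by
    intro c
    have hN' : ∀ x ∈ N, (θ c)⁻¹ * x * θ c ∈ N := fun x hx => by
      simpa using T.conjN c⁻¹ x hx
    have hU' : ∀ x ∈ U, (θ c)⁻¹ * x * θ c ∈ U := fun x hx => by
      simpa using T.conjU c⁻¹ x hx
    have e1 : ∀ φ : G → MonoidAlgebra R Q, ∑ x ∈ FU, φ (θ c * x * (θ c)⁻¹) = ∑ x ∈ FU, φ x := by
      intro φ
      simpa using sum_conj_eq (B := ⊤) (g := θ c) hFU trivial (T.conjU c) hU' φ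
    have e2 : ∀ φ : G → MonoidAlgebra R Q, ∑ x ∈ FN, φ (θ c * x * (θ c)⁻¹) = ∑ x ∈ FN, φ x := by
      intro φ
      simpa using sum_conj_eq (B := ⊤) (g := θ c) hFN trivial (T.conjN c) hN' φ
    rw [midSum, Finset.mul_sum, Finset.sum_mul,
      ← e1 fun x => (∑ n ∈ FN, MonoidAlgebra.of R Q (τ (x * n))) * MonoidAlgebra.of R Q c]
    refine Finset.sum_congr rfl fun x hx => ?_
    rw [Finset.mul_sum, Finset.sum_mul, ← e2 fun n =>
      MonoidAlgebra.of R Q (τ (θ c * x * (θ c)⁻¹ * n)) * MonoidAlgebra.of R Q c]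
    refine Finset.sum_congr rfl fun n hn => ?_
    have h := T.tau_conj (c := c) (hdec x ((hFU x).1 hx) n ((hFN n).1 hn))
    rw [show θ c * x * (θ c)⁻¹ * (θ c * n * (θ c)⁻¹) = θ c * (x * n) * (θ c)⁻¹ by group, h,
      ← map_mul, ← map_mul]
    simp
  -- R need not be commutative: scalars commute with the sum because the sum has integral
  -- coefficients.
  have hr : ∀ r : R, MonoidAlgebra.single 1 r * midSum R FN FU τ =
      midSum R FN FU τ * MonoidAlgebra.single 1 r := by
    intro r
    simp only [midSum, Finset.mul_sum, Finset.sum_mul]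
    simp [MonoidAlgebra.single_mul_single]
  rw [Subring.mem_center_iff]
  intro a
  induction a using MonoidAlgebra.induction_linear with
  | zero => simp
  | add a b ha hb => rw [add_mul, mul_add, ha, hb]
  | single q r =>
    have : (MonoidAlgebra.single q r : MonoidAlgebra R Q) =
        MonoidAlgebra.single 1 r * MonoidAlgebra.of R Q q := by
      simp [MonoidAlgebra.single_mul_single]
    rw [this, mul_assoc, hc, ← mul_assoc, hr, mul_assoc]

/-- By the square formula, the left side is the contribution of the trivial coset of U in U' to
[N][U'][N][U]. The remaining cosets are treated with the elements m that exchange N and U', and are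
then subtracted. -/
theorem setSum_mul_midSum_mul_mem (hFU' : ∀ x, x ∈ FU' ↔ x ∈ U') (hUU' : U ≤ U')
    (hconj : ∀ q, ∀ u ∈ U', θ q * u * (θ q)⁻¹ ∈ U')
    (hswap : ∀ u ∈ U', u ∉ U → ∃ v ∈ N, ∃ m, ∃ v' ∈ N, u = v * m * v' ∧
      (∀ n ∈ N, m * n * m⁻¹ ∈ U') ∧ ∀ u ∈ U', m⁻¹ * u * m ∈ N) :
    ∃ f, setSum R FN * MonoidAlgebra.mapDomainRingHom R θ (midSum R FN FU τ) * setSum R FU =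
      setSum R FN * setSum R FU' * f := by
  -- Representatives of the cosets U s, with 1 representing the trivial one; those in U' form J, so
  -- that [U'] = [U][J].
  obtain ⟨S, hS, hS1⟩ := Subgroup.exists_isComplement_right U 1
  have hU'FN : ∀ x ∈ FU, x ∈ U' := fun x hx => hUU' ((hFU x).1 hx)
  set J := FU'.filter (· ∈ S) with hJ
  have hmem : ∀ x ∈ J, x ∈ U' ∧ x ∈ S := fun x hx => by
    rw [hJ, Finset.mem_filter, hFU'] at hx
    exact hx
  have hfac : setSum R FU' = setSum R FU * setSum R J := by
    simp only [setSum, Finset.sum_mul_sum]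
    rw [← Finset.sum_product']
    symm
    refine Finset.sum_nbij (fun q => q.1 * q.2) ?_ ?_ ?_ ?_
    · intro q hq
      rw [Finset.mem_product] at hq
      exact (hFU' _).2 (mul_mem (hU'FN _ hq.1) (hmem _ hq.2).1)
    · intro q hq q' hq' h
      simp only [Finset.coe_product, Set.mem_prod, Finset.mem_coe] at hq hq'
      have := hS.1 (a₁ := (⟨q.1, (hFU _).1 hq.1⟩, ⟨q.2, (hmem _ hq.2).2⟩))
        (a₂ := (⟨q'.1, (hFU _).1 hq'.1⟩, ⟨q'.2, (hmem _ hq'.2).2⟩)) h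
      simp only [Prod.mk.injEq, Subtype.mk.injEq] at this
      exact Prod.ext this.1 this.2
    · intro x hx
      obtain ⟨⟨u, s⟩, hus⟩ := hS.2 x
      have hus' : (u : G) * s = x := hus
      refine ⟨(u, s), ?_, hus⟩
      simp only [Finset.coe_product, Set.mem_prod, Finset.mem_coe]
      refine ⟨(hFU _).2 u.2, ?_⟩
      rw [hJ, Finset.mem_filter, hFU']
      refine ⟨?_, s.2⟩
      have : (s : G) = (u : G)⁻¹ * x := by rw [← hus']; group
      rw [this]
      exact mul_mem (inv_mem (hUU' u.2)) ((hFU' x).1 hx)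
    · intro q _
      rw [map_mul]
  have h1J : (1 : G) ∈ J := by
    rw [hJ, Finset.mem_filter, hFU']
    exact ⟨one_mem _, hS1⟩
  have hterm : ∀ j, ∃ f, j ∈ J.erase 1 → setSum R FN * setSum R FU * MonoidAlgebra.of R G j *
      (setSum R FN * setSum R FU) = setSum R FN * setSum R FU' * f := by
    intro j
    by_cases hj : j ∈ J.erase 1
    swap
    · exact ⟨0, fun h => (hj h).elim⟩
    rw [Finset.mem_erase] at hj
    have hjU : j ∉ U := by
      intro hjU
      have := hS.1 (a₁ := (⟨j, hjU⟩, ⟨1, hS1⟩)) (a₂ := (1, ⟨j, (hmem _ hj.2).2⟩)) (by simp)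
      simp only [Prod.mk.injEq, Subtype.mk.injEq] at this
      exact hj.1 this.2.symm
    obtain ⟨v, hv, m, v', hv', rfl, hm, hm'⟩ := hswap j (hmem _ hj.2).1 hjU
    -- v' disappears in [N], and moving m across turns [N] into [U'].
    have e1 : MonoidAlgebra.of R G (v * m * v') * setSum R FN =
        MonoidAlgebra.of R G v * setSum R FU' * MonoidAlgebra.of R G m := by
      rw [map_mul, map_mul, mul_assoc, of_mul_setSum R hFN hv', mul_assoc,
        of_mul_setSum_eq R hFN hFU' hm hm', mul_assoc]
    -- Each x v with x ∈ U factorises: its left factor is absorbed by [N], its right factor by [U']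
    -- ⊇ [U], and the torus factor commutes with [U'].
    have e2 : setSum R FN * setSum R FU * MonoidAlgebra.of R G v * setSum R FU' =
        setSum R FN * setSum R FU' * ∑ x ∈ FU, MonoidAlgebra.of R G (θ (τ (x * v))) := by
      rw [setSum.eq_1 R FU, Finset.mul_sum, Finset.sum_mul, Finset.sum_mul, Finset.mul_sum]
      refine Finset.sum_congr rfl fun x hx => ?_
      obtain ⟨u, hu, h⟩ := setSum_mul_of_mul R T hFN hdec ((hFU x).1 hx) hv
      rw [mul_assoc (setSum R FN) _ (MonoidAlgebra.of R G v), ← map_mul, h, mul_assoc _ _ (setSum R FU'),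
        of_mul_setSum R hFU' (hUU' hu), mul_assoc,
        of_mul_setSum_eq R hFU' hFU' (hconj _) (fun y hy => by simpa using hconj (τ (x * v))⁻¹ y hy), mul_assoc]
    refine ⟨(∑ x ∈ FU, MonoidAlgebra.of R G (θ (τ (x * v)))) * MonoidAlgebra.of R G m *
      setSum R FU, fun _ => ?_⟩
    calc _ = setSum R FN * setSum R FU * (MonoidAlgebra.of R G (v * m * v') * setSum R FN) *
          setSum R FU := by simp only [mul_assoc]
      _ = (setSum R FN * setSum R FU * MonoidAlgebra.of R G v * setSum R FU') *
          MonoidAlgebra.of R G m * setSum R FU := by rw [e1]; simp only [mul_assoc]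
      _ = _ := by rw [e2]; simp only [mul_assoc]
  choose f hf using hterm
  refine ⟨setSum R FN * setSum R FU - ∑ j ∈ J.erase 1, f j, ?_⟩
  -- The factor [N][U] in the witness produces the whole of [N][U'][N][U], of which only the term j
  -- = 1 remains after the subtraction.
  rw [← sq_setSum_mul_setSum R T hFN hFU hdec, mul_sub, Finset.mul_sum,
    ← Finset.sum_congr rfl fun j hj => hf j hj, eq_sub_iff_add_eq, hfac, setSum.eq_1 R J,
    ← Finset.add_sum_erase _ _ h1J, map_one]
  simp only [sq, mul_add, add_mul, Finset.mul_sum, Finset.sum_mul, mul_assoc, one_mul]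

/-- Injectivity on every p-torsion-free module becomes invertibility by testing it on R[Q]/R[Q]s,
where s acts as zero: the quotient must vanish. -/
theorem isUnit_midSum {p : ℕ} (hp : p.Prime) (hpR : IsUnit (p : R))
    (hN : ∃ a, Nat.card N = p ^ a) (hU : ∃ a, Nat.card U = p ^ a) {C : ℕ → Subgroup G}
    (hC : IsDecomposedChain N U θ C) (hNC : N ≤ C 0) (hUC : U ≤ C 0) :
    IsUnit (midSum R FN FU τ) := by
  set s := midSum R FN FU τ with hs
  have hcen : s ∈ Subring.center (MonoidAlgebra R Q) := midSum_mem_center R T hFN hFU hdec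
  -- A left ideal; centrality of s is what makes s annihilate the quotient.
  let I : Ideal (MonoidAlgebra R Q) := Ideal.span {s}
  let ρ : Q →* AddMonoid.End (MonoidAlgebra R Q ⧸ I) :=
    (DistribMulAction.toAddMonoidEnd (MonoidAlgebra R Q) (MonoidAlgebra R Q ⧸ I)).comp
      (MonoidAlgebra.of R Q)
  have key : ∀ f : MonoidAlgebra R Q ⧸ I, triSum FN FU τ ρ (C 0) f = s • f := by
    intro f
    rw [triSum_apply, hs, midSum, Finset.sum_smul, Finset.filter_true_of_mem
      fun x hx => hUC ((hFU x).1 hx)]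
    refine Finset.sum_congr rfl fun x _ => ?_
    rw [Finset.sum_smul, Finset.filter_true_of_mem fun x hx => hNC ((hFN x).1 hx)]
    rfl
  have hzero : ∀ f : MonoidAlgebra R Q ⧸ I, s • f = 0 := by
    intro f
    obtain ⟨a, rfl⟩ := Submodule.Quotient.mk_surjective I f
    rw [← Submodule.Quotient.mk_smul, Submodule.Quotient.mk_eq_zero, smul_eq_mul,
      ← (Subring.mem_center_iff.1 hcen a)]
    exact Ideal.mul_mem_left _ _ (Ideal.subset_span rfl)
  have hpA : IsUnit (p : MonoidAlgebra R Q) := by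
    have := hpR.map (MonoidAlgebra.singleOneRingHom (R := R) (M := Q))
    simpa using this
  -- With K trivial, the fixedness condition on the class of 1 is vacuous, since θ is injective.
  have h1 : (Submodule.Quotient.mk 1 : MonoidAlgebra R Q ⧸ I) = 0 := by
    refine eq_zero_of_triSum_eq_zero T hFN hFU ρ hp (fun f hf => ?_) hN hU hC (C 0) ⊥
      ⟨bot_le, ?_, hC.dec 0, ?_⟩ le_rfl _ (fun q hq => ?_) ((key _).trans (hzero _))
    · rw [← Nat.cast_smul_eq_nsmul (MonoidAlgebra R Q)] at hf
      exact hpA.smul_eq_zero.1 hf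
    · intro b _ k hk
      rw [Subgroup.mem_bot] at hk ⊢
      simp [hk]
    · intro x hx
      rw [Subgroup.mem_bot] at hx
      exact ⟨1, one_mem _, 1, 1, one_mem _, one_mem _, by simp, one_mem _, by simp [hx]⟩
    · have : q = 1 := by
        rw [Subgroup.mem_bot] at hq
        exact T.eq_of_eq_theta (one_mem _) (one_mem _) (q := q) (t := 1) (by simp [hq]) 
      simp [this]
  rw [Submodule.Quotient.mk_eq_zero, Ideal.mem_span_singleton'] at h1
  obtain ⟨a, ha⟩ := h1
  exact ⟨⟨s, a, by rw [← (Subring.mem_center_iff.1 hcen a), ha], ha⟩, rfl⟩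

end GroupAlgebra

end TriangularDecomposition
end

/-! ### Factorisation of groups generated by compact filtered pieces. -/

noncomputable section

namespace FilteredProduct

open scoped Pointwise

variable {Γ κ : Type*} [Group Γ] {A : κ → ℕ → Subgroup Γ}

/-- The group generated by the `n`-th layers. -/
def layer (A : κ → ℕ → Subgroup Γ) (n : ℕ) : Subgroup Γ := ⨆ c, A c n

/-- The product of the zeroth layers along a list. -/
def listProd (A : κ → ℕ → Subgroup Γ) (l : List κ) : Set Γ := (l.map fun c => (A c 0 : Set Γ)).prod

lemma le_layer (c : κ) (n : ℕ) : A c n ≤ layer A n := le_iSup (fun c => A c n) c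

lemma listProd_cons (c : κ) (l : List κ) :
    listProd A (c :: l) = (A c 0 : Set Γ) * listProd A l := by simp [listProd]

lemma listProd_append (l l' : List κ) :
    listProd A (l ++ l') = listProd A l * listProd A l' := by simp [listProd]

lemma listProd_subset {X : Subgroup Γ} {l : List κ} (h : ∀ c ∈ l, A c 0 ≤ X) :
    listProd A l ⊆ X := by
  induction l with
  | nil => simp [listProd, one_mem]
  | cons c l ih =>
    rw [listProd_cons]
    rintro _ ⟨x, hx, y, hy, rfl⟩
    exact mul_mem (h c (by simp) hx) (ih (fun c hc => h c (by simp [hc])) hy)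

lemma one_mem_listProd (l : List κ) : (1 : Γ) ∈ listProd A l := by
  induction l with
  | nil => simp [listProd]
  | cons c l ih =>
    rw [listProd_cons]
    exact ⟨1, one_mem _, 1, ih, by simp⟩

section

variable (hanti : ∀ c n, A c (n + 1) ≤ A c n)
  (hcomm : ∀ n c c', ⁅A c 0, A c' n⁆ ≤ layer A (n + 1))
include hanti hcomm

omit hcomm in
lemma A_le (c : κ) (n : ℕ) : A c n ≤ A c 0 := by
  induction n with
  | zero => exact le_rfl
  | succ n ih => exact (hanti c n).trans ih

omit hcomm in
lemma layer_anti (n : ℕ) : layer A (n + 1) ≤ layer A n := iSup_mono fun c => hanti c n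

lemma layer_conj {n : ℕ} {x y : Γ} (hx : x ∈ layer A 0) (hy : y ∈ layer A n) :
    x * y * x⁻¹ ∈ layer A n := by
  have : layer A 0 ≤ Subgroup.normalizer (layer A n : Set Γ) := by
    refine iSup_le fun c => Subgroup.le_normalizer_iff.2 fun x hx y hy => ?_
    have : layer A n ≤ (layer A n).comap (MulAut.conj x).toMonoidHom := by
      refine iSup_le fun c' z hz => ?_
      have h := layer_anti hanti n (hcomm n c c' (Subgroup.commutator_mem_commutator hx hz))
      have := mul_mem h (le_layer c' n hz)
      simpa [commutatorElement_def] using this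
    exact this hy
  exact Subgroup.le_normalizer_iff.1 this x hx y hy

/-- The condition on generators extends to products in both variables because layer n + 1 is stable
under conjugation by layer 0. -/
lemma layer_commutator {n : ℕ} {x y : Γ} (hx : x ∈ layer A 0) (hy : y ∈ layer A n) :
    x * y * x⁻¹ * y⁻¹ ∈ layer A (n + 1) := by
  have h1 : ∀ c', ∀ z ∈ A c' n, x * z * x⁻¹ * z⁻¹ ∈ layer A (n + 1) := by
    intro c' z hz
    suffices x ∈ layer A 0 ∧ x * z * x⁻¹ * z⁻¹ ∈ layer A (n + 1) from this.2
    refine Subgroup.iSup_induction (fun c => A c 0)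
      (C := fun x => x ∈ layer A 0 ∧ x * z * x⁻¹ * z⁻¹ ∈ layer A (n + 1)) hx ?_ ?_ ?_
    · intro c x hx
      exact ⟨le_layer c 0 hx, hcomm n c c' (Subgroup.commutator_mem_commutator hx hz)⟩
    · exact ⟨one_mem _, by simp⟩
    · intro x x' hx hx'
      refine ⟨mul_mem hx.1 hx'.1, ?_⟩
      have := mul_mem (layer_conj hanti hcomm hx.1 hx'.2) hx.2
      simpa [mul_assoc] using this
  suffices y ∈ layer A 0 ∧ x * y * x⁻¹ * y⁻¹ ∈ layer A (n + 1) from this.2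
  refine Subgroup.iSup_induction (fun c => A c n)
    (C := fun y => y ∈ layer A 0 ∧ x * y * x⁻¹ * y⁻¹ ∈ layer A (n + 1)) hy ?_ ?_ ?_
  · intro c y hy
    exact ⟨le_layer c 0 (A_le hanti c n hy), h1 c y hy⟩
  · exact ⟨one_mem _, by simp⟩
  · intro y y' hy hy'
    refine ⟨mul_mem hy.1 hy'.1, ?_⟩
    have := mul_mem hy.2 (layer_conj hanti hcomm hy.1 hy'.2)
    simpa [mul_assoc] using this

/-- The element a is carried left into the last factor with index c. The commutator produced on the
way lies one layer deeper. -/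
lemma listProd_mul_mem {l : List κ} {n : ℕ} {c : κ} (hc : c ∈ l) {x a : Γ}
    (hx : x ∈ listProd A l) (ha : a ∈ A c n) :
    x * a ∈ listProd A l * (layer A (n + 1) : Set Γ) := by
  induction l generalizing x with
  | nil => simp at hc
  | cons d l ih =>
    rw [listProd_cons] at hx ⊢
    obtain ⟨x₁, hx₁, x₂, hx₂, rfl⟩ := hx
    by_cases hcl : c ∈ l
    · obtain ⟨y, hy, g, hg, h⟩ := ih hcl hx₂
      refine ⟨x₁ * y, ⟨x₁, hx₁, y, hy, rfl⟩, g, hg, ?_⟩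
      simp only [mul_assoc] at h ⊢
      rw [h]
    · obtain rfl : c = d := by simpa [hcl] using hc
      have hx₂' : x₂⁻¹ ∈ layer A 0 := inv_mem (listProd_subset (fun c _ => le_layer c 0) hx₂)
      have := layer_commutator hanti hcomm hx₂' (inv_mem (le_layer c n ha))
      have h2 := layer_conj hanti hcomm (inv_mem hx₂') (n := n + 1)
        (layer_conj hanti hcomm (le_layer c 0 (A_le hanti c n ha)) this)
      refine ⟨x₁ * a * x₂, ⟨x₁ * a, mul_mem hx₁ (A_le hanti c n ha), x₂, hx₂, rfl⟩,
        x₂⁻¹ * a⁻¹ * x₂ * a, ?_, by group⟩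
      simpa using this

theorem layer_subset_listProd_mul {l : List κ} (hl : ∀ c, c ∈ l) (n : ℕ) :
    (layer A 0 : Set Γ) ⊆ listProd A l * (layer A n : Set Γ) := by
  have step : ∀ n, ∀ y ∈ layer A n, ∀ x ∈ listProd A l * (layer A (n + 1) : Set Γ),
      x * y ∈ listProd A l * (layer A (n + 1) : Set Γ) := by
    intro n y hy
    refine Subgroup.iSup_induction (fun c => A c n)
      (C := fun y => ∀ x ∈ listProd A l * (layer A (n + 1) : Set Γ),
        x * y ∈ listProd A l * (layer A (n + 1) : Set Γ)) hy ?_ (by simp) ?_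
    · rintro c a ha _ ⟨x, hx, g, hg, rfl⟩
      obtain ⟨x', hx', g', hg', h⟩ := listProd_mul_mem hanti hcomm (hl c) hx ha
      refine ⟨x', hx', g' * (a⁻¹ * g * a), mul_mem hg' ?_, ?_⟩
      · simpa using layer_conj hanti hcomm (inv_mem (le_layer c 0 (A_le hanti c n ha))) hg
      · simp only at h ⊢
        rw [← mul_assoc, h]
        group
    · intro y y' hy hy' x hx
      rw [← mul_assoc]
      exact hy' _ (hy x hx)
  induction n with
  | zero => exact fun x hx => ⟨1, one_mem_listProd l, x, hx, by simp⟩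
  | succ n ih =>
    intro x hx
    obtain ⟨y, hy, g, hg, rfl⟩ := ih hx
    exact step n g hg y ⟨y, hy, 1, one_mem _, by simp⟩

end

variable [TopologicalSpace Γ] [IsTopologicalGroup Γ]

lemma isCompact_listProd (hcpt : ∀ c, IsCompact (A c 0 : Set Γ)) (l : List κ) :
    IsCompact (listProd A l) := by
  induction l with
  | nil => simp [listProd]
  | cons c l ih =>
    rw [listProd_cons]
    exact (hcpt c).mul ih

/-- Successive correction gives the factorisation modulo every layer. The set of products is
compact, hence closed, so arbitrarily small errors can be removed. -/
theorem exists_factorization [T2Space Γ] {ι : Type*} [Finite ι] {A : Option ι → ℕ → Subgroup Γ}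
    (hΓ : ∀ O ∈ nhds (1 : Γ), ∃ K : Subgroup Γ, IsOpen (K : Set Γ) ∧ (K : Set Γ) ⊆ O)
    (hanti : ∀ c n, A c (n + 1) ≤ A c n)
    (hcomm : ∀ n c c', ⁅A c 0, A c' n⁆ ≤ layer A (n + 1))
    (hcpt : ∀ c, IsCompact (A c 0 : Set Γ))
    (hnorm : ∀ n a, ∀ h ∈ A none n, ∀ x ∈ A (some a) n, h * x * h⁻¹ ∈ A (some a) n)
    (hsmall : ∀ K : Subgroup Γ, IsOpen (K : Set Γ) → ∃ n, ∀ a, A (some a) n ≤ K)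
    (neg : ι → Prop) {g : Γ} (hg : g ∈ layer A 0) :
    ∃ v ∈ ⨆ (a : ι) (_ : neg a), A (some a) 0, ∃ w ∈ ⨆ (a : ι) (_ : ¬ neg a), A (some a) 0,
      ∃ h ∈ A none 0, g = v * w * h := by
  classical
  have := Fintype.ofFinite ι
  set lneg : List (Option ι) := (Finset.univ.filter neg).toList.map some with hlneg
  set lpos : List (Option ι) := (Finset.univ.filter (¬ neg ·)).toList.map some with hlpos
  -- The index `none` comes last: its groups are not assumed to shrink to 1, and in last position an
  -- error from them is absorbed exactly. Only the pieces `some a` need to become small.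
  set l : List (Option ι) := (lneg ++ lpos) ++ [none] with hl
  have hmem : ∀ c, c ∈ l := by
    intro c
    cases c with
    | none => simp [hl]
    | some a => by_cases h : neg a <;> simp [hl, hlneg, hlpos, h]
  have hP : listProd A l = listProd A lneg * listProd A lpos * (A none 0 : Set Γ) := by
    rw [hl, listProd_append, listProd_append]
    simp [listProd]
  have hgl : g ∈ listProd A l := by
    by_contra hgl
    have hclosed := (isCompact_listProd hcpt l).isClosed
    have hO : {k : Γ | g * k⁻¹ ∉ listProd A l} ∈ nhds (1 : Γ) := by
      refine IsOpen.mem_nhds ?_ (by simpa using hgl)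
      exact hclosed.isOpen_compl.preimage (by fun_prop : Continuous fun k : Γ => g * k⁻¹)
    obtain ⟨K, hK, hKO⟩ := hΓ _ hO
    obtain ⟨n, hn⟩ := hsmall K hK
    obtain ⟨x, hx, y, hy, rfl⟩ := layer_subset_listProd_mul hanti hcomm hmem n hg
    have hy' : y ∈ (A none n : Set Γ) * ((⨆ a, A (some a) n : Subgroup Γ) : Set Γ) := by
      have h1 : A none n ≤ Subgroup.normalizer ((⨆ a, A (some a) n : Subgroup Γ) : Set Γ) := by
        refine Subgroup.le_normalizer_iff.2 fun h hh k hk => ?_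
        have : (⨆ a, A (some a) n : Subgroup Γ) ≤
            (⨆ a, A (some a) n : Subgroup Γ).comap (MulAut.conj h).toMonoidHom :=
          iSup_le fun a z hz => Subgroup.mem_iSup_of_mem a (hnorm n a h hh z hz)
        exact this hk
      rw [← Subgroup.coe_mul_of_left_le_normalizer_right _ _ h1]
      have : layer A n = A none n ⊔ ⨆ a, A (some a) n := iSup_option _
      rwa [← this]
    obtain ⟨h, hh, k, hk, rfl⟩ := hy'
    refine hKO (show k ∈ K from (iSup_le hn) hk) ?_
    rw [hP] at hx ⊢
    obtain ⟨z, hz, h', hh', rfl⟩ := hx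
    exact ⟨z, hz, h' * h, mul_mem hh' (A_le hanti _ _ hh), by group⟩
  rw [hP] at hgl
  obtain ⟨_, ⟨v, hv, w, hw, rfl⟩, h, hh, rfl⟩ := hgl
  refine ⟨v, listProd_subset ?_ hv, w, listProd_subset ?_ hw, h, hh, rfl⟩
  · intro c hc
    obtain ⟨a, ha, rfl⟩ : ∃ a, neg a ∧ some a = c := by simpa [hlneg] using hc
    exact le_iSup₂_of_le a ha le_rfl
  · intro c hc
    obtain ⟨a, ha, rfl⟩ : ∃ a, ¬ neg a ∧ some a = c := by simpa [hlpos] using hc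
    exact le_iSup₂_of_le a ha le_rfl

end FilteredProduct
end

/-! ### Topology of GL_n over an ultrametric field: small open subgroups and unipotent elements. -/

noncomputable section

namespace LinAlgGroup

open Filter Topology

section CompactOpen

variable {Γ : Type*} [Group Γ] [TopologicalSpace Γ] [IsTopologicalGroup Γ]

lemma exists_finite_cosets {X Y : Subgroup Γ} (hX : IsCompact (X : Set Γ)) {O : Set Γ}
    (hO : IsOpen O) (h1 : (1 : Γ) ∈ O) (hOY : O ∩ X ⊆ Y) :
    ∃ t : Finset Γ, ∀ x ∈ X, ∃ z ∈ t, z⁻¹ * x ∈ Y := by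
  obtain ⟨t, htX, ht⟩ := hX.elim_nhds_subcover (fun z => {x | z⁻¹ * x ∈ O}) fun z _ => by
    refine IsOpen.mem_nhds (hO.preimage (by fun_prop : Continuous fun x : Γ => z⁻¹ * x)) ?_
    simpa using h1
  refine ⟨t, fun x hx => ?_⟩
  obtain ⟨z, hz, hzx⟩ := Set.mem_iUnion₂.1 (ht hx)
  exact ⟨z, hz, hOY ⟨hzx, mul_mem (inv_mem (htX z hz)) hx⟩⟩

end CompactOpen

section GeneralLinear

variable {F : Type*} [NontriviallyNormedField F] [IsUltrametricDist F] {n : ℕ}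

lemma norm_mul_sub_one_apply_le {ε : ℝ} (hε : 0 ≤ ε) (hε1 : ε ≤ 1)
    {A B : Matrix (Fin n) (Fin n) F}
    (hA : ∀ i j, ‖A i j - (1 : Matrix (Fin n) (Fin n) F) i j‖ ≤ ε)
    (hB : ∀ i j, ‖B i j - (1 : Matrix (Fin n) (Fin n) F) i j‖ ≤ ε) (i j : Fin n) :
    ‖(A * B) i j - (1 : Matrix (Fin n) (Fin n) F) i j‖ ≤ ε := by
  have h : (A * B) i j - (1 : Matrix (Fin n) (Fin n) F) i j =
      (∑ k, (A - 1) i k * (B - 1) k j) + ((A i j - (1 : Matrix (Fin n) (Fin n) F) i j) +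
        (B i j - (1 : Matrix (Fin n) (Fin n) F) i j)) := by
    have h : A * B - 1 = (A - 1) * (B - 1) + ((A - 1) + (B - 1)) := by noncomm_ring
    have := congrFun (congrFun h i) j
    simpa only [Matrix.add_apply, Matrix.sub_apply, Matrix.mul_apply] using this
  rw [h]
  refine (IsUltrametricDist.norm_add_le_max _ _).trans (max_le ?_
    ((IsUltrametricDist.norm_add_le_max _ _).trans (max_le (hA i j) (hB i j))))
  refine IsUltrametricDist.norm_sum_le_of_forall_le_of_nonneg hε fun k _ => ?_
  rw [norm_mul, Matrix.sub_apply, Matrix.sub_apply]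
  calc _ ≤ ε * 1 := mul_le_mul (hA i k) ((hB k j).trans hε1) (norm_nonneg _) hε
    _ = ε := mul_one ε

/-- The congruence subgroup of radius `ε`. -/
def congruenceSubgroup (F : Type*) [NontriviallyNormedField F] [IsUltrametricDist F] (n : ℕ)
    {ε : ℝ} (hε : 0 ≤ ε) (hε1 : ε ≤ 1) : Subgroup (GL (Fin n) F) where
  carrier := {g | (∀ i j, ‖(g : Matrix (Fin n) (Fin n) F) i j -
      (1 : Matrix (Fin n) (Fin n) F) i j‖ ≤ ε) ∧
    ∀ i j, ‖((g⁻¹ : GL (Fin n) F) : Matrix (Fin n) (Fin n) F) i j -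
      (1 : Matrix (Fin n) (Fin n) F) i j‖ ≤ ε}
  mul_mem' := by
    rintro g h ⟨hg, hg'⟩ ⟨hh, hh'⟩
    refine ⟨?_, ?_⟩
    · rw [Units.val_mul]
      exact norm_mul_sub_one_apply_le hε hε1 hg hh
    · rw [mul_inv_rev, Units.val_mul]
      exact norm_mul_sub_one_apply_le hε hε1 hh' hg'
  one_mem' := by simp [hε]
  inv_mem' := by
    rintro g ⟨hg, hg'⟩
    exact ⟨hg', by simpa using hg⟩

lemma isOpen_congruenceSubgroup {ε : ℝ} (hε : 0 < ε) (hε1 : ε ≤ 1) :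
    IsOpen (congruenceSubgroup F n hε.le hε1 : Set (GL (Fin n) F)) := by
  refine Subgroup.isOpen_of_mem_nhds (g := 1) _ ?_
  have h1 : ∀ᶠ g : GL (Fin n) F in 𝓝 1, ∀ i j, ‖(g : Matrix (Fin n) (Fin n) F) i j -
      (1 : Matrix (Fin n) (Fin n) F) i j‖ < ε := by
    refine eventually_all.2 fun i => eventually_all.2 fun j => ?_
    have hc : Continuous fun g : GL (Fin n) F => ‖(g : Matrix (Fin n) (Fin n) F) i j -
      (1 : Matrix (Fin n) (Fin n) F) i j‖ :=
      ((Units.continuous_val.matrix_elem i j).sub continuous_const).norm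
    exact (hc.tendsto 1).eventually_lt_const (by simpa using hε)
  have h2 : ∀ᶠ g : GL (Fin n) F in 𝓝 1, ∀ i j,
      ‖((g⁻¹ : GL (Fin n) F) : Matrix (Fin n) (Fin n) F) i j -
      (1 : Matrix (Fin n) (Fin n) F) i j‖ < ε := by
    have := (continuous_inv.tendsto (1 : GL (Fin n) F))
    rw [inv_one] at this
    exact this.eventually h1
  filter_upwards [h1, h2] with g hg hg'
  exact ⟨fun i j => (hg i j).le, fun i j => (hg' i j).le⟩

omit [IsUltrametricDist F] in
lemma exists_ball_subset {V : Set (Matrix (Fin n) (Fin n) F)} (hV : V ∈ 𝓝 1) :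
    ∃ ε > 0, ∀ A : Matrix (Fin n) (Fin n) F,
      (∀ i j, ‖A i j - (1 : Matrix (Fin n) (Fin n) F) i j‖ ≤ ε) → A ∈ V := by
  set I : Fin n → Fin n → F := fun i j => (1 : Matrix (Fin n) (Fin n) F) i j with hI
  set V' : Set (Fin n → Fin n → F) := {f | (Matrix.of f : Matrix (Fin n) (Fin n) F) ∈ V} with hV''
  have hV' : V' ∈ 𝓝 I := hV
  obtain ⟨ε, hε, h⟩ := Metric.nhds_basis_closedBall.mem_iff.1 hV'
  refine ⟨ε, hε, fun A hA => ?_⟩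
  have : (fun i j => A i j) ∈ Metric.closedBall I ε := by
    rw [Metric.mem_closedBall, dist_pi_le_iff hε.le]
    intro i
    rw [dist_pi_le_iff hε.le]
    intro j
    rw [dist_eq_norm]
    exact hA i j
  exact h this

lemma exists_open_subgroup_GL {O : Set (GL (Fin n) F)} (hO : O ∈ 𝓝 1) :
    ∃ K : Subgroup (GL (Fin n) F), IsOpen (K : Set (GL (Fin n) F)) ∧ (K : Set _) ⊆ O := by
  rw [Units.isInducing_embedProduct.nhds_eq_comap, mem_comap] at hO
  obtain ⟨t, ht, htO⟩ := hO
  rw [map_one, show (1 : Matrix (Fin n) (Fin n) F × (Matrix (Fin n) (Fin n) F)ᵐᵒᵖ) = (1, 1) from rfl,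
    nhds_prod_eq, mem_prod_iff] at ht
  obtain ⟨t₁, ht₁, t₂, ht₂, ht⟩ := ht
  obtain ⟨ε₁, h₁, hε₁⟩ := exists_ball_subset ht₁
  have ht₂' : MulOpposite.op ⁻¹' t₂ ∈ 𝓝 (1 : Matrix (Fin n) (Fin n) F) :=
    MulOpposite.continuous_op.continuousAt.preimage_mem_nhds (by simpa using ht₂)
  obtain ⟨ε₂, h₂, hε₂⟩ := exists_ball_subset ht₂'
  have hpos : 0 < min (min ε₁ ε₂) 1 := by positivity
  refine ⟨congruenceSubgroup F n hpos.le (min_le_right _ _),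
    isOpen_congruenceSubgroup hpos (min_le_right _ _), ?_⟩
  rintro g ⟨hg, hg'⟩
  refine htO (ht ⟨hε₁ _ fun i j => (hg i j).trans ?_, hε₂ _ fun i j => (hg' i j).trans ?_⟩)
  · exact (min_le_left _ _).trans (min_le_left _ _)
  · exact (min_le_left _ _).trans (min_le_right _ _)

lemma exists_open_subgroup (Δ : Subgroup (GL (Fin n) F)) {O : Set Δ} (hO : O ∈ 𝓝 1) :
    ∃ K : Subgroup Δ, IsOpen (K : Set Δ) ∧ (K : Set Δ) ⊆ O := by
  rw [nhds_subtype_eq_comap, mem_comap] at hO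
  obtain ⟨t, ht, htO⟩ := hO
  obtain ⟨K, hK, hKt⟩ := exists_open_subgroup_GL ht
  exact ⟨K.subgroupOf Δ, hK.preimage continuous_subtype_val, fun x hx => htO (hKt hx)⟩

/-- From i · C(p^k, i) = p^k · C(p^k - 1, i - 1): the power of p in i is less than p^s, so at least
p^(k-s) divides the binomial coefficient. -/
lemma pow_sub_dvd_choose {p : ℕ} (hp : p.Prime) {k s i : ℕ} (hi : i ≠ 0) (his : i < p ^ s) :
    p ^ (k - s) ∣ (p ^ k).choose i := by
  obtain ⟨a, u, hu, rfl⟩ := Nat.exists_eq_pow_mul_and_not_dvd hi p hp.ne_one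
  have hupos : 0 < u := Nat.pos_of_ne_zero fun h => hu (h ▸ dvd_zero p)
  have has : a < s := (Nat.pow_lt_pow_iff_right hp.one_lt).1
    ((Nat.le_mul_of_pos_right _ hupos).trans_lt his)
  set i := p ^ a * u with hi'
  have h1 : p ^ k ∣ (p ^ k).choose i * i := by
    obtain ⟨m, hm⟩ : ∃ m, i = m + 1 := Nat.exists_eq_succ_of_ne_zero hi
    obtain ⟨N, hN⟩ : ∃ N, p ^ k = N + 1 := Nat.exists_eq_succ_of_ne_zero (pow_pos hp.pos k).ne'
    rw [hm, hN, ← Nat.add_one_mul_choose_eq]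
    exact dvd_mul_right _ _
  rcases le_or_gt k s with hks | hks
  · simp [Nat.sub_eq_zero_of_le hks]
  have h2 : p ^ a * p ^ (k - s) ∣ p ^ a * (u * (p ^ k).choose i) := by
    rw [← pow_add]
    refine (pow_dvd_pow p (by omega)).trans (h1.trans (dvd_of_eq ?_))
    rw [hi']; ring
  exact hp.prime.pow_dvd_of_dvd_mul_left _ hu (Nat.dvd_of_mul_dvd_mul_left (pow_pos hp.pos a) h2)

lemma tendsto_choose {p : ℕ} (hp : p.Prime) (hpF : ‖(p : F)‖ < 1) {i : ℕ} (hi : i ≠ 0) :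
    Tendsto (fun k => ((p ^ k).choose i : F)) atTop (𝓝 0) := by
  have his : i < p ^ i := Nat.lt_pow_self hp.one_lt
  have h : ∀ k, ‖((p ^ k).choose i : F)‖ ≤ ‖(p : F)‖ ^ (k - i) := by
    intro k
    obtain ⟨c, hc⟩ := pow_sub_dvd_choose hp (k := k) hi his
    rw [hc, Nat.cast_mul, norm_mul, Nat.cast_pow, norm_pow]
    exact mul_le_of_le_one_right (by positivity) (IsUltrametricDist.norm_natCast_le_one F c)
  refine squeeze_zero_norm h ?_
  exact (tendsto_pow_atTop_nhds_zero_of_lt_one (norm_nonneg _) hpF).comp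
    (tendsto_sub_atTop_nat i)

lemma tendsto_unipotent_pow_matrix {p : ℕ} (hp : p.Prime) (hpF : ‖(p : F)‖ < 1)
    {A : Matrix (Fin n) (Fin n) F} (hA : IsNilpotent (A - 1)) :
    Tendsto (fun k => A ^ p ^ k) atTop (𝓝 1) := by
  obtain ⟨N, hN⟩ := hA
  -- Nilpotency bounds the number of terms independently of m, so the limit can be taken term by
  -- term.
  have h1 : ∀ m, A ^ m = ∑ i ∈ Finset.range (N + 1), (m.choose i : F) • (A - 1) ^ i := by
    intro m
    have h2 : A ^ m = ∑ i ∈ Finset.range (m + 1), (m.choose i : F) • (A - 1) ^ i := by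
      conv_lhs => rw [show A = (A - 1) + 1 by abel]
      rw [(Commute.one_right (A - 1)).add_pow]
      refine Finset.sum_congr rfl fun i _ => ?_
      rw [one_pow, mul_one, ← Nat.cast_comm, ← nsmul_eq_mul, Nat.cast_smul_eq_nsmul]
    rw [h2]
    rcases le_total m N with h | h
    · refine Finset.sum_subset (Finset.range_subset_range.2 (by omega)) fun i _ hi => ?_
      rw [Finset.mem_range] at hi
      rw [Nat.choose_eq_zero_of_lt (by omega)]
      simp
    · symm
      refine Finset.sum_subset (Finset.range_subset_range.2 (by omega)) fun i _ hi => ?_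
      rw [Finset.mem_range] at hi
      rw [show i = N + (i - N) by omega, pow_add, hN]
      simp
  have h2 : ∑ i ∈ Finset.range (N + 1), (if i = 0 then (1 : F) else 0) • (A - 1) ^ i = 1 := by
    rw [Finset.sum_eq_single 0] <;> simp +contextual
  suffices h3 : Tendsto (fun k => ∑ i ∈ Finset.range (N + 1), ((p ^ k).choose i : F) • (A - 1) ^ i)
      atTop (𝓝 (∑ i ∈ Finset.range (N + 1), (if i = 0 then (1 : F) else 0) • (A - 1) ^ i)) by
    rw [h2] at h3
    exact h3.congr fun k => (h1 _).symm
  refine tendsto_finsetSum _ fun i _ => Tendsto.smul_const ?_ _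
  split_ifs with h
  · subst h; simp
  · exact tendsto_choose hp hpF h

/-- The topology of the unit group also controls inverses, so convergence is needed for g⁻¹ too,
which is again unipotent. -/
lemma tendsto_unipotent_pow {p : ℕ} (hp : p.Prime) (hpF : ‖(p : F)‖ < 1) {g : GL (Fin n) F}
    (hg : IsNilpotent ((g : Matrix (Fin n) (Fin n) F) - 1)) :
    Tendsto (fun k => g ^ p ^ k) atTop (𝓝 1) := by
  have hg' : IsNilpotent (((g⁻¹ : GL (Fin n) F) : Matrix (Fin n) (Fin n) F) - 1) := by
    have h : ((g⁻¹ : GL (Fin n) F) : Matrix (Fin n) (Fin n) F) - 1 =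
        -((g⁻¹ : GL (Fin n) F) : Matrix (Fin n) (Fin n) F) *
          ((g : Matrix (Fin n) (Fin n) F) - 1) := by
      rw [mul_sub, neg_mul, Units.inv_mul]; noncomm_ring
    rw [h]
    refine Commute.isNilpotent_mul_left ?_ hg
    refine Commute.neg_left (Commute.sub_right ?_ (Commute.one_right _))
    exact (Units.commute_coe_inv g).symm
  rw [Units.isInducing_embedProduct.tendsto_nhds_iff, map_one,
    show (1 : Matrix (Fin n) (Fin n) F × (Matrix (Fin n) (Fin n) F)ᵐᵒᵖ) = (1, 1) from rfl,
    nhds_prod_eq]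
  refine Tendsto.prodMk ?_ ?_
  · simpa using tendsto_unipotent_pow_matrix hp hpF hg
  · have := (MulOpposite.continuous_op.tendsto _).comp
      (tendsto_unipotent_pow_matrix hp hpF hg')
    simpa [Function.comp_def] using this

end GeneralLinear

end LinAlgGroup
end

/-! ### Root data: unique triangular factorisations and the exchange of opposite root groups. -/

noncomputable section

namespace BruhatTits

section RankOne

variable {ι V W : Type*} [AddCommGroup V] [Module ℝ V] [AddCommGroup W] [Module ℝ W]
variable {P : RootPairing ι ℝ V W} {Γ : Type*} [Group Γ]

lemma root_negIdx (a : ι) : P.root (negIdx P a) = -P.root a := by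
  simp [negIdx, P.root_reflectionPerm]

lemma negIdx_negIdx (a : ι) : negIdx P (negIdx P a) = a := by
  apply P.root.injective
  rw [root_negIdx, root_negIdx, neg_neg]

lemma reflectionPerm_negIdx_self (a : ι) : P.reflectionPerm a (negIdx P a) = a := by
  simp [negIdx]

-- Each root is a nonzero functional, as its coroot shows, so finitely many of them are nonzero at a
-- common point; a change of sign makes α positive.
variable (P) in
lemma exists_regular [Finite ι] (α : ι) : ∃ f : W,
    (∀ a, P.toLinearMap (P.root a) f ≠ 0) ∧ 0 < P.toLinearMap (P.root α) f := by
  obtain ⟨f, hf⟩ := Module.Dual.exists_forall_ne_zero_of_forall_exists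
    (fun a => P.toLinearMap (P.root a)) fun a => ⟨P.coroot a, by
      rw [P.root_coroot_two]; norm_num⟩
  rcases lt_or_gt_of_ne (hf α) with h | h
  · exact ⟨-f, fun a => by simpa using hf a, by simpa using h⟩
  · exact ⟨f, hf, h⟩

namespace GroupRootDatum

variable (D : GroupRootDatum P Γ)

lemma exists_mem_M (a : ι) : ∃ m, m ∈ D.M a ∧ ∀ t ∈ D.T, t * m ∈ D.M a := by
  obtain ⟨m, hm⟩ := D.M_coset a
  refine ⟨m, ?_, fun t ht => ?_⟩
  · rw [hm]; exact ⟨1, one_mem _, by simp⟩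
  · rw [hm]; exact ⟨t, ht, rfl⟩

/-- Both m and t m lie in M_b, so both carry U_{-b} onto U_b; hence t normalises U_b. -/
lemma conj_mem_of_mem_T {t x : Γ} {b : ι} (ht : t ∈ D.T) (hx : x ∈ D.U b) :
    t * x * t⁻¹ ∈ D.U b := by
  obtain ⟨m, hm, hm'⟩ := D.exists_mem_M b
  have h1 := D.conj_U b (negIdx P b) m hm
  have h2 := D.conj_U b (negIdx P b) (t * m) (hm' t ht)
  rw [reflectionPerm_negIdx_self] at h1 h2
  rw [← h1] at hx
  obtain ⟨u, hu, rfl⟩ := hx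
  rw [← h2]
  exact ⟨u, hu, by simp [mul_assoc]⟩

/-- The group generated by the root groups for the roots that are positive with respect to `f`. -/
def pos (f : W) : Subgroup Γ := ⨆ (a : ι) (_ : 0 < P.toLinearMap (P.root a) f), D.U a

/-- The group generated by the root groups for the roots that are negative with respect to `f`. -/
def neg (f : W) : Subgroup Γ := ⨆ (a : ι) (_ : P.toLinearMap (P.root a) f < 0), D.U a

variable {D}

lemma U_le_pos {f : W} {a : ι} (h : 0 < P.toLinearMap (P.root a) f) : D.U a ≤ D.pos f :=
  le_iSup₂_of_le a h le_rfl

lemma U_le_neg {f : W} {a : ι} (h : P.toLinearMap (P.root a) f < 0) : D.U a ≤ D.neg f :=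
  le_iSup₂_of_le a h le_rfl

lemma conj_mem_pos {f : W} {t x : Γ} (ht : t ∈ D.T) (hx : x ∈ D.pos f) :
    t * x * t⁻¹ ∈ D.pos f := by
  have : D.pos f ≤ (D.pos f).comap (MulAut.conj t).toMonoidHom :=
    iSup₂_le fun a ha z hz => U_le_pos ha (D.conj_mem_of_mem_T ht hz)
  exact this hx

lemma eq_one_of_mem_T_of_mem_pos {f : W} (hf : ∀ a, P.toLinearMap (P.root a) f ≠ 0) {t : Γ}
    (ht : t ∈ D.T) (h : t ∈ D.pos f) : t = 1 := by
  have := D.triangular (-f) (fun a => by simpa using hf a) t ht 1 (one_mem _) (by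
    simpa [pos] using h)
  simpa using this

/-- Uniqueness of factorisations in `U⁻ T U⁺`. -/
theorem triangular_unique {f : W} (hf : ∀ a, P.toLinearMap (P.root a) f ≠ 0) {v v' t t' w w' : Γ}
    (hv : v ∈ D.neg f) (hv' : v' ∈ D.neg f) (ht : t ∈ D.T) (ht' : t' ∈ D.T) (hw : w ∈ D.pos f)
    (hw' : w' ∈ D.pos f) (h : v * t * w = v' * t' * w') : v = v' ∧ t = t' ∧ w = w' := by
  have h1 : v'⁻¹ * v = t' * t⁻¹ * (t * (w' * w⁻¹) * t⁻¹) := by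
    have : v = v' * t' * w' * w⁻¹ * t⁻¹ := by rw [← h]; group
    rw [this]; group
  have h2 := conj_mem_pos ht (mul_mem hw' (inv_mem hw))
  have h3 := D.triangular f hf _ (mul_mem ht' (inv_mem ht)) _ h2
    (h1 ▸ mul_mem (inv_mem hv') hv)
  have hvv : v = v' := by
    rw [h3] at h1
    exact (inv_mul_eq_one.1 h1).symm
  subst hvv
  have h4 : t * w = t' * w' := by simpa [mul_assoc] using h
  have h5 : t'⁻¹ * t = w' * w⁻¹ := by
    have : t = t' * w' * w⁻¹ := by rw [← h4]; group
    rw [this]; group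
  have h6 := eq_one_of_mem_T_of_mem_pos hf (mul_mem (inv_mem ht') ht)
    (h5 ▸ mul_mem hw' (inv_mem hw))
  have htt : t = t' := (inv_mul_eq_one.1 h6).symm
  subst htt
  exact ⟨rfl, rfl, by simpa using h4⟩

variable (D) in
lemma eq_one_of_mem_of_mem_neg [Finite ι] {a : ι} {x : Γ} (hx : x ∈ D.U a)
    (hx' : x ∈ D.U (negIdx P a)) : x = 1 := by
  obtain ⟨f, hf, ha⟩ := exists_regular P a
  have := D.triangular f hf 1 (one_mem _) x (U_le_pos ha hx)
    (by rw [one_mul]; exact U_le_neg (by simpa [root_negIdx] using ha) hx')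
  simpa using this

variable (D) in
lemma not_le_neg [Finite ι] (a : ι) : ¬ D.U a ≤ D.U (negIdx P a) := fun h =>
  D.U_ne_bot a ((Subgroup.eq_bot_iff_forall _).2 fun _ hx => D.eq_one_of_mem_of_mem_neg hx (h hx))

variable (D) in
lemma not_neg_le [Finite ι] (a : ι) : ¬ D.U (negIdx P a) ≤ D.U a := by
  simpa [negIdx_negIdx] using D.not_le_neg (negIdx P a)

variable (D) in
/-- Conjugation by `m` exchanges the root groups of `a` and `-a`. -/
structure IsFlip (a : ι) (m : Γ) : Prop where
  map : ∀ x ∈ D.U a, m * x * m⁻¹ ∈ D.U (negIdx P a)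
  map_neg : ∀ x ∈ D.U (negIdx P a), m * x * m⁻¹ ∈ D.U a
  inv_map : ∀ x ∈ D.U a, m⁻¹ * x * m ∈ D.U (negIdx P a)
  inv_map_neg : ∀ x ∈ D.U (negIdx P a), m⁻¹ * x * m ∈ D.U a

lemma IsFlip.of_mem_M {a : ι} {m : Γ} (hm : m ∈ D.M a) : D.IsFlip a m := by
  have h1 : (D.U a).map (MulAut.conj m).toMonoidHom = D.U (negIdx P a) := D.conj_U a a m hm
  have h2 := D.conj_U a (negIdx P a) m hm
  rw [reflectionPerm_negIdx_self] at h2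
  constructor
  · intro x hx; rw [← h1]; exact ⟨x, hx, rfl⟩
  · intro x hx; rw [← h2]; exact ⟨x, hx, rfl⟩
  · intro x hx
    rw [← h2] at hx
    obtain ⟨y, hy, rfl⟩ := hx
    simpa [mul_assoc] using hy
  · intro x hx
    rw [← h1] at hx
    obtain ⟨y, hy, rfl⟩ := hx
    simpa [mul_assoc] using hy

lemma IsFlip.inv {a : ι} {m : Γ} (h : D.IsFlip a m) : D.IsFlip a m⁻¹ :=
  ⟨by simpa using h.inv_map, by simpa using h.inv_map_neg, by simpa using h.map,
    by simpa using h.map_neg⟩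

lemma IsFlip.neg {a : ι} {m : Γ} (h : D.IsFlip a m) : D.IsFlip (negIdx P a) m :=
  ⟨by simpa [negIdx_negIdx] using h.map_neg, by simpa [negIdx_negIdx] using h.map,
    by simpa [negIdx_negIdx] using h.inv_map_neg, by simpa [negIdx_negIdx] using h.inv_map⟩

variable [Finite ι]

/-- If x ≠ 1, write x = v m v' with v, v' ∈ U_a. Then m would normalise U_a as well, but it
exchanges U_a and U_{-a}, giving U_{-a} ≤ U_a. -/
lemma eq_one_of_normalises {a : ι} {x : Γ} (hx : x ∈ D.U (negIdx P a))
    (h : ∀ y ∈ D.U a, x * y * x⁻¹ ∈ D.U a) : x = 1 := by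
  by_contra hne
  obtain ⟨v, hv, m, hm, v', hv', rfl⟩ := D.subset_UMU a x hx hne
  have hfl := IsFlip.of_mem_M hm
  refine D.not_neg_le a fun y hy => ?_
  have h1 := h (v'⁻¹ * (m⁻¹ * y * m) * v')
    (mul_mem (mul_mem (inv_mem hv') (hfl.inv_map_neg y hy)) hv')
  have h2 := mul_mem (mul_mem (inv_mem hv) h1) hv
  simpa [mul_assoc] using h2

lemma eq_one_of_mul_normalises {a : ι} {x z : Γ} (hx : x ∈ D.U (negIdx P a)) (hz : z ∈ D.U a)
    (h : ∀ y ∈ D.U a, (x * z) * y * (x * z)⁻¹ ∈ D.U a)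
    (h' : ∀ y ∈ D.U (negIdx P a), (x * z) * y * (x * z)⁻¹ ∈ D.U (negIdx P a)) :
    x = 1 ∧ z = 1 := by
  constructor
  · refine eq_one_of_normalises hx fun y hy => ?_
    have := h (z⁻¹ * y * z) (mul_mem (mul_mem (inv_mem hz) hy) hz)
    simpa [mul_assoc] using this
  · refine eq_one_of_normalises (D := D) (a := negIdx P a) (by rwa [negIdx_negIdx]) fun y hy => ?_
    have := mul_mem (mul_mem (inv_mem hx) (h' y hy)) hx
    simpa [mul_assoc] using this

/-- The quotient m' m⁻¹ normalises both root groups and is a product of an element of U_{-a} and one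
of U_a; such a product is trivial. -/
lemma IsFlip.unique_neg {a : ι} {m m' x x' : Γ} (hm : D.IsFlip a m) (hm' : D.IsFlip a m')
    (hx : x ∈ D.U (negIdx P a)) (hx' : x' ∈ D.U (negIdx P a)) (h : m' = x * m * x') :
    m' = m := by
  have h1 : m' * m⁻¹ = x * (m * x' * m⁻¹) := by rw [h]; group
  have h2 := eq_one_of_mul_normalises hx (hm.map_neg x' hx')
    (fun y hy => by
      rw [← h1]
      have := hm'.map_neg _ (hm.inv_map y hy)
      simpa [mul_assoc] using this)
    (fun y hy => by
      rw [← h1]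
      have := hm'.map _ (hm.inv_map_neg y hy)
      simpa [mul_assoc] using this)
  rw [h2.1, h2.2, mul_one] at h1
  exact mul_inv_eq_one.1 h1

/-- The axiom applied to v' yields some m₁ ∈ M_{-b}. Solving for it shows m₁ ∈ U_{-b} m⁻¹ U_{-b},
and a double coset of this kind contains only one flip. -/
lemma IsFlip.inv_mem_M {b : ι} {u v m v' : Γ} (hm : D.IsFlip b m) (hu : u ∈ D.U (negIdx P b))
    (hv : v ∈ D.U b) (hv' : v' ∈ D.U b) (h : u = v * m * v') : m⁻¹ ∈ D.M (negIdx P b) := by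
  have hne : v' ≠ 1 := by
    rintro rfl
    refine D.not_neg_le b fun y hy => ?_
    have h1 := hm.map_neg _ (mul_mem (mul_mem (inv_mem hu) hy) hu)
    have h2 := mul_mem (mul_mem hv h1) (inv_mem hv)
    rw [h] at h2
    simpa [mul_assoc] using h2
  obtain ⟨w, hw, m₁, hm₁, w', hw', h1⟩ := D.subset_UMU (negIdx P b) v'
    (by rwa [negIdx_negIdx]) hne
  have h2 : m₁ = (w⁻¹ * (m⁻¹ * v⁻¹ * m)) * m⁻¹ * (u * w'⁻¹) := by
    have : m₁ = w⁻¹ * v' * w'⁻¹ := by rw [h1]; group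
    rw [this, h]; group
  have hf : D.IsFlip b m₁ := by simpa [negIdx_negIdx] using (IsFlip.of_mem_M hm₁).neg
  have := IsFlip.unique_neg hm.inv hf (mul_mem (inv_mem hw) (hm.inv_map _ (inv_mem hv)))
    (mul_mem hu (inv_mem hw')) h2
  rwa [← this]

/-- The axiom puts m only into M_{-α}. Passing to inverses twice, for u and for u⁻¹, also puts m and
m⁻¹ into M_α, so that the valuation axiom can be used on either side. -/
lemma exists_decomposition {α : ι} {u : Γ} (hu : u ∈ D.U α) (hu1 : u ≠ 1) :
    ∃ v ∈ D.U (negIdx P α), ∃ m, ∃ v' ∈ D.U (negIdx P α), u = v * m * v' ∧ m ∈ D.M α ∧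
      m⁻¹ ∈ D.M α ∧ m ∈ D.M (negIdx P α) := by
  have hu' : u ∈ D.U (negIdx P (negIdx P α)) := by rwa [negIdx_negIdx]
  obtain ⟨v, hv, m, hm, v', hv', h⟩ := D.subset_UMU (negIdx P α) u hu' hu1
  have hfl := IsFlip.of_mem_M hm
  refine ⟨v, hv, m, v', hv', h, ?_, ?_, hm⟩
  · have := hfl.inv.inv_mem_M (u := u⁻¹) (inv_mem hu') (inv_mem hv') (inv_mem hv)
      (by rw [h]; group)
    simpa [negIdx_negIdx] using this
  · simpa [negIdx_negIdx] using hfl.inv_mem_M hu' hv hv' h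

end GroupRootDatum

lemma withTop_eq_neg {x : WithTop ℝ} {r : ℝ} (h : x + (r : WithTop ℝ) = 0) :
    x = ((-r : ℝ) : WithTop ℝ) := by
  cases x with
  | top => simp at h
  | coe x =>
    have : x + r = 0 := by exact_mod_cast h
    exact_mod_cast eq_neg_of_add_eq_zero_left this

open GroupRootDatum in
/-- An element of `U_α` of valuation exactly `r` gives rise to an element that exchanges `U_{α,r}`
and `U_{-α,-r}`. -/
theorem RootDatumValuation.exists_swap [Finite ι] {D : GroupRootDatum P Γ}
    (φ : RootDatumValuation D) {α : ι} {u : Γ} (hu : u ∈ D.U α) {r : ℝ}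
    (hr : φ.val α u = (r : WithTop ℝ)) :
    ∃ v ∈ φ.filt (negIdx P α) (-r), ∃ m, ∃ v' ∈ φ.filt (negIdx P α) (-r), u = v * m * v' ∧
      (∀ x ∈ φ.filt (negIdx P α) (-r), m * x * m⁻¹ ∈ φ.filt α r) ∧
      ∀ x ∈ φ.filt α r, m⁻¹ * x * m ∈ φ.filt (negIdx P α) (-r) := by
  have hu1 : u ≠ 1 := by
    intro h
    rw [((φ.isGroupValuation α).eq_top_iff u hu).2 h] at hr
    exact WithTop.top_ne_coe hr
  obtain ⟨v, hv, m, v', hv', h, hm, hm', hm''⟩ := exists_decomposition hu hu1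
  have hvv : φ.val (negIdx P α) v = ((-r : ℝ) : WithTop ℝ) := by
    have := φ.val_add_val α u hu v⁻¹ (inv_mem hv) v'⁻¹ (inv_mem hv')
      (by rwa [show v⁻¹ * u * v'⁻¹ = m by rw [h]; group])
    rw [(φ.isGroupValuation _).inv v hv, hr] at this
    exact withTop_eq_neg this
  have hvv' : φ.val (negIdx P α) v' = ((-r : ℝ) : WithTop ℝ) := by
    have := φ.val_add_val α u⁻¹ (inv_mem hu) v' hv' v hv
      (by rwa [show v' * u⁻¹ * v = m⁻¹ by rw [h]; group])
    rw [(φ.isGroupValuation _).inv u hu, hr] at this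
    exact withTop_eq_neg this
  have hfl := IsFlip.of_mem_M hm
  have hz := hfl.map_neg v' hv'
  -- With z = m v' m⁻¹, the relation z⁻¹ v⁻¹ u = m ∈ M_{-α} ties the valuation of z to that of v.
  have hzv : φ.val α (m * v' * m⁻¹) = (r : WithTop ℝ) := by
    have := φ.val_add_val (negIdx P α) v⁻¹ (inv_mem hv) (m * v' * m⁻¹)⁻¹
      (by rw [negIdx_negIdx]; exact inv_mem hz) u (by rwa [negIdx_negIdx])
      (by rwa [show (m * v' * m⁻¹)⁻¹ * v⁻¹ * u = m by rw [h]; group])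
    rw [negIdx_negIdx, (φ.isGroupValuation _).inv _ hz, (φ.isGroupValuation _).inv v hv,
      hvv] at this
    simpa using withTop_eq_neg this
  obtain ⟨c, hc⟩ := φ.conj_M α m hm
  -- Conjugation by m shifts valuations by a constant, which is read off from v'.
  have hc' : c = -2 * r := by
    have hv1 : v' ≠ 1 := by
      intro h1
      rw [((φ.isGroupValuation _).eq_top_iff v' hv').2 h1] at hvv'
      exact WithTop.top_ne_coe hvv'
    have := hc v' hv' hv1
    rw [hvv', hzv] at this
    have h2 : -r = r + c := by exact_mod_cast this
    linarith
  have key : ∀ x ∈ D.U (negIdx P α), ((-r : ℝ) : WithTop ℝ) ≤ φ.val (negIdx P α) x ↔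
      (r : WithTop ℝ) ≤ φ.val α (m * x * m⁻¹) := by
    intro x hx
    by_cases hx1 : x = 1
    · subst hx1
      rw [((φ.isGroupValuation _).eq_top_iff 1 (one_mem _)).2 rfl]
      simp [((φ.isGroupValuation _).eq_top_iff 1 (one_mem _)).2 rfl]
    · rw [hc x hx hx1]
      cases φ.val α (m * x * m⁻¹) with
      | top => simp
      | coe s =>
        rw [hc', ← WithTop.coe_add, WithTop.coe_le_coe, WithTop.coe_le_coe]
        constructor <;> intro h <;> linarith
  refine ⟨v, ⟨hv, hvv.ge⟩, m, v', ⟨hv', hvv'.ge⟩, h, ?_, ?_⟩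
  · intro x hx
    exact ⟨hfl.map_neg x hx.1, (key x hx.1).1 hx.2⟩
  · intro x hx
    have h1 := hfl.inv_map x hx.1
    refine ⟨h1, (key _ h1).2 ?_⟩
    rw [show m * (m⁻¹ * x * m) * m⁻¹ = x by group]
    exact hx.2

end RankOne

end BruhatTits
end

/-! ### Layers at a point of the apartment and the factorisation of U_y^{(e)}. -/

noncomputable section

namespace BruhatTits

open Filter Topology FilteredProduct

section Layers

variable {ι V W : Type*} [AddCommGroup V] [Module ℝ V] [AddCommGroup W] [Module ℝ W]
variable {P : RootPairing ι ℝ V W} {Γ : Type*} [Group Γ]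
variable {D : GroupRootDatum P Γ} {φ : RootDatumValuation D}

/-- Topological properties of a valuation of a root datum and a prolongation. -/
structure IsCompactOpen [TopologicalSpace Γ] (E : Prolongation φ) : Prop where
  basis : ∀ O ∈ 𝓝 (1 : Γ), ∃ K : Subgroup Γ, IsOpen (K : Set Γ) ∧ (K : Set Γ) ⊆ O
  compact_filt : ∀ a k, IsCompact (φ.filt a k : Set Γ)
  isOpen_filt : ∀ a k, ∃ O : Set Γ, IsOpen O ∧ O ∩ (D.U a : Set Γ) = φ.filt a k
  compact_H : ∀ r, 0 ≤ r → IsCompact (E.H r : Set Γ)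
  isOpen_H : ∀ r, 0 ≤ r → ∃ O : Set Γ, IsOpen O ∧ O ∩ (D.T : Set Γ) = E.H r

namespace Prolongation

variable (E : Prolongation φ)

lemma extFilt_anti {c : Option ι} {k l : ℝ} (h0 : c = none → 0 ≤ k) (h : k ≤ l) :
    extFilt φ E.H c l ≤ extFilt φ E.H c k := by
  cases c with
  | none => exact E.anti k l (h0 rfl) h
  | some a => exact filt_anti h

lemma mem_Hplus_iff {r : ℝ} (hr : 0 ≤ r) {x : Γ} : x ∈ E.Hplus r ↔ ∃ s, r < s ∧ x ∈ E.H s := by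
  constructor
  · intro hx
    have hdir : Directed (· ≤ ·) fun s : Set.Ioi r => E.H s := by
      intro s t
      have hs := Set.mem_Ioi.1 s.2
      have ht := Set.mem_Ioi.1 t.2
      refine ⟨⟨min s t, lt_min hs ht⟩, E.anti _ _ ?_ (min_le_left _ _),
        E.anti _ _ ?_ (min_le_right _ _)⟩ <;> exact hr.trans (lt_min hs ht).le
    have : Nonempty (Set.Ioi r) := ⟨⟨r + 1, by simp⟩⟩
    obtain ⟨s, hs⟩ := (Subgroup.mem_iSup_of_directed hdir).1 hx
    exact ⟨s, s.2, hs⟩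
  · rintro ⟨s, hs, hx⟩
    exact E.H_le_Hplus hs hx

open scoped Classical in
/-- The groups `U_{c,l}` for `c` in a set `Ψ`, with `l = (n + 1) d - c(y)` or
`l = max(n + 1, ε(c)) d - c(y)`. -/
def pointLayer (y : W) (d : ℝ) (Ψ : Option ι → Prop) (ε : Option ι → ℕ) (c : Option ι) (n : ℕ) :
    Subgroup Γ :=
  if Ψ c then extFilt φ E.H c ((max (n + 1) (ε c) : ℕ) * d - P.toLinearMap (extRoot P c) y) else ⊥

variable {E} {y : W} {d : ℝ} {Ψ : Option ι → Prop} {ε : Option ι → ℕ}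

lemma pointLayer_of {c : Option ι} (h : Ψ c) (n : ℕ) : E.pointLayer y d Ψ ε c n =
    extFilt φ E.H c ((max (n + 1) (ε c) : ℕ) * d - P.toLinearMap (extRoot P c) y) := if_pos h

lemma pointLayer_of_not {c : Option ι} (h : ¬ Ψ c) (n : ℕ) : E.pointLayer y d Ψ ε c n = ⊥ :=
  if_neg h

/-- Closedness under positive integral combinations in `Φ ∪ {0}`. -/
def IsClosedSet (P : RootPairing ι ℝ V W) (Ψ : Option ι → Prop) : Prop :=
  ∀ (a b c : Option ι) (i j : ℕ), Ψ a → Ψ b → 0 < i → 0 < j →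
    extRoot P c = i • extRoot P a + j • extRoot P b → Ψ c

lemma level_nonneg (hd : 0 < d) (n : ℕ) (c : Option ι) :
    c = none → 0 ≤ (n : ℝ) * d - P.toLinearMap (extRoot P c) y := by
  rintro rfl
  simp only [extRoot, map_zero, LinearMap.zero_apply, sub_zero]
  positivity

lemma pointLayer_anti (hd : 0 < d) (c : Option ι) (n : ℕ) :
    E.pointLayer y d Ψ ε c (n + 1) ≤ E.pointLayer y d Ψ ε c n := by
  by_cases h : Ψ c
  · rw [pointLayer_of h, pointLayer_of h]
    refine E.extFilt_anti (level_nonneg hd _ c) (sub_le_sub_right ?_ _)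
    refine mul_le_mul_of_nonneg_right ?_ hd.le
    exact_mod_cast max_le_max_right _ (Nat.le_succ _)
  · rw [pointLayer_of_not h]; exact bot_le

/-- The depths combine to iA + jB ≥ n + 2, with A ≥ 1 and B ≥ n + 1. So every commutator is one
layer deeper, and the minimal levels ε ≤ 2 never interfere. For opposite roots the index in H is
positive, as the prolongation requires. -/
lemma pointLayer_comm (hd : 0 < d) (hΨ : IsClosedSet P Ψ) (hε : ∀ c, ε c ≤ 2) (n : ℕ)
    (a b : Option ι) : ⁅E.pointLayer y d Ψ ε a 0, E.pointLayer y d Ψ ε b n⁆ ≤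
      layer (E.pointLayer y d Ψ ε) (n + 1) := by
  by_cases ha : Ψ a
  swap
  · rw [pointLayer_of_not ha, Subgroup.commutator_bot_left]; exact bot_le
  by_cases hb : Ψ b
  swap
  · rw [pointLayer_of_not hb, Subgroup.commutator_bot_right]; exact bot_le
  rw [pointLayer_of ha, pointLayer_of hb]
  set A : ℕ := max (0 + 1) (ε a) with hA
  set B : ℕ := max (n + 1) (ε b) with hB
  have hA1 : 1 ≤ A := by omega
  have hB1 : n + 1 ≤ B := by omega
  have key : ∀ i j : ℕ, (i : ℝ) * (A * d - P.toLinearMap (extRoot P a) y) +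
      j * (B * d - P.toLinearMap (extRoot P b) y) =
      ((i * A + j * B : ℕ) : ℝ) * d -
        P.toLinearMap (i • extRoot P a + j • extRoot P b) y := by
    intro i j
    simp only [map_add, map_nsmul, LinearMap.add_apply, LinearMap.smul_apply, nsmul_eq_mul]
    push_cast
    ring
  have hAd : 0 < (A : ℝ) * d := mul_pos (by exact_mod_cast hA1) hd
  have hBd : 0 < (B : ℝ) * d := mul_pos (by exact_mod_cast (by omega : 0 < B)) hd
  refine (E.commutator_le a b _ _ ?_ ?_ ?_).trans ?_
  · rintro rfl; simpa [extRoot] using hAd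
  · rintro rfl; simpa [extRoot] using hBd
  · intro i j hi hj h0
    rw [key, h0]
    simp only [map_zero, LinearMap.zero_apply, sub_zero]
    refine mul_pos ?_ hd
    have : 0 < i * A + j * B := by positivity
    exact_mod_cast this
  · refine iSup_le fun c => iSup_le fun i => iSup_le fun j => iSup_le fun ⟨hi, hj, hc⟩ => ?_
    have hcΨ : Ψ c := hΨ a b c i j ha hb hi hj hc
    refine le_trans ?_ (le_layer c (n + 1))
    rw [pointLayer_of hcΨ, key, ← hc]
    refine E.extFilt_anti (level_nonneg hd _ c) (sub_le_sub_right ?_ _)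
    refine mul_le_mul_of_nonneg_right ?_ hd.le
    have h1 : A ≤ i * A := Nat.le_mul_of_pos_left _ hi
    have h2 : B ≤ j * B := Nat.le_mul_of_pos_left _ hj
    have h3 := hε c
    have : max (n + 1 + 1) (ε c) ≤ i * A + j * B := by omega
    exact_mod_cast this

/-- U_y^{(e)} is the directed union of the groups of depth at least d > e. A fixed element therefore
needs only one d, and the factorisation at discrete depths applies. -/
lemma exists_mem_layer_of_mem_pointGroup {e : ℝ≥0} {g : Γ} (hg : g ∈ E.pointGroup y e) :
    ∃ d : ℝ, e < d ∧ g ∈ layer (E.pointLayer y d (fun _ => True) fun _ => 0) 0 := by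
  have hA : ∀ (d : ℝ) c, E.pointLayer y d (fun _ => True) (fun _ => 0) c 0 =
      extFilt φ E.H c (d - P.toLinearMap (extRoot P c) y) := by
    intro d c
    rw [pointLayer_of trivial]
    simp
  have hmono : ∀ d d' : ℝ, 0 ≤ d → d ≤ d' →
      layer (E.pointLayer y d' (fun _ => True) fun _ => 0) 0 ≤
        layer (E.pointLayer y d (fun _ => True) fun _ => 0) 0 := by
    intro d d' h0 h
    refine iSup_mono fun c => ?_
    rw [hA, hA]
    refine E.extFilt_anti ?_ (by linarith)
    rintro rfl
    simpa [extRoot] using h0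
  have he : (0 : ℝ) ≤ e := e.2
  have hdir : Directed (· ≤ ·) fun d : Set.Ioi (e : ℝ) =>
      layer (E.pointLayer y d (fun _ => True) fun _ => 0) 0 := by
    intro s t
    have hs := Set.mem_Ioi.1 s.2
    have ht := Set.mem_Ioi.1 t.2
    refine ⟨⟨min s t, lt_min hs ht⟩, hmono _ _ ?_ (min_le_left _ _),
      hmono _ _ ?_ (min_le_right _ _)⟩ <;> exact he.trans (lt_min hs ht).le
  have : Nonempty (Set.Ioi (e : ℝ)) := ⟨⟨e + 1, by simp⟩⟩
  have hle : E.pointGroup y e ≤ ⨆ d : Set.Ioi (e : ℝ),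
      layer (E.pointLayer y d (fun _ => True) fun _ => 0) 0 := by
    refine E.pointGroup_le fun c l hl => ?_
    have hl' : (e : ℝ) < l + P.toLinearMap (extRoot P c) y := by linarith
    refine le_trans ?_ (le_iSup _ ⟨l + P.toLinearMap (extRoot P c) y, hl'⟩)
    refine le_trans ?_ (le_layer c 0)
    rw [hA]
    simp
  obtain ⟨s, hs⟩ := (Subgroup.mem_iSup_of_directed hdir).1 (hle hg)
  exact ⟨s, s.2, hs⟩

variable [TopologicalSpace Γ]

lemma _root_.BruhatTits.IsCompactOpen.compact_extFilt (hE : IsCompactOpen E) {c : Option ι} {k : ℝ}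
    (h : c = none → 0 ≤ k) : IsCompact (extFilt φ E.H c k : Set Γ) := by
  cases c with
  | none => exact hE.compact_H k (h rfl)
  | some a => exact hE.compact_filt a k

/-- The groups U_{a,s} are compact with trivial intersection, so one of them lies in the given
neighbourhood of 1. -/
lemma _root_.BruhatTits.IsCompactOpen.exists_filt_le [T2Space Γ] (hE : IsCompactOpen E) (a : ι)
    {K : Subgroup Γ} (hK : IsOpen (K : Set Γ)) : ∃ s : ℝ, φ.filt a s ≤ K := by
  have hdir : Directed (· ⊇ ·) fun s : ℝ => (φ.filt a s : Set Γ) := fun s t =>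
    ⟨max s t, filt_anti (le_max_left s t), filt_anti (le_max_right s t)⟩
  refine exists_subset_nhds_of_isCompact hdir (fun s => hE.compact_filt a s) fun x hx => ?_
  have hx' := Set.mem_iInter.1 hx
  have hx1 : x = 1 := by
    refine ((φ.isGroupValuation a).eq_top_iff x (hx' 0).1).1 ?_
    cases hv : φ.val a x with
    | top => rfl
    | coe v =>
      have := (hx' (v + 1)).2
      rw [hv, WithTop.coe_le_coe] at this
      linarith
  rw [hx1]
  exact hK.mem_nhds (one_mem K)

lemma pointLayer_small [T2Space Γ] [Finite ι] (hE : IsCompactOpen E) (hd : 0 < d)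
    {K : Subgroup Γ} (hK : IsOpen (K : Set Γ)) :
    ∃ n, ∀ a, E.pointLayer y d Ψ ε (some a) n ≤ K := by
  have h1 : ∀ a, ∀ᶠ n : ℕ in atTop, E.pointLayer y d Ψ ε (some a) n ≤ K := by
    intro a
    obtain ⟨s, hs⟩ := hE.exists_filt_le a hK
    obtain ⟨N, hN⟩ := exists_nat_gt ((s + P.toLinearMap (P.root a) y) / d)
    filter_upwards [eventually_ge_atTop N] with n hn
    by_cases h : Ψ (some a)
    · rw [pointLayer_of h]
      refine le_trans (filt_anti ?_) hs
      rw [div_lt_iff₀ hd] at hN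
      have : (N : ℝ) * d ≤ ((max (n + 1) (ε (some a)) : ℕ) : ℝ) * d :=
        mul_le_mul_of_nonneg_right (by exact_mod_cast (by omega)) hd.le
      simp only [extRoot]
      linarith
    · rw [pointLayer_of_not h]; exact bot_le
  exact (eventually_all.2 h1).exists

theorem exists_layer_factorization [P.IsCrystallographic] [IsTopologicalGroup Γ] [T2Space Γ] [Finite ι]
    (hE : IsCompactOpen E) (hd : 0 < d)
    (hΨ : IsClosedSet P Ψ) (hε : ∀ c, ε c ≤ 2) (neg : ι → Prop) (k : ℕ) {g : Γ}
    (hg : g ∈ layer (E.pointLayer y d Ψ ε) k) :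
    ∃ v ∈ ⨆ (a : ι) (_ : neg a), E.pointLayer y d Ψ ε (some a) k,
    ∃ w ∈ ⨆ (a : ι) (_ : ¬ neg a), E.pointLayer y d Ψ ε (some a) k,
    ∃ h ∈ E.pointLayer y d Ψ ε none k, g = v * w * h := by
  have hanti := pointLayer_anti (E := E) (y := y) (Ψ := Ψ) (ε := ε) hd
  have hcpt : ∀ c n, IsCompact (E.pointLayer y d Ψ ε c n : Set Γ) := by
    intro c n
    by_cases h : Ψ c
    · rw [pointLayer_of h]
      exact hE.compact_extFilt (level_nonneg hd _ c)
    · rw [pointLayer_of_not h]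
      simp
  have hle : ∀ c n m, E.pointLayer y d Ψ ε c (n + m) ≤ E.pointLayer y d Ψ ε c n := by
    intro c n m
    induction m with
    | zero => exact le_rfl
    | succ m ih => exact (hanti c _).trans ih
  have := exists_factorization (A := fun c n => E.pointLayer y d Ψ ε c (k + n)) hE.basis
    (fun c n => hanti c (k + n)) (fun n a b => ?_) (fun c => hcpt c _) ?_ ?_ neg hg
  · exact this
  · exact (Subgroup.commutator_mono (by simpa using hle a 0 k) le_rfl).trans
      (pointLayer_comm hd hΨ hε (k + n) a b)
  · intro n a h hh x hx
    by_cases hΨ0 : Ψ none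
    swap
    · rw [pointLayer_of_not hΨ0, Subgroup.mem_bot] at hh
      simpa [hh] using hx
    by_cases ha : Ψ (some a)
    swap
    · rw [pointLayer_of_not ha, Subgroup.mem_bot] at hx ⊢
      simp [hx]
    rw [pointLayer_of ha] at hx ⊢
    rw [pointLayer_of hΨ0] at hh
    refine E.conj_mem_filt (s := _) ?_ hh hx
    simp only [extRoot, map_zero, LinearMap.zero_apply, sub_zero]
    exact mul_pos (by exact_mod_cast (by omega)) hd
  · intro K hK
    obtain ⟨n, hn⟩ := pointLayer_small (y := y) (Ψ := Ψ) (ε := ε) hE hd hK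
    refine ⟨n, fun a => le_trans ?_ (hn a)⟩
    simpa [add_comm] using hle (some a) n k

/-- The factors of an element of `U_y^{(e)}` in `U_{-α} T U_α` belong to `U_y^{(e)}`. -/
theorem mem_pointGroup_of_mul [P.IsCrystallographic] [IsTopologicalGroup Γ] [T2Space Γ] [Finite ι]
    (hE : IsCompactOpen E) {e : ℝ≥0} {α : ι} {v t u : Γ} (hv : v ∈ D.U (negIdx P α))
    (ht : t ∈ D.T) (hu : u ∈ D.U α) (h : v * t * u ∈ E.pointGroup y e) :
    v ∈ E.pointGroup y e ∧ t ∈ E.Hplus e ∧ u ∈ E.pointGroup y e := by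
  obtain ⟨f, hf, hα⟩ := exists_regular P α
  obtain ⟨d, hd, hg⟩ := exists_mem_layer_of_mem_pointGroup h
  have he : (0 : ℝ) ≤ e := e.2
  have hd0 : 0 < d := he.trans_lt hd
  have hA : ∀ c, E.pointLayer y d (fun _ => True) (fun _ => 0) c 0 =
      extFilt φ E.H c (d - P.toLinearMap (extRoot P c) y) := by
    intro c
    rw [pointLayer_of trivial]
    simp
  obtain ⟨v', hv', w, hw, h', hh', heq⟩ := exists_layer_factorization hE hd0
    (fun _ _ _ _ _ _ _ _ _ _ => trivial) (fun _ => by norm_num)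
    (fun a => P.toLinearMap (P.root a) f < 0) 0 hg
  simp only [hA] at hv' hw hh'
  have hlevel : ∀ c, extFilt φ E.H c (d - P.toLinearMap (extRoot P c) y) ≤ E.pointGroup y e :=
    fun c => E.extFilt_le_pointGroup (by linarith)
  have hv1 : v' ∈ E.pointGroup y e := (iSup₂_le fun a _ => hlevel (some a)) hv'
  have hw1 : w ∈ E.pointGroup y e := (iSup₂_le fun a _ => hlevel (some a)) hw
  have hv2 : v' ∈ D.neg f := SetLike.le_def.1
    (iSup₂_le fun a ha => le_trans (fun x hx => hx.1) (GroupRootDatum.U_le_neg ha)) hv'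
  have hw2 : w ∈ D.pos f := by
    refine SetLike.le_def.1 (iSup₂_le fun a ha => ?_) hw
    exact le_trans (fun x hx => hx.1)
      (GroupRootDatum.U_le_pos (lt_of_le_of_ne (not_lt.1 ha) (hf a).symm))
  have hh1 : h' ∈ E.H d := by simpa [extFilt, extRoot] using hh'
  have hh2 : h' ∈ D.T := E.le_T d hd0.le hh1
  have hh3 : h' ∈ E.pointGroup y e := hlevel none hh'
  -- The factorisation inside U_y^{(e)} and the given one are both triangular for f, hence equal; h'
  -- is first moved to the middle.
  have := GroupRootDatum.triangular_unique hf
    (GroupRootDatum.U_le_neg (by simpa [root_negIdx] using hα) hv) hv2 ht hh2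
    (GroupRootDatum.U_le_pos hα hu) (w' := h'⁻¹ * w * h')
    (by simpa using GroupRootDatum.conj_mem_pos (inv_mem hh2) hw2)
    (by rw [heq]; group)
  obtain ⟨rfl, rfl, rfl⟩ := this
  exact ⟨hv1, E.H_le_Hplus hd hh1, mul_mem (mul_mem (inv_mem hh3) hw1) hh3⟩

end Prolongation

end Layers

end BruhatTits
end

/-! ### The quotient L and its unique triangular factorisations. -/

noncomputable section

namespace BruhatTits

open Filter Topology FilteredProduct TriangularDecomposition

section RankOneQuotient

variable {ι V W : Type*} [AddCommGroup V] [Module ℝ V] [AddCommGroup W] [Module ℝ W]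
variable {P : RootPairing ι ℝ V W} {Γ : Type*} [Group Γ]
variable {D : GroupRootDatum P Γ} {φ : RootDatumValuation D}

/-- The Cartan integers of a and α are 2m and 2/m, so z = 2m divides 4. The values z = ±1 would make
α twice a root. -/
lemma eq_of_root_eq_smul [P.IsCrystallographic] {α : ι}
    (hα : ∀ β, P.root α ≠ (2 : ℕ) • P.root β) {a : ι} {m : ℝ} (h : P.root a = m • P.root α) :
    m = 1 ∨ m = -1 ∨ m = 2 ∨ m = -2 := by
  obtain ⟨z, hz⟩ := P.exists_value (S := ℤ) a α
  obtain ⟨z', hz'⟩ := P.exists_value (S := ℤ) α a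
  have h1 : (z : ℝ) = 2 * m := by
    have : P.pairing a α = m * 2 := by
      rw [← P.root_coroot_eq_pairing, h, map_smul, LinearMap.smul_apply, P.root_coroot_two,
        smul_eq_mul]
    rw [mul_comm, ← this, ← hz]; simp
  have h2 : m * (z' : ℝ) = 2 := by
    have : (2 : ℝ) = m * P.pairing α a := by
      rw [← P.root_coroot_two a, h, map_smul, LinearMap.smul_apply, P.root_coroot_eq_pairing,
        smul_eq_mul]
    rw [this, ← hz']; simp
  have h3 : z * z' = 4 := by
    have : (z : ℝ) * z' = 4 := by rw [h1]; linarith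
    exact_mod_cast this
  have hm : m = z / 2 := by rw [h1]; ring
  have hdvd : z ∣ 4 := ⟨z', h3.symm⟩
  have hle : z ≤ 4 := Int.le_of_dvd (by norm_num) hdvd
  have hge : -4 ≤ z := by
    have := Int.le_of_dvd (by norm_num) ((neg_dvd).2 hdvd)
    linarith
  have hroot : ∀ β, P.root α = (2 : ℝ) • P.root β → False := fun β hβ => hα β (by
    rw [hβ, ← Nat.cast_smul_eq_nsmul ℝ]; norm_num)
  interval_cases z
  all_goals first
    | omega
    | (right; right; right; rw [hm]; norm_num; done)
    | (right; right; left; rw [hm]; norm_num; done)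
    | (right; left; rw [hm]; norm_num; done)
    | (left; rw [hm]; norm_num; done)
    | skip
  · refine (hroot (negIdx P a) ?_).elim
    rw [root_negIdx, h, hm, smul_neg, ← neg_smul, smul_smul]
    norm_num
  · refine (hroot a ?_).elim
    rw [h, hm, smul_smul]
    norm_num

lemma filt_le_stab (y : W) (a : ι) {k : ℝ} (h : -P.toLinearMap (P.root a) y ≤ k) :
    φ.filt a k ≤ φ.stab y := fun _ hx =>
  Subgroup.subset_closure (Or.inr (Set.mem_iUnion.2 ⟨a, filt_anti h hx⟩))

lemma filtPlus_le_filt (a : ι) (k : ℝ) : φ.filtPlus a k ≤ φ.filt a k := fun x hx => by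
  obtain ⟨l, hl, hx⟩ := mem_filtPlus_iff.1 hx
  exact filt_anti hl.le hx

lemma filt_le_U (a : ι) (k : ℝ) : φ.filt a k ≤ D.U a := fun _ hx => hx.1

namespace Prolongation

variable (E : Prolongation φ) (α : ι) (y : W) (e : ℝ≥0)

lemma filt_le_stab_inf {k : ℝ} (h : -P.toLinearMap (P.root α) y ≤ k) :
    φ.filt α k ≤ φ.stab y ⊓ D.rankOne α :=
  le_inf (filt_le_stab y α h) ((filt_le_U α k).trans le_sup_left)

lemma filt_neg_le_stab_inf {k : ℝ} (h : P.toLinearMap (P.root α) y ≤ k) :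
    φ.filt (negIdx P α) k ≤ φ.stab y ⊓ D.rankOne α :=
  le_inf (filt_le_stab y _ (by simpa [root_negIdx] using h)) ((filt_le_U _ k).trans le_sup_right)

lemma torusFilt_le_stab_inf [P.IsCrystallographic] :
    E.torusFilt α 0 ≤ φ.stab y ⊓ D.rankOne α :=
  fun _ hx => ⟨E.Hplus_le_stab y (by simpa using hx.2), hx.1.1⟩

/-- The class in `L_{α,e,r}` of an element of `P_y ∩ G_α`. -/
def mkL {g : Γ} (hg : g ∈ φ.stab y ⊓ D.rankOne α) : E.L α y e :=
  QuotientGroup.mk (⟨g, hg⟩ : (φ.stab y ⊓ D.rankOne α : Subgroup Γ))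

variable {α y}

lemma mkL_mul {g h : Γ} (hg : g ∈ φ.stab y ⊓ D.rankOne α) (hh : h ∈ φ.stab y ⊓ D.rankOne α) :
    E.mkL α y e (mul_mem hg hh) = E.mkL α y e hg * E.mkL α y e hh := rfl

lemma mkL_congr {g h : Γ} (hg : g ∈ φ.stab y ⊓ D.rankOne α) (h' : g = h) :
    E.mkL α y e hg = E.mkL α y e (h' ▸ hg : h ∈ _) := by subst h'; rfl

lemma mkL_eq_iff {g h : Γ} (hg : g ∈ φ.stab y ⊓ D.rankOne α) (hh : h ∈ φ.stab y ⊓ D.rankOne α) :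
    E.mkL α y e hg = E.mkL α y e hh ↔ g⁻¹ * h ∈ E.pointGroup y e :=
  QuotientGroup.eq

lemma mkL_eq_one_iff {g : Γ} (hg : g ∈ φ.stab y ⊓ D.rankOne α) :
    E.mkL α y e hg = 1 ↔ g ∈ E.pointGroup y e :=
  QuotientGroup.eq_one_iff _

lemma mem_imageL_iff {X : Subgroup Γ} {x : E.L α y e} : x ∈ E.imageL α y e X ↔
    ∃ (g : Γ) (hg : g ∈ φ.stab y ⊓ D.rankOne α), g ∈ X ∧ E.mkL α y e hg = x := by
  constructor
  · rintro ⟨⟨g, hg⟩, hgX, rfl⟩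
    exact ⟨g, hg, hgX, rfl⟩
  · rintro ⟨g, hg, hgX, rfl⟩
    exact ⟨⟨g, hg⟩, hgX, rfl⟩

lemma mkL_mem_imageL {X : Subgroup Γ} {g : Γ} (hg : g ∈ φ.stab y ⊓ D.rankOne α) (hX : g ∈ X) :
    E.mkL α y e hg ∈ E.imageL α y e X := (E.mem_imageL_iff e).2 ⟨g, hg, hX, rfl⟩

lemma imageL_mono {X Y : Subgroup Γ} (h : X ≤ Y) : E.imageL α y e X ≤ E.imageL α y e Y := by
  intro x hx
  obtain ⟨g, hg, hX, rfl⟩ := (E.mem_imageL_iff e).1 hx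
  exact E.mkL_mem_imageL e hg (h hX)

variable [P.IsCrystallographic]

lemma exists_torusToL_eq (q : E.TorusQuot α e) : ∃ (h : Γ) (hh : h ∈ E.torusFilt α 0),
    q = QuotientGroup.mk ⟨h, hh⟩ ∧
      E.torusToL α y e q = E.mkL α y e (E.torusFilt_le_stab_inf α y hh) := by
  obtain ⟨⟨h, hh⟩, rfl⟩ := QuotientGroup.mk_surjective q
  exact ⟨h, hh, rfl, rfl⟩

lemma conj_mem_filt_of_Hplus {h x : Γ} {a : ι} {k : ℝ} (hh : h ∈ E.Hplus 0)
    (hx : x ∈ φ.filt a k) : h * x * h⁻¹ ∈ φ.filt a k := by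
  obtain ⟨s, hs, hh⟩ := (E.mem_Hplus_iff le_rfl).1 hh
  exact E.conj_mem_filt hs hh hx

lemma conj_mem_filtPlus_of_Hplus {h x : Γ} {a : ι} {k : ℝ} (hh : h ∈ E.Hplus 0)
    (hx : x ∈ φ.filtPlus a k) : h * x * h⁻¹ ∈ φ.filtPlus a k := by
  obtain ⟨l, hl, hx⟩ := mem_filtPlus_iff.1 hx
  exact mem_filtPlus_iff.2 ⟨l, hl, E.conj_mem_filt_of_Hplus hh hx⟩

lemma conj_mem_imageL {X : Subgroup Γ} (hX : ∀ h ∈ E.Hplus 0, ∀ x ∈ X, h * x * h⁻¹ ∈ X)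
    (q : E.TorusQuot α e) {x : E.L α y e} (hx : x ∈ E.imageL α y e X) :
    E.torusToL α y e q * x * (E.torusToL α y e q)⁻¹ ∈ E.imageL α y e X := by
  obtain ⟨h, hh, rfl, hθ⟩ := E.exists_torusToL_eq (y := y) e q
  obtain ⟨g, hg, hgX, rfl⟩ := (E.mem_imageL_iff e).1 hx
  rw [hθ]
  exact E.mkL_mem_imageL e (mul_mem (mul_mem (E.torusFilt_le_stab_inf α y hh) hg)
    (inv_mem (E.torusFilt_le_stab_inf α y hh))) (hX h (by simpa using hh.2) g hgX)

variable (α y) in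
/-- The middle factor of an element of `L_{α,e,r}`. -/
def tauL (b : E.L α y e) : E.TorusQuot α e :=
  Classical.epsilon fun t => ∃ ubar ∈ E.imUbar α y e, ∃ u ∈ E.imUplus α y e,
    b = ubar * E.torusToL α y e t * u

variable [TopologicalSpace Γ] [IsTopologicalGroup Γ] [T2Space Γ] [Finite ι]

-- Lifting to P_y ∩ G_α gives a product in U_y^{(e)}, whose three factors are then in U_y^{(e)} too.
variable {E} in
lemma eq_one_of_mul_eq_one (hE : IsCompactOpen E) {n u : E.L α y e} {q : E.TorusQuot α e}
    (hn : n ∈ E.imUbar α y e) (hu : u ∈ E.imUplus α y e) (h : n * E.torusToL α y e q * u = 1) :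
    n = 1 ∧ q = 1 ∧ u = 1 := by
  obtain ⟨t, ht, rfl, hθ⟩ := E.exists_torusToL_eq (y := y) e q
  obtain ⟨v, hv, hvX, rfl⟩ := (E.mem_imageL_iff e).1 hn
  obtain ⟨w, hw, hwX, rfl⟩ := (E.mem_imageL_iff e).1 hu
  rw [hθ, ← mkL_mul, ← mkL_mul, mkL_eq_one_iff] at h
  obtain ⟨h1, h2, h3⟩ := mem_pointGroup_of_mul hE (filt_le_U _ _ hvX) ht.1.2
    (filt_le_U _ _ (filtPlus_le_filt _ _ hwX)) h
  exact ⟨(E.mkL_eq_one_iff e hv).2 h1, (QuotientGroup.eq_one_iff _).2 ⟨ht.1, h2⟩,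
    (E.mkL_eq_one_iff e hw).2 h3⟩

variable {E} in
theorem isTriangular (hE : IsCompactOpen E) : IsTriangular (E.imUbar α y e) (E.imUplus α y e)
    (E.torusToL α y e) (E.tauL α y e) := by
  have conjN : ∀ q, ∀ n ∈ E.imUbar α y e,
      E.torusToL α y e q * n * (E.torusToL α y e q)⁻¹ ∈ E.imUbar α y e := fun q n hn =>
    E.conj_mem_imageL e (fun h hh x hx => E.conj_mem_filt_of_Hplus hh hx) q hn
  have conjU : ∀ q, ∀ n ∈ E.imUplus α y e,
      E.torusToL α y e q * n * (E.torusToL α y e q)⁻¹ ∈ E.imUplus α y e := fun q n hn =>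
    E.conj_mem_imageL e (fun h hh x hx => E.conj_mem_filtPlus_of_Hplus hh hx) q hn
  have uniq : ∀ n ∈ E.imUbar α y e, ∀ n' ∈ E.imUbar α y e, ∀ q q', ∀ u ∈ E.imUplus α y e,
      ∀ u' ∈ E.imUplus α y e,
      n * E.torusToL α y e q * u = n' * E.torusToL α y e q' * u' → n = n' ∧ q = q' ∧ u = u' := by
    intro n hn n' hn' q q' u hu u' hu' h
    have h1 := eq_one_of_mul_eq_one (q := q * q'⁻¹) e hE (mul_mem (inv_mem hn') hn)
      (conjU q' _ (mul_mem hu (inv_mem hu'))) (by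
        have : n'⁻¹ * (n * E.torusToL α y e q * u) * u'⁻¹ * (E.torusToL α y e q')⁻¹ = 1 := by
          rw [h]; group
        rw [← this, map_mul, map_inv]; group)
    obtain ⟨h2, h3, h4⟩ := h1
    refine ⟨(inv_mul_eq_one.1 h2).symm, mul_inv_eq_one.1 h3, ?_⟩
    rw [conj_eq_one_iff] at h4
    exact mul_inv_eq_one.1 h4
  refine ⟨conjN, conjU, uniq, fun n hn q u hu => ?_⟩
  have hex : ∃ t, ∃ ubar ∈ E.imUbar α y e, ∃ u' ∈ E.imUplus α y e,
      n * E.torusToL α y e q * u = ubar * E.torusToL α y e t * u' := ⟨q, n, hn, u, hu, rfl⟩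
  obtain ⟨n', hn', u', hu', h⟩ := Classical.epsilon_spec hex
  exact (uniq n hn n' hn' q _ u hu u' hu' h).2.1.symm

end Prolongation

end RankOneQuotient

end BruhatTits
end

/-! ### Finiteness of the images, and their p-power orders. -/

noncomputable section

namespace BruhatTits

open Filter Topology FilteredProduct TriangularDecomposition

section Finiteness

variable {ι V W : Type*} [AddCommGroup V] [Module ℝ V] [AddCommGroup W] [Module ℝ W]
variable {P : RootPairing ι ℝ V W} {Γ : Type*} [Group Γ]
variable {D : GroupRootDatum P Γ} {φ : RootDatumValuation D}

namespace Prolongation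

variable {E : Prolongation φ} {α : ι} {y : W} (e : ℝ≥0)
variable [TopologicalSpace Γ]

lemma exists_open_inter_filt (hE : IsCompactOpen E) (y : W) (a : ι) (k : ℝ) :
    ∃ O : Set Γ, IsOpen O ∧ 1 ∈ O ∧ O ∩ (φ.filt a k : Set Γ) ⊆ E.pointGroup y e := by
  obtain ⟨O, hO, h⟩ := hE.isOpen_filt a (e - P.toLinearMap (P.root a) y + 1)
  have h1 : (1 : Γ) ∈ O ∩ (D.U a : Set Γ) := by rw [h]; exact one_mem _
  refine ⟨O, hO, h1.1, fun x hx => ?_⟩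
  have hx' : x ∈ φ.filt a (e - P.toLinearMap (P.root a) y + 1) := by
    rw [← SetLike.mem_coe, ← h]
    exact ⟨hx.1, hx.2.1⟩
  refine E.extFilt_le_pointGroup (c := some a) ?_ hx'
  simp [extRoot]

section TopologicalGroup

variable [IsTopologicalGroup Γ]

lemma finite_imageL {X : Subgroup Γ} (hX : IsCompact (X : Set Γ)) {O : Set Γ} (hO : IsOpen O)
    (h1 : 1 ∈ O) (h : O ∩ X ⊆ E.pointGroup y e) : Finite (E.imageL α y e X) := by
  obtain ⟨t, ht⟩ := LinAlgGroup.exists_finite_cosets hX hO h1 h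
  have : ∀ x : E.imageL α y e X, ∃ z : t, ∃ (g : Γ) (hg : g ∈ φ.stab y ⊓ D.rankOne α),
      E.mkL α y e hg = x ∧ (z : Γ)⁻¹ * g ∈ E.pointGroup y e := by
    intro x
    obtain ⟨g, hg, hgX, hx⟩ := (E.mem_imageL_iff e).1 x.2
    obtain ⟨z, hz, hzg⟩ := ht g hgX
    exact ⟨⟨z, hz⟩, g, hg, hx, hzg⟩
  choose f g hg hx hf using this
  refine Finite.of_injective f fun x x' hxx => Subtype.ext ?_
  rw [← hx x, ← hx x', mkL_eq_iff]
  have := mul_mem (inv_mem (hf x)) (hf x')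
  rw [hxx] at this
  simpa [mul_assoc] using this

lemma finite_imageL_filt (hE : IsCompactOpen E) (a : ι) (k : ℝ) :
    Finite (E.imageL α y e (φ.filt a k)) := by
  obtain ⟨O, hO, h1, h⟩ := exists_open_inter_filt e hE y a k
  exact finite_imageL e (hE.compact_filt a k) hO h1 h

lemma finite_imU (hE : IsCompactOpen E) : Finite (E.imU α y e) := finite_imageL_filt e hE _ _

lemma finite_imUbar (hE : IsCompactOpen E) : Finite (E.imUbar α y e) :=
  finite_imageL_filt e hE _ _

variable (E) in
omit [TopologicalSpace Γ] [IsTopologicalGroup Γ] in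
lemma imUplus_le_imU : E.imUplus α y e ≤ E.imU α y e := E.imageL_mono e (filtPlus_le_filt _ _)

lemma finite_imUplus (hE : IsCompactOpen E) : Finite (E.imUplus α y e) := by
  have := finite_imU (α := α) (y := y) e hE
  exact Finite.of_injective _ (Subgroup.inclusion_injective (E.imUplus_le_imU e))

lemma finite_torusQuot (hE : IsCompactOpen E) : Finite (E.TorusQuot α e) := by
  have he : (0 : ℝ) ≤ e := e.2
  obtain ⟨O, hO, h⟩ := hE.isOpen_H (e + 1) (by linarith)
  have h1 : (1 : Γ) ∈ O ∩ (D.T : Set Γ) := by rw [h]; exact one_mem _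
  have hOX : O ∩ (E.H 0 : Set Γ) ⊆ E.Hplus e := fun x hx => by
    refine E.H_le_Hplus (lt_add_one (e : ℝ)) ?_
    rw [← SetLike.mem_coe, ← h]
    exact ⟨hx.1, E.le_T 0 le_rfl hx.2⟩
  obtain ⟨t, ht⟩ := LinAlgGroup.exists_finite_cosets (hE.compact_H 0 le_rfl) hO h1.1 hOX
  have : ∀ q : E.TorusQuot α e, ∃ z : t, ∃ (g : Γ) (hg : g ∈ E.torusFilt α 0),
      q = QuotientGroup.mk ⟨g, hg⟩ ∧ (z : Γ)⁻¹ * g ∈ E.Hplus e := by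
    intro q
    obtain ⟨⟨g, hg⟩, rfl⟩ := QuotientGroup.mk_surjective q
    obtain ⟨s, hs, hgs⟩ := (E.mem_Hplus_iff le_rfl).1 (by simpa using hg.2)
    obtain ⟨z, hz, hzg⟩ := ht g (E.anti 0 s le_rfl hs.le hgs)
    exact ⟨⟨z, hz⟩, g, hg, rfl, hzg⟩
  choose f g hg hx hf using this
  refine Finite.of_injective f fun x x' hxx => ?_
  rw [hx x, hx x', QuotientGroup.eq]
  refine ⟨Subgroup.mul_mem _ (Subgroup.inv_mem _ (hg x).1) (hg x').1, ?_⟩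
  have := mul_mem (inv_mem (hf x)) (hf x')
  rw [hxx] at this
  simpa [mul_assoc] using this

end TopologicalGroup

/-- The powers g^(p^k) eventually enter U_y^{(e)}, so every element of the image has p-power order.
-/
lemma exists_card_eq_pow (hE : IsCompactOpen E) {p : ℕ} (hp : p.Prime) {a : ι}
    (hpow : ∀ g ∈ D.U a, Tendsto (fun k : ℕ => g ^ p ^ k) atTop (𝓝 1)) {k : ℝ} {X : Subgroup Γ}
    (hX : X ≤ φ.filt a k) (hfin : Finite (E.imageL α y e X)) :
    ∃ j, Nat.card (E.imageL α y e X) = p ^ j := by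
  have : Fact p.Prime := ⟨hp⟩
  refine IsPGroup.iff_card.1 ?_
  rintro ⟨x, hx⟩
  obtain ⟨g, hg, hgX, rfl⟩ := (E.mem_imageL_iff e).1 hx
  obtain ⟨O, hO, h1, h⟩ := exists_open_inter_filt e hE y a k
  obtain ⟨n, hn⟩ := ((hpow g (hX hgX).1).eventually (hO.mem_nhds h1)).exists
  refine ⟨n, Subtype.ext ?_⟩
  have h2 : E.mkL α y e (pow_mem hg (p ^ n)) = 1 :=
    (E.mkL_eq_one_iff e _).2 (h ⟨hn, pow_mem (hX hgX) _⟩)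
  exact h2

end Prolongation

end Finiteness

end BruhatTits
end

/-! ### The central chain on the line through α. -/

noncomputable section

namespace BruhatTits

open Filter Topology FilteredProduct TriangularDecomposition

section RankOneChain

variable {ι V W : Type*} [AddCommGroup V] [Module ℝ V] [AddCommGroup W] [Module ℝ W]
variable {P : RootPairing ι ℝ V W} {Γ : Type*} [Group Γ]
variable {D : GroupRootDatum P Γ} {φ : RootDatumValuation D}

lemma filt_le_filt_of_root_eq_two_smul {a b : ι} (h : P.root b = (2 : ℕ) • P.root a) {k l : ℝ}
    (hkl : 2 * k ≤ l) : φ.filt b l ≤ φ.filt a k := by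
  intro u hu
  refine ⟨(D.double_lt a b h).le hu.1, ?_⟩
  have h4 := hu.2
  rw [φ.double a b h u hu.1] at h4
  rcases hv : φ.val a u with _ | v
  · exact le_top
  · rw [hv] at h4
    have h5 : l ≤ v + v := WithTop.coe_le_coe.1 h4
    exact WithTop.coe_le_coe.2 (by linarith)

/-- The elements of `Φ ∪ {0}` on the line through `α`. -/
def IsOnLine (P : RootPairing ι ℝ V W) (α : ι) (c : Option ι) : Prop :=
  ∃ m : ℝ, extRoot P c = m • P.root α

lemma isClosedSet_isOnLine (α : ι) : Prolongation.IsClosedSet P (IsOnLine P α) := by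
  rintro a b c i j ⟨m, hm⟩ ⟨m', hm'⟩ _ _ hc
  refine ⟨i * m + j * m', ?_⟩
  rw [hc, hm, hm', ← Nat.cast_smul_eq_nsmul ℝ, ← Nat.cast_smul_eq_nsmul ℝ, smul_smul, smul_smul,
    add_smul]

open scoped Classical in
/-- The minimal levels: `2` for the roots `± 2 α`, and `0` for `± α` and `0`. -/
def lineLevel (P : RootPairing ι ℝ V W) (α : ι) : Option ι → ℕ
  | none => 0
  | some b => if b = α ∨ b = negIdx P α then 0 else 2

lemma lineLevel_le (α : ι) (c : Option ι) : lineLevel P α c ≤ 2 := by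
  cases c with
  | none => simp [lineLevel]
  | some b => simp only [lineLevel]; split_ifs <;> norm_num

namespace Prolongation

variable (E : Prolongation φ) (α : ι) (y : W)

/-- The layers attached to `0` and the roots on the line through `α`. -/
def lineLayer (d : ℝ) : Option ι → ℕ → Subgroup Γ :=
  E.pointLayer (y - (d / 2) • P.coroot α) d (IsOnLine P α) (lineLevel P α)

variable {E α y} {d : ℝ}

/-- Shifting the point by -(d/2)α^∨ makes depth d at the new point mean level r + 2d for α but
exactly -r for -α. One uniform filtration thus starts with all of U_{-α,-r} and a group inside
U_{α,r+}. -/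
lemma root_line_point : P.toLinearMap (P.root α) (y - (d / 2) • P.coroot α) =
    P.toLinearMap (P.root α) y - d := by
  rw [map_sub, map_smul, P.root_coroot_two, smul_eq_mul]
  ring

lemma lineLayer_self : E.lineLayer α y d (some α) 0 =
    φ.filt α (2 * d - P.toLinearMap (P.root α) y) := by
  rw [lineLayer, pointLayer_of ⟨1, by simp [extRoot]⟩]
  simp only [extRoot, root_line_point, lineLevel, extFilt, true_or, if_true]
  congr 1
  push_cast
  simp
  ring

lemma lineLayer_neg : E.lineLayer α y d (some (negIdx P α)) 0 =
    φ.filt (negIdx P α) (P.toLinearMap (P.root α) y) := by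
  rw [lineLayer, pointLayer_of ⟨-1, by simp [extRoot, root_negIdx]⟩]
  simp only [extRoot, root_negIdx, map_neg, LinearMap.neg_apply, root_line_point, lineLevel,
    extFilt, or_true, if_true]
  congr 1
  push_cast
  simp

lemma lineLayer_none : E.lineLayer α y d none 0 = E.H d := by
  rw [lineLayer, pointLayer_of ⟨0, by simp [extRoot]⟩]
  simp [extRoot, lineLevel, extFilt]

/-- Since φ_{2a} = 2 φ_a on U_{2a}, the group for ±2α lies in that for ±α once its level is doubled;
the minimal depth 2d achieves exactly this. -/
lemma lineLayer_le [P.IsCrystallographic] (hα : ∀ β, P.root α ≠ (2 : ℕ) • P.root β) {f : W}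
    (hf : 0 < P.toLinearMap (P.root α) f) (b : ι) :
    (P.toLinearMap (P.root b) f < 0 → E.lineLayer α y d (some b) 0 ≤
      φ.filt (negIdx P α) (P.toLinearMap (P.root α) y)) ∧
    (¬ P.toLinearMap (P.root b) f < 0 → E.lineLayer α y d (some b) 0 ≤
      φ.filt α (2 * d - P.toLinearMap (P.root α) y)) := by
  by_cases hb : IsOnLine P α (some b)
  swap
  · rw [lineLayer, pointLayer_of_not hb]
    exact ⟨fun _ => bot_le, fun _ => bot_le⟩
  obtain ⟨m, hm⟩ := id hb
  simp only [extRoot] at hm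
  have hbf : P.toLinearMap (P.root b) f = m * P.toLinearMap (P.root α) f := by rw [hm]; simp
  have hroot : P.root α ≠ 0 := P.ne_zero α
  have hlev : m ≠ 1 → m ≠ -1 → lineLevel P α (some b) = 2 := by
    intro h1 h2
    simp only [lineLevel]
    refine if_neg ?_
    rintro (rfl | rfl)
    · exact h1 (smul_left_injective ℝ hroot (by simpa using hm.symm))
    · rw [root_negIdx] at hm
      exact h2 (smul_left_injective ℝ hroot (by simpa using hm.symm))
  have hlayer : lineLevel P α (some b) = 2 → E.lineLayer α y d (some b) 0 =
      φ.filt b (2 * d - m * (P.toLinearMap (P.root α) y - d)) := by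
    intro h
    rw [lineLayer, pointLayer_of hb, h]
    simp only [extRoot, hm, map_smul, LinearMap.smul_apply, root_line_point, extFilt, smul_eq_mul]
    norm_num
  rcases eq_of_root_eq_smul hα hm with rfl | rfl | rfl | rfl
  · obtain rfl : b = α := P.root.injective (by simpa using hm)
    exact ⟨fun h => (lt_asymm hf h).elim, fun _ => lineLayer_self.le⟩
  · obtain rfl : b = negIdx P α := P.root.injective (by rw [root_negIdx]; simpa using hm)
    exact ⟨fun _ => lineLayer_neg.le, fun h => (h (by rw [hbf]; linarith)).elim⟩
  · refine ⟨fun h => ?_, fun _ => ?_⟩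
    · rw [hbf] at h; linarith
    · rw [hlayer (hlev (by norm_num) (by norm_num))]
      refine filt_le_filt_of_root_eq_two_smul ?_ (by linarith)
      rw [hm, ← Nat.cast_smul_eq_nsmul ℝ]; norm_num
  · refine ⟨fun _ => ?_, fun h => (h (by rw [hbf]; linarith)).elim⟩
    rw [hlayer (hlev (by norm_num) (by norm_num))]
    refine filt_le_filt_of_root_eq_two_smul ?_ (by linarith)
    rw [hm, root_negIdx, ← Nat.cast_smul_eq_nsmul ℝ]
    simp

variable [TopologicalSpace Γ] [IsTopologicalGroup Γ] [T2Space Γ] [Finite ι]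
  [P.IsCrystallographic] (e : ℝ≥0)

lemma decomposed_imageL_layer (hE : IsCompactOpen E) (hα : ∀ β, P.root α ≠ (2 : ℕ) • P.root β)
    (hd : 0 < d) (n : ℕ) : Decomposed (E.imUbar α y e) (E.imUplus α y e) (E.torusToL α y e)
      (E.imageL α y e (layer (E.lineLayer α y d) n)) := by
  intro x hx
  obtain ⟨g, hg, hgX, rfl⟩ := (E.mem_imageL_iff e).1 hx
  obtain ⟨f, hf, hαf⟩ := exists_regular P α
  obtain ⟨v, hv, w, hw, h, hh, heq⟩ := exists_layer_factorization hE hd (isClosedSet_isOnLine α)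
    (lineLevel_le α) (fun b => P.toLinearMap (P.root b) f < 0) n hgX
  have hle : ∀ c, E.lineLayer α y d c n ≤ E.lineLayer α y d c 0 := fun c =>
    A_le (fun c n => pointLayer_anti hd c n) c n
  have hv0 : v ∈ φ.filt (negIdx P α) (P.toLinearMap (P.root α) y) :=
    SetLike.le_def.1 (iSup₂_le fun b hb => (hle _).trans ((lineLayer_le hα hαf b).1 hb)) hv
  have hw0 : w ∈ φ.filt α (2 * d - P.toLinearMap (P.root α) y) :=
    SetLike.le_def.1 (iSup₂_le fun b hb => (hle _).trans ((lineLayer_le hα hαf b).2 hb)) hw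
  have hh0 : h ∈ E.H d := by rw [← lineLayer_none (α := α) (y := y)]; exact hle none hh
  have hvn : v ∈ layer (E.lineLayer α y d) n :=
    SetLike.le_def.1 (iSup₂_le fun b _ => le_layer (some b) n) hv
  have hwn : w ∈ layer (E.lineLayer α y d) n :=
    SetLike.le_def.1 (iSup₂_le fun b _ => le_layer (some b) n) hw
  have hhn : h ∈ layer (E.lineLayer α y d) n := le_layer none n hh
  have hvS := filt_neg_le_stab_inf α y le_rfl hv0
  have hwS := filt_le_stab_inf α y (by linarith) hw0
  have hhS : h ∈ φ.stab y ⊓ D.rankOne α := by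
    have : h = w⁻¹ * v⁻¹ * g := by rw [heq]; group
    rw [this]
    exact mul_mem (mul_mem (inv_mem hwS) (inv_mem hvS)) hg
  have hhT : h ∈ E.torusFilt α 0 :=
    ⟨⟨hhS.2, E.le_T d hd.le hh0⟩, E.H_le_Hplus (by simpa using hd) hh0⟩
  have hu0 : h⁻¹ * w * h ∈ φ.filt α (2 * d - P.toLinearMap (P.root α) y) := by
    simpa using E.conj_mem_filt hd (inv_mem hh0) hw0
  have huS := mul_mem (mul_mem (inv_mem hhS) hwS) hhS
  refine ⟨E.mkL α y e hvS, E.mkL_mem_imageL e hvS hv0, QuotientGroup.mk ⟨h, hhT⟩,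
    E.mkL α y e huS, E.mkL_mem_imageL e huS (mem_filtPlus_iff.2 ⟨_, ?_, hu0⟩),
    E.mkL_mem_imageL e hvS hvn, E.mkL_mem_imageL e hhS hhn,
    E.mkL_mem_imageL e huS (mul_mem (mul_mem (inv_mem hhn) hwn) hhn), ?_⟩
  · linarith
  · change _ = E.mkL α y e hvS * E.mkL α y e hhS * E.mkL α y e huS
    rw [← mkL_mul, ← mkL_mul, mkL_eq_iff]
    have : g⁻¹ * (v * h * (h⁻¹ * w * h)) = 1 := by rw [heq]; group
    rw [this]
    exact one_mem _

-- The levels of the finitely many pieces grow linearly in n, eventually beyond those of U_y^{(e)};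
-- so the chain in L terminates.
omit [TopologicalSpace Γ] [IsTopologicalGroup Γ] [T2Space Γ] [P.IsCrystallographic] in
lemma exists_layer_le_pointGroup (hd : 0 < d) :
    ∃ n, layer (E.lineLayer α y d) n ≤ E.pointGroup y e := by
  have h1 : ∀ c, ∀ᶠ n : ℕ in atTop, E.lineLayer α y d c n ≤ E.pointGroup y e := by
    intro c
    obtain ⟨N, hN⟩ := exists_nat_gt ((e - P.toLinearMap (extRoot P c) y +
      P.toLinearMap (extRoot P c) (y - (d / 2) • P.coroot α)) / d)
    filter_upwards [eventually_ge_atTop N] with n hn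
    by_cases h : IsOnLine P α c
    · rw [lineLayer, pointLayer_of h]
      refine E.extFilt_le_pointGroup ?_
      rw [div_lt_iff₀ hd] at hN
      have : (N : ℝ) * d ≤ ((max (n + 1) (lineLevel P α c) : ℕ) : ℝ) * d :=
        mul_le_mul_of_nonneg_right (by exact_mod_cast (by omega)) hd.le
      linarith
    · rw [lineLayer, pointLayer_of_not h]; exact bot_le
  obtain ⟨n, hn⟩ := (eventually_all.2 h1).exists
  exact ⟨n, iSup_le hn⟩

theorem isDecomposedChain (hE : IsCompactOpen E) (hα : ∀ β, P.root α ≠ (2 : ℕ) • P.root β)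
    (hd : 0 < d) : IsDecomposedChain (E.imUbar α y e) (E.imUplus α y e) (E.torusToL α y e)
      fun n => E.imageL α y e (layer (E.lineLayer α y d) n) where
  dec n := decomposed_imageL_layer e hE hα hd n
  comm n b hb c hc := by
    obtain ⟨g, hg, hgX, rfl⟩ := (E.mem_imageL_iff e).1 hb
    obtain ⟨h, hh, hhX, rfl⟩ := (E.mem_imageL_iff e).1 hc
    exact E.mkL_mem_imageL e (mul_mem (mul_mem (mul_mem hg hh) (inv_mem hg)) (inv_mem hh))
      (layer_commutator (fun c n => pointLayer_anti hd c n)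
        (pointLayer_comm hd (isClosedSet_isOnLine α) (lineLevel_le α)) hgX hhX)
  bot := by
    obtain ⟨n, hn⟩ := exists_layer_le_pointGroup (E := E) (α := α) (y := y) e hd
    refine ⟨n, (Subgroup.eq_bot_iff_forall _).2 fun x hx => ?_⟩
    obtain ⟨g, hg, hgX, rfl⟩ := (E.mem_imageL_iff e).1 hx
    exact (E.mkL_eq_one_iff e hg).2 (hn hgX)
  finite := by
    have := finite_imUbar (α := α) (y := y) e hE
    have := finite_imUplus (α := α) (y := y) e hE
    have := finite_torusQuot (α := α) e hE
    refine (Set.finite_range fun q : E.imUbar α y e × E.TorusQuot α e × E.imUplus α y e =>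
      (q.1 : E.L α y e) * E.torusToL α y e q.2.1 * q.2.2).subset fun x hx => ?_
    obtain ⟨n, hn, q, u, hu, _, _, _, rfl⟩ := decomposed_imageL_layer e hE hα hd 0 x hx
    exact ⟨(⟨n, hn⟩, q, ⟨u, hu⟩), rfl⟩

variable (α y) in
/-- A chain of subgroups of `L_{α,e,r}` that starts above the images of `U_{α,r+}` and
`U_{-α,-r}`. -/
theorem exists_isDecomposedChain (hE : IsCompactOpen E)
    (hα : ∀ β, P.root α ≠ (2 : ℕ) • P.root β) :
    ∃ C, IsDecomposedChain (E.imUbar α y e) (E.imUplus α y e) (E.torusToL α y e) C ∧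
      E.imUbar α y e ≤ C 0 ∧ E.imUplus α y e ≤ C 0 := by
  have := finite_imUplus (α := α) (y := y) e hE
  -- The image of U_{α,r+} is finite, so a single small d puts all of it into the image of
  -- U_{α,r+2d}.
  have h1 : ∀ x : E.imUplus α y e, ∀ᶠ d in 𝓝[>] (0 : ℝ),
      (x : E.L α y e) ∈ E.imageL α y e (φ.filt α (2 * d - P.toLinearMap (P.root α) y)) := by
    intro x
    obtain ⟨g, hg, hgX, hx⟩ := (E.mem_imageL_iff e).1 x.2
    obtain ⟨l, hl, hgl⟩ := mem_filtPlus_iff.1 hgX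
    have hpos : 0 < (l + P.toLinearMap (P.root α) y) / 2 := by linarith
    filter_upwards [Ioo_mem_nhdsGT hpos] with d hd
    rw [← hx]
    exact E.mkL_mem_imageL e hg (filt_anti (by linarith [hd.2]) hgl)
  obtain ⟨d, hd, hd0⟩ := ((eventually_all.2 h1).and self_mem_nhdsWithin).exists
  refine ⟨_, isDecomposedChain e hE hα (Set.mem_Ioi.1 hd0), ?_, fun x hx => ?_⟩
  · refine E.imageL_mono e ?_
    rw [← lineLayer_neg (d := d)]
    exact le_layer _ 0
  · have := hd ⟨x, hx⟩
    rw [← lineLayer_self] at this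
    exact E.imageL_mono e (le_layer _ 0) this

end Prolongation

end RankOneChain

end BruhatTits
end

/-! ### Transfer to the elements [X] and S of the group algebras. -/

noncomputable section

namespace BruhatTits

open Filter Topology FilteredProduct TriangularDecomposition

section GroupAlgebra

variable {ι V W : Type*} [AddCommGroup V] [Module ℝ V] [AddCommGroup W] [Module ℝ W]
variable {P : RootPairing ι ℝ V W} {Γ : Type*} [Group Γ]
variable {D : GroupRootDatum P Γ} {φ : RootDatumValuation D}

namespace Prolongation

variable {E : Prolongation φ} {α : ι} {y : W} (e : ℝ≥0)

lemma bracket_eq_setSum (R : Type*) [Ring R] {X : Subgroup (E.L α y e)}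
    {F : Finset (E.L α y e)} (hF : ∀ x, x ∈ F ↔ x ∈ X) : E.bracket R X = setSum R F := by
  rw [bracket, setSum, ← finsum_mem_coe_finset,
    finsum_mem_congr (show (F : Set (E.L α y e)) = X from Set.ext fun x => hF x) fun _ _ => rfl]
  exact finsum_set_coe_eq_finsum_mem (X : Set (E.L α y e))

section Crystallographic

variable [P.IsCrystallographic]

lemma elementS_eq_midSum (R : Type*) [Ring R] {FN FU : Finset (E.L α y e)}
    (hFN : ∀ x, x ∈ FN ↔ x ∈ E.imUbar α y e) (hFU : ∀ x, x ∈ FU ↔ x ∈ E.imUplus α y e) :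
    E.elementS R α y e = midSum R FN FU (E.tauL α y e) := by
  have : Fintype (E.imUbar α y e) := Fintype.subtype FN hFN
  have : Fintype (E.imUplus α y e) := Fintype.subtype FU hFU
  rw [elementS, finsum_eq_sum_of_fintype, Fintype.sum_prod_type, midSum,
    Finset.sum_subtype FU hFU]
  refine Finset.sum_congr rfl fun x _ => ?_
  rw [Finset.sum_subtype FN hFN]
  -- `tElt` at (x, n) is by definition `tauL` at x n.
  rfl

variable [TopologicalSpace Γ] [IsTopologicalGroup Γ] [T2Space Γ] [Finite ι]

lemma exists_decomposition_mul (hE : IsCompactOpen E)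
    (hα : ∀ β, P.root α ≠ (2 : ℕ) • P.root β) : ∀ x ∈ E.imUplus α y e, ∀ n ∈ E.imUbar α y e,
      ∃ n' ∈ E.imUbar α y e, ∃ q, ∃ u ∈ E.imUplus α y e, x * n = n' * E.torusToL α y e q * u := by
  intro x hx n hn
  obtain ⟨C, hC, hNC, hUC⟩ := exists_isDecomposedChain α y e hE hα
  obtain ⟨n', hn', q, u, hu, _, _, _, h⟩ := hC.dec 0 _ (mul_mem (hUC hx) (hNC hn))
  exact ⟨n', hn', q, u, hu, h⟩

theorem existsUnique_decomposition (hE : IsCompactOpen E)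
    (hα : ∀ β, P.root α ≠ (2 : ℕ) • P.root β) {x xbar : E.L α y e} (hx : x ∈ E.imUplus α y e)
    (hxbar : xbar ∈ E.imUbar α y e) :
    ∃! q : E.imUbar α y e × E.TorusQuot α e × E.imUplus α y e,
      x * xbar = q.1 * E.torusToL α y e q.2.1 * q.2.2 := by
  obtain ⟨n, hn, q, u, hu, h⟩ := exists_decomposition_mul e hE hα x hx xbar hxbar
  refine ⟨(⟨n, hn⟩, q, ⟨u, hu⟩), h, ?_⟩
  rintro ⟨⟨n', hn'⟩, q', ⟨u', hu'⟩⟩ h'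
  obtain ⟨rfl, rfl, rfl⟩ := (isTriangular e hE).unique n' hn' n hn q' q u' hu' u hu (h'.symm.trans h)
  rfl

-- A representative outside U_{α,r+} has valuation exactly r, so the exchange element of rank one
-- exists; it lies in P_y ∩ G_α because v, v' and the representative do.
omit [P.IsCrystallographic] [TopologicalSpace Γ] [IsTopologicalGroup Γ] [T2Space Γ] in
lemma exists_swap_imU {u : E.L α y e} (hu : u ∈ E.imU α y e) (hu' : u ∉ E.imUplus α y e) :
    ∃ v ∈ E.imUbar α y e, ∃ m, ∃ v' ∈ E.imUbar α y e, u = v * m * v' ∧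
      (∀ n ∈ E.imUbar α y e, m * n * m⁻¹ ∈ E.imU α y e) ∧
      ∀ u ∈ E.imU α y e, m⁻¹ * u * m ∈ E.imUbar α y e := by
  obtain ⟨g, hg, hgX, rfl⟩ := (E.mem_imageL_iff e).1 hu
  have hval : φ.val α g = ((-P.toLinearMap (P.root α) y : ℝ) : WithTop ℝ) := by
    refine le_antisymm (not_lt.1 fun h => hu' ?_) hgX.2
    exact E.mkL_mem_imageL e hg ⟨hgX.1, h⟩
  obtain ⟨v, hv, m, v', hv', h, h1, h2⟩ := φ.exists_swap hgX.1 hval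
  rw [neg_neg] at hv hv' h1 h2
  have hvS := filt_neg_le_stab_inf α y le_rfl hv
  have hvS' := filt_neg_le_stab_inf α y le_rfl hv'
  have hmS : m ∈ φ.stab y ⊓ D.rankOne α := by
    have : m = v⁻¹ * g * v'⁻¹ := by rw [h]; group
    rw [this]
    exact mul_mem (mul_mem (inv_mem hvS) hg) (inv_mem hvS')
  refine ⟨E.mkL α y e hvS, E.mkL_mem_imageL e hvS hv, E.mkL α y e hmS, E.mkL α y e hvS',
    E.mkL_mem_imageL e hvS' hv', ?_, ?_, ?_⟩
  · rw [← mkL_mul, ← mkL_mul]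
    exact E.mkL_congr e hg h
  · intro n hn
    obtain ⟨x, hx, hxX, rfl⟩ := (E.mem_imageL_iff e).1 hn
    exact E.mkL_mem_imageL e (mul_mem (mul_mem hmS hx) (inv_mem hmS)) (h1 x hxX)
  · intro n hn
    obtain ⟨x, hx, hxX, rfl⟩ := (E.mem_imageL_iff e).1 hn
    exact E.mkL_mem_imageL e (mul_mem (mul_mem (inv_mem hmS) hx) hmS) (h2 x hxX)

theorem bracket_identities (hE : IsCompactOpen E) (hα : ∀ β, P.root α ≠ (2 : ℕ) • P.root β)
    (R : Type*) [Ring R] :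
    (E.bracket R (E.imUbar α y e) * E.bracket R (E.imUplus α y e)) ^ 2 =
        E.bracket R (E.imUbar α y e) * E.toHeckeL R α y e (E.elementS R α y e) *
          E.bracket R (E.imUplus α y e) ∧
    E.elementS R α y e ∈ Subring.center (MonoidAlgebra R (E.TorusQuot α e)) ∧
    ∃ f : MonoidAlgebra R (E.L α y e),
      E.bracket R (E.imUbar α y e) * E.toHeckeL R α y e (E.elementS R α y e) *
          E.bracket R (E.imUplus α y e) =
        E.bracket R (E.imUbar α y e) * E.bracket R (E.imU α y e) * f := by
  have hfN : ((E.imUbar α y e : Subgroup _) : Set (E.L α y e)).Finite := finite_imUbar e hE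
  have hfU : ((E.imUplus α y e : Subgroup _) : Set (E.L α y e)).Finite := finite_imUplus e hE
  have hfU' : ((E.imU α y e : Subgroup _) : Set (E.L α y e)).Finite := finite_imU e hE
  have hN : ∀ x, x ∈ hfN.toFinset ↔ x ∈ E.imUbar α y e := fun x => hfN.mem_toFinset
  have hU : ∀ x, x ∈ hfU.toFinset ↔ x ∈ E.imUplus α y e := fun x => hfU.mem_toFinset
  have hU' : ∀ x, x ∈ hfU'.toFinset ↔ x ∈ E.imU α y e := fun x => hfU'.mem_toFinset
  have T := isTriangular (α := α) (y := y) e hE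
  have hdec := exists_decomposition_mul (α := α) (y := y) e hE hα
  rw [bracket_eq_setSum e R hN, bracket_eq_setSum e R hU, bracket_eq_setSum e R hU',
    elementS_eq_midSum e R hN hU]
  refine ⟨sq_setSum_mul_setSum R T hN hU hdec, midSum_mem_center R T hN hU hdec, ?_⟩
  exact setSum_mul_midSum_mul_mem R T hN hU hdec hU' (E.imUplus_le_imU e)
    (fun q u hu => E.conj_mem_imageL e (fun h hh x hx => E.conj_mem_filt_of_Hplus hh hx) q hu)
    (fun u hu hu' => exists_swap_imU e hu hu')

theorem isUnit_elementS (hE : IsCompactOpen E) (hα : ∀ β, P.root α ≠ (2 : ℕ) • P.root β)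
    {p : ℕ} (hp : p.Prime)
    (hpow : ∀ a, ∀ g ∈ D.U a, Tendsto (fun k : ℕ => g ^ p ^ k) atTop (𝓝 1))
    (R : Type*) [Ring R] (hR : IsUnit (p : R)) : IsUnit (E.elementS R α y e) := by
  have hfN : ((E.imUbar α y e : Subgroup _) : Set (E.L α y e)).Finite := finite_imUbar e hE
  have hfU : ((E.imUplus α y e : Subgroup _) : Set (E.L α y e)).Finite := finite_imUplus e hE
  have hN : ∀ x, x ∈ hfN.toFinset ↔ x ∈ E.imUbar α y e := fun x => hfN.mem_toFinset
  have hU : ∀ x, x ∈ hfU.toFinset ↔ x ∈ E.imUplus α y e := fun x => hfU.mem_toFinset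
  obtain ⟨C, hC, hNC, hUC⟩ := exists_isDecomposedChain α y e hE hα
  rw [elementS_eq_midSum e R hN hU]
  exact isUnit_midSum R (isTriangular e hE) hN hU (exists_decomposition_mul e hE hα) hp hR
    (exists_card_eq_pow e hE hp (hpow _) le_rfl (finite_imUbar e hE))
    (exists_card_eq_pow e hE hp (hpow _) (filtPlus_le_filt _ _) (finite_imUplus e hE)) hC hNC hUC

lemma toHeckeL_mul_bracket (hE : IsCompactOpen E) (R : Type*) [Ring R]
    (s : MonoidAlgebra R (E.TorusQuot α e)) :
    E.toHeckeL R α y e s * E.bracket R (E.imUplus α y e) =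
      E.bracket R (E.imUplus α y e) * E.toHeckeL R α y e s := by
  have hfU : ((E.imUplus α y e : Subgroup _) : Set (E.L α y e)).Finite := finite_imUplus e hE
  have hU : ∀ x, x ∈ hfU.toFinset ↔ x ∈ E.imUplus α y e := fun x => hfU.mem_toFinset
  have T := isTriangular (α := α) (y := y) e hE
  rw [bracket_eq_setSum e R hU]
  have hsingle : ∀ (g : E.L α y e) (r : R), MonoidAlgebra.single g r * setSum R hfU.toFinset =
      MonoidAlgebra.single 1 r * (MonoidAlgebra.of R _ g * setSum R hfU.toFinset) := by
    intro g r
    rw [← mul_assoc, MonoidAlgebra.of_apply, MonoidAlgebra.single_mul_single, one_mul, mul_one]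
  have hcomm : ∀ r : R, MonoidAlgebra.single (1 : E.L α y e) r * setSum R hfU.toFinset =
      setSum R hfU.toFinset * MonoidAlgebra.single 1 r := by
    intro r
    rw [setSum, Finset.mul_sum, Finset.sum_mul]
    refine Finset.sum_congr rfl fun x _ => ?_
    simp [MonoidAlgebra.of_apply, MonoidAlgebra.single_mul_single]
  induction s using MonoidAlgebra.induction_linear with
  | zero => simp
  | add f g hf hg => rw [map_add, add_mul, mul_add, hf, hg]
  | single q r =>
    have h1 : E.toHeckeL R α y e (MonoidAlgebra.single q r) =
        MonoidAlgebra.single (E.torusToL α y e q) r := by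
      simp [toHeckeL]
    rw [h1, hsingle, of_mul_setSum_eq R hU hU (T.conjU q)
      (fun x hx => by simpa using T.conjU q⁻¹ x hx), ← mul_assoc, hcomm, mul_assoc,
      MonoidAlgebra.of_apply, MonoidAlgebra.single_mul_single, one_mul, mul_one]

/-- The identity (c) is multiplied by S⁻¹ on the right; S commutes with [U_{α,r+}], so S and S⁻¹
cancel. -/
theorem exists_bracket_mul_bracket_eq (hE : IsCompactOpen E)
    (hα : ∀ β, P.root α ≠ (2 : ℕ) • P.root β) (R : Type*) [Ring R]
    (hS : IsUnit (E.elementS R α y e)) : ∃ f : MonoidAlgebra R (E.L α y e),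
      E.bracket R (E.imUbar α y e) * E.bracket R (E.imUplus α y e) =
        E.bracket R (E.imUbar α y e) * E.bracket R (E.imU α y e) * f := by
  obtain ⟨_, _, f, hf⟩ := bracket_identities (α := α) (y := y) e hE hα R
  obtain ⟨s, hs⟩ := hS
  refine ⟨f * E.toHeckeL R α y e (s⁻¹ : (MonoidAlgebra R (E.TorusQuot α e))ˣ), ?_⟩
  rw [← mul_assoc, ← hf, mul_assoc _ _ (E.bracket R (E.imUplus α y e)), toHeckeL_mul_bracket e hE,
    ← hs, mul_assoc, mul_assoc, ← map_mul, Units.mul_inv, map_one, mul_one]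

end Crystallographic

end Prolongation

end GroupAlgebra

end BruhatTits

/-- Nilpotency of g - 1 over the algebraic closure descends to F, where the limit is taken. -/
theorem LinAlgGroup.IsUnipotentGroup.tendsto_pow {F : Type*} [NontriviallyNormedField F]
    [IsUltrametricDist F] {p : ℕ} (hp : p.Prime) (hpF : ‖(p : F)‖ < 1) {n : ℕ}
    {𝒢 X : Subgroup (GL (Fin n) (AlgebraicClosure F))} (hX : LinAlgGroup.IsUnipotentGroup X)
    {g : LinAlgGroup.rationalPoints F 𝒢} (hg : g ∈ LinAlgGroup.rationalSubgroup F 𝒢 X) :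
    Filter.Tendsto (fun k : ℕ => g ^ p ^ k) Filter.atTop (nhds 1) := by
  rw [tendsto_subtype_rng]
  have h1 : IsNilpotent (((g : GL (Fin n) F) : Matrix (Fin n) (Fin n) F) - 1) := by
    have h2 := hX _ hg
    have h3 : (((LinAlgGroup.toClosure F) (g : GL (Fin n) F) :
        GL (Fin n) (AlgebraicClosure F)) : Matrix (Fin n) (Fin n) (AlgebraicClosure F)) - 1 =
        (algebraMap F (AlgebraicClosure F)).mapMatrix
          (((g : GL (Fin n) F) : Matrix (Fin n) (Fin n) F) - 1) := by
      rw [map_sub, map_one]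
      rfl
    have h4 : IsNilpotent ((algebraMap F (AlgebraicClosure F)).mapMatrix
          (((g : GL (Fin n) F) : Matrix (Fin n) (Fin n) F) - 1)) := by
      rw [← h3]; exact h2
    refine (IsNilpotent.map_iff ?_).1 h4
    exact Matrix.map_injective (algebraMap F (AlgebraicClosure F)).injective
  simpa using LinAlgGroup.tendsto_unipotent_pow hp hpF h1

end

/-! ### The theorem for reductive groups over local fields. -/

theorem mainTheorem7
    {F : Type*} [NontriviallyNormedField F] [IsUltrametricDist F] [ProperSpace F]
    {p : ℕ} (hp : p.Prime) (hpF : ‖(p : F)‖ < 1)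
    {n : ℕ} (𝒢 S : Subgroup (GL (Fin n) (AlgebraicClosure F)))
    (h𝒢 : LinAlgGroup.IsConnectedReductive F 𝒢)
    (hS : LinAlgGroup.IsMaximalSplitTorus F 𝒢 S)
    {ι V W : Type*} [Finite ι] [AddCommGroup V] [Module ℝ V] [AddCommGroup W] [Module ℝ W]
    (P : RootPairing ι ℝ V W) [P.IsRootSystem] [P.IsCrystallographic]
    (χ : ι → (S →* (AlgebraicClosure F)ˣ))
    (hχ : LinAlgGroup.IsRelativeRootSystem 𝒢 S P χ)
    (D : BruhatTits.GroupRootDatum P (LinAlgGroup.rationalPoints F 𝒢))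
    (hD : BruhatTits.IsRootDatumOf F 𝒢 S χ D)
    (φ : BruhatTits.RootDatumValuation D)
    (hφ : BruhatTits.IsCompatibleValuation F χ φ)
    (E : BruhatTits.Prolongation φ)
    (hE : BruhatTits.IsCompactOpenProP F p E)
    (α : ι) (hα : ∀ β, P.root α ≠ (2 : ℕ) • P.root β)
    (y : W) (e : ℝ≥0) :
    -- the sums are finite, and the decomposition that defines `t(x, x̄)` exists and is unique
    Finite (E.imU α y e) ∧ Finite (E.imUplus α y e) ∧ Finite (E.imUbar α y e) ∧
    (∀ x ∈ E.imUplus α y e, ∀ xbar ∈ E.imUbar α y e,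
      ∃! q : E.imUbar α y e × E.TorusQuot α e × E.imUplus α y e,
        x * xbar = q.1 * E.torusToL α y e q.2.1 * q.2.2) ∧
    -- (a), (b), (c), for arbitrary coefficient rings
    (∀ (R : Type*) [Ring R],
      (E.bracket R (E.imUbar α y e) * E.bracket R (E.imUplus α y e)) ^ 2 =
          E.bracket R (E.imUbar α y e) * E.toHeckeL R α y e (E.elementS R α y e) *
            E.bracket R (E.imUplus α y e) ∧
      E.elementS R α y e ∈ Subring.center (MonoidAlgebra R (E.TorusQuot α e)) ∧
      ∃ f : MonoidAlgebra R (E.L α y e),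
        E.bracket R (E.imUbar α y e) * E.toHeckeL R α y e (E.elementS R α y e) *
            E.bracket R (E.imUplus α y e) =
          E.bracket R (E.imUbar α y e) * E.bracket R (E.imU α y e) * f) ∧
    -- (d)
    (∀ l : ℕ, l.Prime → l ≠ p → IsUnit (E.elementS (ZMod l) α y e)) ∧
    -- (e)
    IsUnit (E.elementS (Localization.Away (p : ℤ)) α y e) ∧
    -- (e) and its consequence for arbitrary coefficient rings in which `p` is invertible
    (∀ (R : Type*) [Ring R], IsUnit (p : R) →
      IsUnit (E.elementS R α y e) ∧
      ∃ f : MonoidAlgebra R (E.L α y e),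
        E.bracket R (E.imUbar α y e) * E.bracket R (E.imUplus α y e) =
          E.bracket R (E.imUbar α y e) * E.bracket R (E.imU α y e) * f) := by
  have hC : BruhatTits.IsCompactOpen E :=
    ⟨fun _ hO => LinAlgGroup.exists_open_subgroup _ hO, hφ.compact, hφ.isOpen, hE.compact,
      hE.isOpen⟩
  have hpow : ∀ a, ∀ g ∈ D.U a,
      Filter.Tendsto (fun k : ℕ => g ^ p ^ k) Filter.atTop (nhds 1) := by
    intro a g hg
    obtain ⟨X, hX, hU⟩ := hD.U_eq a
    rw [hU] at hg
    exact hX.unipotent.tendsto_pow hp hpF hg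
  refine ⟨BruhatTits.Prolongation.finite_imU e hC, BruhatTits.Prolongation.finite_imUplus e hC,
    BruhatTits.Prolongation.finite_imUbar e hC, fun x hx xbar hxbar =>
      BruhatTits.Prolongation.existsUnique_decomposition e hC hα hx hxbar, fun R _ =>
      BruhatTits.Prolongation.bracket_identities e hC hα R, fun l hl hlp => ?_, ?_, fun R _ hR =>
      ?_⟩
  · have : Fact l.Prime := ⟨hl⟩
    refine BruhatTits.Prolongation.isUnit_elementS e hC hα hp hpow _ ?_
    exact (ZMod.isUnit_iff_coprime p l).2 ((Nat.coprime_primes hp hl).2 hlp.symm)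
  · refine BruhatTits.Prolongation.isUnit_elementS e hC hα hp hpow _ ?_
    simpa using IsLocalization.Away.algebraMap_isUnit (S := Localization.Away (p : ℤ)) (p : ℤ)
  · have hS := BruhatTits.Prolongation.isUnit_elementS (α := α) (y := y) e hC hα hp hpow R hR
    exact ⟨hS, BruhatTits.Prolongation.exists_bracket_mul_bracket_eq e hC hα R hS⟩
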